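/- Let $H$ be a graph. For a finite graph $F$ let $n_H(F)$ denote the number of subgraphs of $F$ isomorphic to $H$. The $H$-bootstrap process on a finite graph $G$ is the sequence of graphs $(G_i)_{i\ge 0}$ on the vertex set $V(G)$ with $G_0=G$ and $$E(G_{i+1})=E(G_i)\cup\Big\{e\in\tbinom{V(G)}{2}: n_H(G_i+e)>n_H(G_i)\Big\}\qquad(i\ge 0).$$ Its running time is $\tau_H(G)=\min\{t\ge 0: G_t=G_{t+1}\}$, and $M_H(n)=\max_{|V(G)|=n}\tau_H(G)$ is the maximum running time over all graphs $G$ with $n$ vertices. Let $C_k$ denote the cycle of length $k$. **Theorem.** Let $k\ge 3$. There is an $N$, depending only on $k$, such that for all integers $n\ge N$ $$M_{C_k}(n)=\begin{cases}\left\lceil \log_{k-1}\left(n+k^2-4k+2\right)\right\rceil & \text{if } k \text{ is odd},\\[2pt] \left\lceil \log_{k-1}\left(2n+k^2-5k\right)\right\rceil & \text{if } k \text{ is even}.\end{cases}$$ -/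

import Mathlib

namespace SimpleGraph

variable {V W : Type*} [Fintype V]

/-- One round of the `H`-bootstrap percolation process on `G`: every pair `e` of distinct vertices
such that `G + e` contains more copies of `H` than `G` is added to `G` as an edge, all of them
simultaneously (`fromEdgeSet` discards the degenerate pairs). -/
def bootstrapStep (H : SimpleGraph W) (G : SimpleGraph V) : SimpleGraph V :=
  G ⊔ fromEdgeSet {e : Sym2 V | G.copyCount H < (G ⊔ fromEdgeSet {e}).copyCount H}

/-- The `H`-bootstrap percolation process `G₀ = G, G₁, G₂, …` with starting graph `G`. -/
def bootstrapProcess (H : SimpleGraph W) (G : SimpleGraph V) : ℕ → SimpleGraph V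
  | 0 => G
  | i + 1 => bootstrapStep H (bootstrapProcess H G i)

/-- On a finite vertex set the process stabilises. -/
theorem exists_bootstrapProcess_eq (H : SimpleGraph W) (G : SimpleGraph V) :
    ∃ t, bootstrapProcess H G t = bootstrapProcess H G (t + 1) := by
  have hm : Monotone (bootstrapProcess H G) := monotone_nat_of_le_succ fun _ => le_sup_left
  obtain ⟨t, ht⟩ := WellFoundedGT.monotone_chain_condition ⟨_, hm⟩
  exact ⟨t, ht (t + 1) t.le_succ⟩

open Classical in
/-- The running time `τ_H(G) = min {t : G_t = G_{t+1}}` of the `H`-bootstrap process on `G`. -/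
noncomputable def bootstrapTime (H : SimpleGraph W) (G : SimpleGraph V) : ℕ :=
  Nat.find (exists_bootstrapProcess_eq H G)

open Classical in
/-- `M_H(n)`: the maximum running time of the `H`-bootstrap process over all starting graphs with
`n` vertices (there are finitely many graphs on `Fin n`, and at least one). -/
noncomputable def maxBootstrapTime (H : SimpleGraph W) (n : ℕ) : ℕ :=
  (Finset.univ : Finset (SimpleGraph (Fin n))).sup (bootstrapTime H)

end SimpleGraph

/-! A round adds exactly the pairs joined by a path with `k - 1` edges
(`bootstrapStep_cycleGraph_adj`), so the reach grows at most by the factor `k - 1` per round. This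
gives the logarithm; the additive constants come from lengths that cannot be hit exactly. In a
concatenation of jumps of length `k - 1`, replacing one jump by a unit step forwards loses `k - 2`,
by a unit step backwards `k`. So the displacements along a path at time `t` are `(k - 1) ^ t` minus
members of the numerical semigroup generated by `k - 2` and `k`.

Upper bounds. After boundedly many rounds, new edges occur only in components with more than `k`
vertices and a path on `k` vertices. There the final graph joins any two distinct vertices if `k` is
odd, and any two that are ends of an odd walk if `k` is even (`CycleStable.adj_of_walk`); for short
walks this happens in bounded time (`cycleProc_adj_of_short_walk`). Long distances are covered by
jumps with prescribed loss (`exists_jump_range`).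

Odd `k`: the semigroup has largest gap `k ^ 2 - 4 * k + 2`, and a path has at most `n - 1` edges.
This settles the upper bound. It is attained by the path graph: a pair at distance `(k - 1) ^ t`
minus that gap is still missing at time `t` (`cycleProc_pathGraph_defect`).

Even `k`: edges only join ends of odd walks, and a shortest odd walk may revisit vertices. All its
coincidences are reflections in one centre (`Walk.exists_center`), so it is a `Fold`: two paths that
share vertices only at equal indices. A path of jumps through the fold must not use the same index
on both sides, and this costs `(k - 1) * (k - 4)` in total (`Fold.exists_adj`). The extremal graph
is a path folded onto itself, with an edge at the near end and twins at the far end. Unfold it to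
the integers: in the first round a crossing path must have an end at level `0`, since otherwise it
would repeat a vertex. Hence the losses on the two sides of the fold obey separate equations
(`Crossing`), and for the chosen twins one of the two asks for a gap of the semigroup
(`not_crossing`). -/

namespace SimpleGraph

/-! ### One round of the process in terms of paths -/

/-- A path with `m` edges from `u` to `v`, given by its sequence of vertices. -/
def HasPath {V : Type*} (G : SimpleGraph V) (m : ℕ) (u v : V) : Prop :=
  ∃ p : ℕ → V, p 0 = u ∧ p m = v ∧ (∀ j < m, G.Adj (p j) (p (j + 1))) ∧ Set.InjOn p (Set.Iic m)

/-- Subgraphs of `G` isomorphic to `H` inject into those of `G'`, so the count grows iff some copy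
in `G'` is not the image of one in `G`, that is, uses an edge outside `G`. -/
theorem copyCount_lt_copyCount_iff {V W : Type*} [Fintype V] {G G' : SimpleGraph V} (h : G ≤ G')
    (H : SimpleGraph W) :
    G.copyCount H < G'.copyCount H ↔
      ∃ f : Copy H G', ∃ a b, H.Adj a b ∧ ¬ G.Adj (f a) (f b) := by
  classical
  set φ : G.Subgraph → G'.Subgraph := fun S => S.map (Hom.ofLE h) with hφ
  have hinj : Function.Injective φ := by
    intro S T hST
    ext x y
    · simpa [hφ] using congrArg (fun R => x ∈ R.verts) hST
    · simpa [hφ, Relation.map_id_id, Relation.Map] using congrArg (fun R => R.Adj x y) hST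
  have hsub : (Finset.univ.filter fun S : G.Subgraph => Nonempty (H ≃g S.coe)).image φ ⊆
      Finset.univ.filter fun S : G'.Subgraph => Nonempty (H ≃g S.coe) := by
    intro S hS
    simp only [Finset.mem_image, Finset.mem_filter, Finset.mem_univ, true_and] at hS ⊢
    obtain ⟨T, ⟨e⟩, rfl⟩ := hS
    exact ⟨((Copy.ofLE _ _ h).isoSubgraphMap T).comp e⟩
  have hc : G.copyCount H = ((Finset.univ.filter
      fun S : G.Subgraph => Nonempty (H ≃g S.coe)).image φ).card := by
    rw [Finset.card_image_of_injective _ hinj]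
    unfold copyCount
    congr
  have hc' : G'.copyCount H = (Finset.univ.filter
      fun S : G'.Subgraph => Nonempty (H ≃g S.coe)).card := by
    unfold copyCount
    congr
  rw [hc, hc']
  constructor
  · intro hlt
    by_contra hcon
    push Not at hcon
    refine hlt.not_ge (Finset.card_le_card ?_)
    intro S hS
    simp only [Finset.mem_image, Finset.mem_filter, Finset.mem_univ, true_and] at hS ⊢
    have hS' : S ∈ Set.range (Copy.toSubgraph (A := H) (B := G')) := by
      rw [Copy.range_toSubgraph]; exact hS
    obtain ⟨f, rfl⟩ := hS'
    let g : Copy H G := ⟨⟨f, fun {a b} hab => hcon f a b hab⟩, f.injective⟩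
    refine ⟨g.toSubgraph, ⟨g.isoToSubgraph⟩, ?_⟩
    simp only [hφ, Copy.toSubgraph, ← Subgraph.map_comp]
    rfl
  · rintro ⟨f, a, b, hab, hn⟩
    refine Finset.card_lt_card ⟨hsub, fun hle => hn ?_⟩
    have := @hle f.toSubgraph (by simpa using ⟨f.isoToSubgraph⟩)
    simp only [Finset.mem_image, Finset.mem_filter, Finset.mem_univ, true_and] at this
    obtain ⟨T, -, hT⟩ := this
    have hadj : f.toSubgraph.Adj (f a) (f b) := by
      simp only [Copy.toSubgraph, Subgraph.map_adj]
      exact ⟨a, b, hab, rfl, rfl⟩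
    rw [← hT] at hadj
    simp only [hφ, Subgraph.map_adj] at hadj
    obtain ⟨x, y, hxy, hx, hy⟩ := hadj
    simp at hx hy
    rw [← hx, ← hy]
    exact hxy.adj_sub

theorem cycleGraph_adj_iff_val {k : ℕ} (hk : 3 ≤ k) (a b : Fin k) :
    (cycleGraph k).Adj a b ↔ (b : ℕ) = (a + 1) % k ∨ (a : ℕ) = (b + 1) % k := by
  obtain ⟨n, rfl⟩ : ∃ n, k = n + 2 := ⟨k - 2, by omega⟩
  rw [cycleGraph_adj, or_comm, sub_eq_iff_eq_add', sub_eq_iff_eq_add', Fin.ext_iff, Fin.ext_iff,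
    Fin.val_add, Fin.val_add]
  simp

theorem hasPath_symm {V : Type*} {G : SimpleGraph V} {m : ℕ} {u v : V} (h : G.HasPath m u v) :
    G.HasPath m v u := by
  obtain ⟨p, rfl, rfl, hadj, hinj⟩ := h
  refine ⟨fun j => p (m - j), by simp, by simp, fun j hj => ?_, ?_⟩
  · have := (hadj (m - (j + 1)) (by omega)).symm
    rwa [show m - (j + 1) + 1 = m - j by omega] at this
  · intro a ha b hb hab
    simp only [Set.mem_Iic] at ha hb
    have := hinj (by simp) (by simp) hab
    omega

/-- A new copy of the cycle must use the added edge; deleting that edge leaves a path with `k - 1`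
edges between its ends, and conversely. -/
theorem bootstrapStep_cycleGraph_adj {V : Type*} [Fintype V] {k : ℕ} (hk : 3 ≤ k)
    (G : SimpleGraph V) (u v : V) :
    (bootstrapStep (cycleGraph k) G).Adj u v ↔ G.Adj u v ∨ G.HasPath (k - 1) u v := by
  have hkey : ∀ u v : V, u ≠ v → ¬ G.Adj u v →
      (G.copyCount (cycleGraph k) < (G ⊔ fromEdgeSet {s(u, v)}).copyCount (cycleGraph k) ↔
        G.HasPath (k - 1) u v) := by
    intro u v huv hn
    rw [copyCount_lt_copyCount_iff le_sup_left]
    constructor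
    · rintro ⟨f, a, b, hab, hnf⟩
      wlog hb : (b : ℕ) = (a + 1) % k generalizing a b
      · exact this b a hab.symm (fun h => hnf h.symm)
          (((cycleGraph_adj_iff_val hk a b).1 hab).resolve_left hb)
      have hf : s(f a, f b) = s(u, v) := by
        have := f.toHom.map_adj hab
        simp only [sup_adj, fromEdgeSet_adj, Set.mem_singleton_iff] at this
        exact (this.resolve_left hnf).1
      have hpos : 0 < k := by omega
      have hpath : G.HasPath (k - 1) (f b) (f a) := by
        refine ⟨fun j => f ⟨(b + j) % k, Nat.mod_lt _ hpos⟩, ?_, ?_, ?_, ?_⟩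
        · simp [Nat.mod_eq_of_lt b.2]
        · have : (⟨(b + (k - 1)) % k, Nat.mod_lt _ hpos⟩ : Fin k) = a := by
            ext
            simp only [hb]
            rw [Nat.mod_add_mod, show (a : ℕ) + 1 + (k - 1) = a + k by omega,
              Nat.add_mod_right, Nat.mod_eq_of_lt a.2]
          simp only [this]
        · intro j hj
          have hadj : (cycleGraph k).Adj ⟨(b + j) % k, Nat.mod_lt _ hpos⟩
              ⟨(b + (j + 1)) % k, Nat.mod_lt _ hpos⟩ := by
            rw [cycleGraph_adj_iff_val hk]
            left
            simp [← add_assoc]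
          have h1 := f.toHom.map_adj hadj
          simp only [sup_adj, fromEdgeSet_adj, Set.mem_singleton_iff] at h1
          -- The copy is traversed from `b` round to `a = b - 1`, so the `k - 1` steps taken omit
          -- the cycle edge `ab`; a step on the added edge would, by injectivity of `f`, be `ab`
          -- itself.
          refine h1.resolve_right fun h2 => ?_
          have h3 := h2.1.trans hf.symm
          have hmod : ((b : ℕ) + j) % k = b + j ∨ k ≤ b + j ∧ ((b : ℕ) + j) % k = b + j - k := by
            rcases lt_or_ge ((b : ℕ) + j) k with h | h
            · left; exact Nat.mod_eq_of_lt h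
            · right; exact ⟨h, by rw [Nat.mod_eq_sub_mod h, Nat.mod_eq_of_lt (by omega)]⟩
          have hmod' : ((b : ℕ) + (j + 1)) % k = b + (j + 1) ∨
              k ≤ b + (j + 1) ∧ ((b : ℕ) + (j + 1)) % k = b + (j + 1) - k := by
            rcases lt_or_ge ((b : ℕ) + (j + 1)) k with h | h
            · left; exact Nat.mod_eq_of_lt h
            · right; exact ⟨h, by rw [Nat.mod_eq_sub_mod h, Nat.mod_eq_of_lt (by omega)]⟩
          have hba : (b : ℕ) = a + 1 ∨ (b : ℕ) = 0 ∧ (a : ℕ) + 1 = k := by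
            rcases lt_or_ge ((a : ℕ) + 1) k with h | h
            · left; rw [hb]; exact Nat.mod_eq_of_lt h
            · right
              have : (a : ℕ) + 1 = k := by omega
              exact ⟨by rw [hb, this, Nat.mod_self], this⟩
          have l1 := Nat.mod_lt ((b : ℕ) + j) hpos
          have l2 := Nat.mod_lt ((b : ℕ) + (j + 1)) hpos
          rw [Sym2.eq_iff] at h3
          rcases h3 with ⟨e1, e2⟩ | ⟨e1, e2⟩
          · have e3 : ((b : ℕ) + j) % k = a := congrArg Fin.val (f.injective e1)
            have e4 : ((b : ℕ) + (j + 1)) % k = b := congrArg Fin.val (f.injective e2)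
            rw [e3] at hmod l1
            rw [e4] at hmod' l2
            clear e3 e4 hb
            omega
          · have e3 : ((b : ℕ) + j) % k = b := congrArg Fin.val (f.injective e1)
            have e4 : ((b : ℕ) + (j + 1)) % k = a := congrArg Fin.val (f.injective e2)
            rw [e3] at hmod l1
            rw [e4] at hmod' l2
            clear e3 e4 hb
            omega
        · intro x hx y hy hxy
          simp only [Set.mem_Iic] at hx hy
          have := congrArg Fin.val (f.injective hxy)
          simp only at this
          have h4 : (b + x) ≡ b + y [MOD k] := this
          have h5 := Nat.ModEq.add_left_cancel' (b : ℕ) h4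
          exact Nat.ModEq.eq_of_lt_of_lt h5 (by omega) (by omega)
      rw [Sym2.eq_iff] at hf
      rcases hf with ⟨h1, h2⟩ | ⟨h1, h2⟩
      · rw [h1, h2] at hpath; exact hasPath_symm hpath
      · rw [h1, h2] at hpath; exact hpath
    · rintro ⟨p, hp0, hpk, hadj, hinj⟩
      have hpos : 0 < k := by omega
      have hstep : ∀ a b : Fin k, (b : ℕ) = (a + 1) % k →
          (G ⊔ fromEdgeSet {s(u, v)}).Adj (p a) (p b) := by
        intro a b hb
        rcases lt_or_ge ((a : ℕ) + 1) k with h | h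
        · rw [Nat.mod_eq_of_lt h] at hb
          rw [hb]
          exact Or.inl (hadj _ (by omega))
        · have ha : (a : ℕ) = k - 1 := by omega
          have hb0 : (b : ℕ) = 0 := by rw [hb, ha, Nat.sub_add_cancel (by omega), Nat.mod_self]
          rw [ha, hb0, hp0, hpk]
          right
          simp only [fromEdgeSet_adj, Set.mem_singleton_iff]
          exact ⟨Sym2.eq_swap, huv.symm⟩
      refine ⟨⟨⟨fun a => p a, ?_⟩, ?_⟩, ⟨k - 1, by omega⟩, ⟨0, hpos⟩, ?_, ?_⟩
      · intro a b hab
        rcases (cycleGraph_adj_iff_val hk a b).1 hab with h | h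
        · exact hstep a b h
        · exact (hstep b a h).symm
      · intro a b hab
        have h1 := a.2
        have h2 := b.2
        exact Fin.ext (hinj (by simp; omega) (by simp; omega) hab)
      · rw [cycleGraph_adj_iff_val hk]
        left
        simp [Nat.sub_add_cancel (show 1 ≤ k by omega)]
      · change ¬ G.Adj (p (k - 1)) (p 0)
        rw [hp0, hpk]
        exact fun h => hn h.symm
  unfold bootstrapStep
  rw [sup_adj, fromEdgeSet_adj, Set.mem_ofPred_eq]
  constructor
  · rintro (h | ⟨h, huv⟩)
    · exact Or.inl h
    · by_cases hn : G.Adj u v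
      · exact Or.inl hn
      · exact Or.inr ((hkey u v huv hn).1 h)
  · rintro (h | h)
    · exact Or.inl h
    · by_cases hn : G.Adj u v
      · exact Or.inl hn
      · have huv : u ≠ v := by
          obtain ⟨p, rfl, rfl, -, hinj⟩ := h
          intro he
          have := hinj (by simp) (by simp) he
          omega
        exact Or.inr ⟨(hkey u v huv hn).2 h, huv⟩

/-- The `C_k`-bootstrap process. -/
abbrev cycleProc {V : Type*} [Fintype V] (k : ℕ) (G : SimpleGraph V) (i : ℕ) : SimpleGraph V :=
  bootstrapProcess (cycleGraph k) G i

/-- `G` is stable if the `C_k`-bootstrap process does not add any edge to it. -/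
def CycleStable {V : Type*} (k : ℕ) (G : SimpleGraph V) : Prop :=
  ∀ u v, G.HasPath (k - 1) u v → G.Adj u v

/-! ### General properties of the process -/

section process

variable {V : Type*} [Fintype V] {k : ℕ}

theorem cycleProc_succ_adj (hk : 3 ≤ k) (G : SimpleGraph V) (i : ℕ) (u v : V) :
    (cycleProc k G (i + 1)).Adj u v ↔
      (cycleProc k G i).Adj u v ∨ (cycleProc k G i).HasPath (k - 1) u v :=
  bootstrapStep_cycleGraph_adj hk _ u v

theorem cycleProc_mono (G : SimpleGraph V) : Monotone (cycleProc k G) :=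
  monotone_nat_of_le_succ fun _ => le_sup_left

theorem cycleProc_adj_of_le {G : SimpleGraph V} {i j : ℕ} (hij : i ≤ j) {u v : V}
    (h : (cycleProc k G i).Adj u v) : (cycleProc k G j).Adj u v :=
  cycleProc_mono G hij h

theorem HasPath.map {V' V : Type*} {G' : SimpleGraph V'} {G : SimpleGraph V} {f : V' → V}
    (hf : Function.Injective f) (h : ∀ a b, G'.Adj a b → G.Adj (f a) (f b)) {m : ℕ} {u v : V'}
    (hp : G'.HasPath m u v) : G.HasPath m (f u) (f v) := by
  obtain ⟨p, rfl, rfl, hadj, hinj⟩ := hp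
  exact ⟨f ∘ p, rfl, rfl, fun j hj => h _ _ (hadj j hj), hf.comp_injOn hinj⟩

theorem cycleProc_map {V' : Type*} [Fintype V'] (hk : 3 ≤ k) {G' : SimpleGraph V'}
    {G : SimpleGraph V} {f : V' → V} (hf : Function.Injective f)
    (h : ∀ a b, G'.Adj a b → G.Adj (f a) (f b)) (i : ℕ) :
    ∀ a b, (cycleProc k G' i).Adj a b → (cycleProc k G i).Adj (f a) (f b) := by
  induction i with
  | zero => exact h
  | succ i ih =>
    intro a b hab
    rw [cycleProc_succ_adj hk] at hab ⊢
    exact hab.imp (ih a b) (HasPath.map hf ih)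

theorem exists_walk_of_seq {V : Type*} {G : SimpleGraph V} (p : ℕ → V) (m : ℕ)
    (h : ∀ j < m, G.Adj (p j) (p (j + 1))) : ∃ q : G.Walk (p 0) (p m), q.length = m := by
  induction m with
  | zero => exact ⟨.nil, rfl⟩
  | succ m ih =>
    obtain ⟨q, hq⟩ := ih fun j hj => h j (by omega)
    exact ⟨q.concat (h m (by omega)), by simp [hq]⟩

theorem cycleProc_reachable (hk : 3 ≤ k) {G : SimpleGraph V} {i : ℕ} {u v : V}
    (h : (cycleProc k G i).Adj u v) : G.Reachable u v := by
  induction i generalizing u v with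
  | zero => exact h.reachable
  | succ i ih =>
    rw [cycleProc_succ_adj hk] at h
    rcases h with h | ⟨p, rfl, rfl, hadj, -⟩
    · exact ih h
    · have : ∀ j ≤ k - 1, G.Reachable (p 0) (p j) := by
        intro j hj
        induction j with
        | zero => exact .rfl
        | succ j ihj => exact (ihj (by omega)).trans (ih (hadj j (by omega)))
      exact this _ le_rfl

/-- For even `k` a new edge replaces `k - 1` edges, an odd number, so parity of walks is preserved.
-/
theorem cycleProc_odd_walk (hk : 3 ≤ k) (hke : Even k) {G : SimpleGraph V} {i : ℕ} {u v : V}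
    (h : (cycleProc k G i).Adj u v) : ∃ p : G.Walk u v, Odd p.length := by
  induction i generalizing u v with
  | zero =>
    change G.Adj u v at h
    exact ⟨h.toWalk, by simp⟩
  | succ i ih =>
    rw [cycleProc_succ_adj hk] at h
    rcases h with h | ⟨p, rfl, rfl, hadj, -⟩
    · exact ih h
    · have : ∀ j ≤ k - 1, ∃ q : G.Walk (p 0) (p j), q.length % 2 = j % 2 := by
        intro j hj
        induction j with
        | zero => exact ⟨.nil, rfl⟩
        | succ j ihj =>
          obtain ⟨q, hq⟩ := ihj (by omega)
          obtain ⟨q', hq'⟩ := ih (hadj j (by omega))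
          refine ⟨q.append q', ?_⟩
          rw [Walk.length_append]
          rw [Nat.odd_iff] at hq'
          omega
      obtain ⟨q, hq⟩ := this _ le_rfl
      refine ⟨q, ?_⟩
      rw [Nat.odd_iff, hq]
      obtain ⟨m, rfl⟩ := hke
      omega

theorem cycleProc_eq_of_stable {G : SimpleGraph V} {s t : ℕ}
    (h : cycleProc k G s = cycleProc k G (s + 1)) (hst : s ≤ t) :
    cycleProc k G t = cycleProc k G s := by
  induction t, hst using Nat.le_induction with
  | base => rfl
  | succ t _ ih =>
    change bootstrapStep _ (cycleProc k G t) = _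
    rw [ih]
    exact h.symm

theorem bootstrapTime_le_iff {G : SimpleGraph V} {t : ℕ} :
    bootstrapTime (cycleGraph k) G ≤ t ↔ cycleProc k G t = cycleProc k G (t + 1) := by
  classical
  constructor
  · intro h
    have h1 := Nat.find_spec (exists_bootstrapProcess_eq (cycleGraph k) G)
    have h2 : bootstrapTime (cycleGraph k) G =
      Nat.find (exists_bootstrapProcess_eq (cycleGraph k) G) := by
      unfold bootstrapTime; congr
    rw [← h2] at h1
    rw [cycleProc_eq_of_stable h1 h, cycleProc_eq_of_stable h1 (h.trans (Nat.le_succ t))]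
  · intro h
    unfold bootstrapTime
    exact Nat.find_min' _ h

theorem cycleProc_stable (hk : 3 ≤ k) {G : SimpleGraph V} {t : ℕ}
    (h : cycleProc k G t = cycleProc k G (t + 1)) : CycleStable k (cycleProc k G t) := by
  intro u v hp
  rw [h, cycleProc_succ_adj hk]
  exact Or.inr hp

/-- Each round that is not yet stable adds an ordered pair of adjacent vertices, and there are only
`|V| ^ 2` pairs. -/
theorem cycleProc_card_sq (G : SimpleGraph V) {t : ℕ} (ht : Fintype.card V ^ 2 ≤ t) :
    cycleProc k G t = cycleProc k G (t + 1) := by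
  by_contra hne
  have hne' : ∀ s ≤ t, cycleProc k G s ≠ cycleProc k G (s + 1) := by
    intro s hs h
    exact hne ((cycleProc_eq_of_stable h hs).trans (cycleProc_eq_of_stable h (by omega)).symm)
  have hcard : ∀ s ≤ t + 1, s ≤ {p : V × V | (cycleProc k G s).Adj p.1 p.2}.ncard := by
    intro s hs
    induction s with
    | zero => exact Nat.zero_le _
    | succ s ih =>
      refine Nat.succ_le_of_lt ((ih (by omega)).trans_lt (Set.ncard_lt_ncard ?_ (Set.toFinite _)))
      refine ⟨fun p hp => cycleProc_adj_of_le (Nat.le_succ s) hp, fun hle => ?_⟩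
      refine hne' s (by omega) (le_antisymm (cycleProc_mono G (Nat.le_succ s)) ?_)
      intro a b hab
      exact hle (show (a, b) ∈ {p : V × V | _} from hab)
  have h1 := hcard (t + 1) le_rfl
  have h2 : {p : V × V | (cycleProc k G (t + 1)).Adj p.1 p.2}.ncard ≤ Fintype.card V ^ 2 := by
    refine (Set.ncard_le_card _).trans ?_
    simp [Nat.card_eq_fintype_card, Fintype.card_prod, sq]
  omega

/-- The process never joins different components, so it can be run in a union of components alone.
-/
theorem cycleProc_induce (hk : 3 ≤ k) {G : SimpleGraph V} {C : Set V} [Fintype C]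
    (hC : ∀ u v, u ∈ C → G.Adj u v → v ∈ C) (i : ℕ) (a b : C) :
    (cycleProc k G i).Adj a b ↔ (cycleProc k (G.induce C) i).Adj a b := by
  have hreach : ∀ u v, G.Reachable u v → u ∈ C → v ∈ C := by
    rintro u v ⟨p⟩ hu
    induction p with
    | nil => exact hu
    | cons h _ ih => exact ih (hC _ _ hu h)
  refine ⟨?_, cycleProc_map hk Subtype.val_injective (fun _ _ h => h) i a b⟩
  induction i generalizing a b with
  | zero => exact id
  | succ i ih =>
    rw [cycleProc_succ_adj hk, cycleProc_succ_adj hk]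
    refine Or.imp (ih a b) ?_
    rintro ⟨p, hp0, hpk, hadj, hinj⟩
    have hmem : ∀ j, j ≤ k - 1 → p j ∈ C := by
      intro j
      induction j with
      | zero => intro _; rw [hp0]; exact a.2
      | succ j ihj =>
        intro hj
        exact hreach _ _ (cycleProc_reachable hk (hadj j (by omega))) (ihj (by omega))
    -- The index is capped at `k - 1` because `p` is uncontrolled beyond and need not stay in `C`.
    refine ⟨fun j => ⟨p (min j (k - 1)), hmem _ (min_le_right _ _)⟩, ?_, ?_, ?_, ?_⟩
    · exact Subtype.ext (by simpa using hp0)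
    · exact Subtype.ext (by simpa using hpk)
    · intro j hj
      refine ih _ _ ?_
      change (cycleProc k G i).Adj (p (min j (k - 1))) (p (min (j + 1) (k - 1)))
      rw [min_eq_left (by omega), min_eq_left (by omega)]
      exact hadj j hj
    · intro x hx y hy hxy
      simp only [Set.mem_Iic] at hx hy
      simp only [Subtype.mk.injEq] at hxy
      rw [min_eq_left hx, min_eq_left hy] at hxy
      exact hinj hx hy hxy

end process

/-! ### Stable graphs containing a cycle of length `k` -/

section core

variable {V : Type*} {G : SimpleGraph V} {k : ℕ}

/-- A cycle of length `k`, parametrised by `ZMod k`. -/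
structure IsCore (G : SimpleGraph V) (f : ZMod k → V) : Prop where
  inj : Function.Injective f
  adj : ∀ a, G.Adj (f a) (f (a + 1))

theorem zmod_natCast_inj {k : ℕ} {i j : ℕ} (hi : i < k) (hj : j < k)
    (h : (i : ZMod k) = j) : i = j :=
  Nat.ModEq.eq_of_lt_of_lt ((ZMod.natCast_eq_natCast_iff _ _ _).1 h) hi hj

theorem CycleStable.exists_isCore [NeZero k] (hk : 3 ≤ k) (hs : CycleStable k G) {u v : V}
    (h : G.HasPath (k - 1) u v) : ∃ f : ZMod k → V, IsCore G f := by
  have huv := hs u v h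
  obtain ⟨p, rfl, rfl, hadj, hinj⟩ := h
  refine ⟨fun a => p a.val, ?_, ?_⟩
  · intro a b hab
    have h1 := ZMod.val_lt a
    have h2 := ZMod.val_lt b
    exact ZMod.val_injective k (hinj (by simp; omega) (by simp; omega) hab)
  · intro a
    have : Fact (1 < k) := ⟨by omega⟩
    have h1 := ZMod.val_lt a
    rcases lt_or_ge (a.val + 1) k with h | h
    · rw [ZMod.val_add_of_lt (by rw [ZMod.val_one]; exact h), ZMod.val_one]
      exact hadj _ (by omega)
    · have h3 : (a + 1).val = 0 := by
        rw [ZMod.val_add, ZMod.val_one, show a.val + 1 = k by omega, Nat.mod_self]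
      rw [h3, show a.val = k - 1 by omega]
      exact huv.symm

/-- Enter the cycle at `f a` and run backwards through all but one of its vertices: the path ends at
`f (a + 2)` and has `k - 1` edges. -/
theorem IsCore.adj_add_two (hk : 3 ≤ k) (hs : CycleStable k G) {f : ZMod k → V}
    (hf : IsCore G f) {x : V} (hx : x ∉ Set.range f) {a : ZMod k} (ha : G.Adj x (f a)) :
    G.Adj x (f (a + 2)) := by
  apply hs
  refine ⟨fun j => if j = 0 then x else f (a - ((j - 1 : ℕ) : ZMod k)), by simp, ?_, ?_, ?_⟩
  · beta_reduce
    rw [if_neg (by omega)]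
    congr 1
    have : ((k - 1 - 1 : ℕ) : ZMod k) + 2 = 0 := by
      have : ((k - 1 - 1 + 2 : ℕ) : ZMod k) = 0 := by
        rw [show k - 1 - 1 + 2 = k by omega]; simp
      exact_mod_cast this
    linear_combination -this
  · intro j hj
    rcases Nat.eq_zero_or_pos j with rfl | hj0
    · simpa using ha
    · beta_reduce
      rw [if_neg (by omega), if_neg (by omega)]
      have := (hf.adj (a - ((j + 1 - 1 : ℕ) : ZMod k))).symm
      convert this using 2
      have : ((j + 1 - 1 : ℕ) : ZMod k) = ((j - 1 : ℕ) : ZMod k) + 1 := by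
        rw [show j + 1 - 1 = (j - 1) + 1 by omega]; push_cast; ring
      rw [this]; ring
  · intro i hi j hj hij
    simp only [Set.mem_Iic] at hi hj
    by_cases h1 : i = 0 <;> by_cases h2 : j = 0
    · omega
    · simp only [h1, h2, if_true, if_false] at hij
      exact absurd ⟨_, hij.symm⟩ hx
    · simp only [h1, h2, if_true, if_false] at hij
      exact absurd ⟨_, hij⟩ hx
    · simp only [h1, h2, if_false] at hij
      have := zmod_natCast_inj (by omega) (by omega) (sub_right_injective (hf.inj hij))
      omega

theorem IsCore.adj_add_two_mul [NeZero k] (hk : 3 ≤ k) (hs : CycleStable k G) {f : ZMod k → V}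
    (hf : IsCore G f) {x : V} (hx : x ∉ Set.range f) {a : ZMod k} (ha : G.Adj x (f a))
    (j : ZMod k) : G.Adj x (f (a + 2 * j)) := by
  have : ∀ n : ℕ, G.Adj x (f (a + 2 * n)) := by
    intro n
    induction n with
    | zero => simpa using ha
    | succ n ih =>
      convert hf.adj_add_two hk hs hx ih using 2
      push_cast; ring
  simpa using this j.val

/-- Since `x` sees `f b` and `f (b + 2)`, it can replace `f (b + 1)` in the cycle. Then `f (b + 1)`
is an outside vertex adjacent to `f b`, and `IsCore.adj_add_two_mul` applies to it. -/
theorem IsCore.adj_core_of_adj [NeZero k] (hk : 3 ≤ k) (hs : CycleStable k G) {f : ZMod k → V}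
    (hf : IsCore G f) {x : V} (hx : x ∉ Set.range f) {b : ZMod k} (hb : G.Adj x (f b))
    (j : ZMod k) (hj : b + 1 ≠ b + 2 * j) : G.Adj (f (b + 1)) (f (b + 2 * j)) := by
  classical
  have : Fact (1 < k) := ⟨by omega⟩
  have hb2 : G.Adj x (f (b + 2)) := hf.adj_add_two hk hs hx hb
  have hx' : ∀ a, f a ≠ x := fun a h => hx ⟨a, h⟩
  have hg : IsCore G (Function.update f (b + 1) x) := by
    constructor
    · intro i j hij
      by_cases h1 : i = b + 1 <;> by_cases h2 : j = b + 1
      · rw [h1, h2]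
      · rw [h1, Function.update_self, Function.update_of_ne h2] at hij
        exact absurd hij.symm (hx' _)
      · rw [h2, Function.update_self, Function.update_of_ne h1] at hij
        exact absurd hij (hx' _)
      · rw [Function.update_of_ne h1, Function.update_of_ne h2] at hij
        exact hf.inj hij
    · intro a
      by_cases h1 : a = b + 1
      · have h2 : a + 1 ≠ b + 1 := by rw [h1]; simp
        rw [Function.update_of_ne h2, h1, Function.update_self]
        convert hb2 using 2
        ring
      · rw [Function.update_of_ne h1]
        by_cases h2 : a + 1 = b + 1
        · rw [h2, Function.update_self, add_right_cancel h2]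
          exact hb.symm
        · rw [Function.update_of_ne h2]
          exact hf.adj a
  have hy : f (b + 1) ∉ Set.range (Function.update f (b + 1) x) := by
    rintro ⟨a, ha⟩
    by_cases h1 : a = b + 1
    · rw [h1, Function.update_self] at ha
      exact hx' _ ha.symm
    · rw [Function.update_of_ne h1] at ha
      exact h1 (hf.inj ha)
  have hadj : G.Adj (f (b + 1)) (Function.update f (b + 1) x b) := by
    rw [Function.update_of_ne (by simp)]
    exact (hf.adj b).symm
  have := hg.adj_add_two_mul hk hs hy hadj j
  rwa [Function.update_of_ne (fun h => hj h.symm)] at this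

theorem zmod_exists_two_mul [NeZero k] (a : ZMod k) : ∃ i : ZMod k, a = 2 * i ∨ a = 1 + 2 * i := by
  refine ⟨((a.val / 2 : ℕ) : ZMod k), ?_⟩
  rcases Nat.mod_two_eq_zero_or_one a.val with h | h
  · left
    calc a = ((a.val : ℕ) : ZMod k) := by simp
      _ = ((2 * (a.val / 2) : ℕ) : ZMod k) := by congr 1; omega
      _ = _ := by push_cast; ring
  · right
    calc a = ((a.val : ℕ) : ZMod k) := by simp
      _ = ((1 + 2 * (a.val / 2) : ℕ) : ZMod k) := by congr 1; omega
      _ = _ := by push_cast; ring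

/-- By `IsCore.adj_add_two_mul` the neighbour `b` may be moved by even amounts. So one of the two
ends can be taken as the replaced vertex, depending on the parity class of `a - b`. -/
theorem IsCore.adj_core [NeZero k] (hk : 3 ≤ k) (hs : CycleStable k G) {f : ZMod k → V}
    (hf : IsCore G f) {x : V} (hx : x ∉ Set.range f) {b : ZMod k} (hb : G.Adj x (f b))
    (a j : ZMod k) (hj : a ≠ a + 1 + 2 * j) : G.Adj (f a) (f (a + 1 + 2 * j)) := by
  obtain ⟨i, hi | hi⟩ := zmod_exists_two_mul (a - b)
  · have h := hf.adj_core_of_adj hk hs hx (hf.adj_add_two_mul hk hs hx hb (i + j)) (-j) ?_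
    · convert h.symm using 2
      · linear_combination hi
      · linear_combination hi
    · intro h; apply hj; linear_combination -h
  · have h := hf.adj_core_of_adj hk hs hx (hf.adj_add_two_mul hk hs hx hb i) (j + 1) ?_
    · convert h using 2
      · linear_combination hi
      · linear_combination hi
    · intro h; apply hj; linear_combination h

/-- The path that runs through `k - 2` consecutive vertices of the core, between two vertices
outside of it. -/
theorem IsCore.hasPath_outside (hk : 3 ≤ k) {f : ZMod k → V} (hf : IsCore G f) {x y : V}
    (hx : x ∉ Set.range f) (hy : y ∉ Set.range f) (hxy : x ≠ y) {a : ZMod k}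
    (ha : G.Adj x (f a)) (hb : G.Adj (f (a - 3)) y) : G.HasPath (k - 1) x y := by
  refine ⟨fun j => if j = 0 then x else if j = k - 1 then y else f (a + ((j - 1 : ℕ) : ZMod k)),
    by simp, by simp; omega, ?_, ?_⟩
  · intro j hj
    rcases Nat.eq_zero_or_pos j with rfl | hj0
    · beta_reduce
      rw [if_pos rfl, if_neg (by omega), if_neg (by omega)]
      simpa using ha
    · beta_reduce
      rw [if_neg (by omega), if_neg (by omega), if_neg (by omega)]
      split_ifs with h
      · convert hb using 2
        have : ((j - 1 : ℕ) : ZMod k) + 3 = 0 := by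
          have : ((j - 1 + 3 : ℕ) : ZMod k) = 0 := by
            rw [show j - 1 + 3 = k by omega]; simp
          exact_mod_cast this
        linear_combination this
      · convert hf.adj _ using 2
        rw [show j + 1 - 1 = (j - 1) + 1 by omega]
        push_cast; ring
  · intro i hi j hj hij
    simp only [Set.mem_Iic] at hi hj
    have hx' : ∀ a, f a ≠ x := fun a h => hx ⟨a, h⟩
    have hy' : ∀ a, f a ≠ y := fun a h => hy ⟨a, h⟩
    simp only at hij
    split_ifs at hij with h1 h2 h3 h4 h5 h6 h7 h8
    · omega
    · exact absurd hij hxy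
    · exact absurd hij.symm (hx' _)
    · exact absurd hij.symm hxy
    · omega
    · exact absurd hij.symm (hy' _)
    · exact absurd hij (hx' _)
    · exact absurd hij (hy' _)
    · have := zmod_natCast_inj (by omega) (by omega) (add_left_cancel (hf.inj hij))
      omega

/-- The path from a vertex outside of the core through a second one to `k - 2` consecutive
vertices of the core. -/
theorem IsCore.hasPath_tail (hk : 3 ≤ k) {f : ZMod k → V} (hf : IsCore G f) {x y : V}
    (hx : x ∉ Set.range f) (hy : y ∉ Set.range f) (hxy : G.Adj x y) {a : ZMod k}
    (ha : G.Adj y (f a)) : G.HasPath (k - 1) x (f (a + ((k - 3 : ℕ) : ZMod k))) := by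
  refine ⟨fun j => if j = 0 then x else if j = 1 then y else f (a + ((j - 2 : ℕ) : ZMod k)),
    by simp, ?_, ?_, ?_⟩
  · beta_reduce
    rw [if_neg (by omega), if_neg (by omega), show k - 1 - 2 = k - 3 by omega]
  · intro j hj
    rcases Nat.eq_zero_or_pos j with rfl | hj0
    · simpa using hxy
    · rcases eq_or_ne j 1 with rfl | hj1
      · simpa using ha
      · beta_reduce
        rw [if_neg (by omega), if_neg (by omega), if_neg (by omega), if_neg (by omega)]
        convert hf.adj _ using 2
        rw [show j + 1 - 2 = (j - 2) + 1 by omega]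
        push_cast; ring
  · intro i hi j hj hij
    simp only [Set.mem_Iic] at hi hj
    have hx' : ∀ a, f a ≠ x := fun a h => hx ⟨a, h⟩
    have hy' : ∀ a, f a ≠ y := fun a h => hy ⟨a, h⟩
    simp only at hij
    split_ifs at hij with h1 h2 h3 h4 h5 h6 h7 h8
    · omega
    · exact absurd hij hxy.ne
    · exact absurd hij.symm (hx' _)
    · exact absurd hij.symm hxy.ne
    · omega
    · exact absurd hij.symm (hy' _)
    · exact absurd hij (hx' _)
    · exact absurd hij (hy' _)
    · have := zmod_natCast_inj (by omega) (by omega) (add_left_cancel (hf.inj hij))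
      omega

/-- Being on or next to the cycle propagates along walks: if `z` is adjacent to an outside vertex
that sees the cycle, `IsCore.hasPath_tail` gives `z` a neighbour on the cycle. -/
theorem IsCore.mem_or_adj (hk : 3 ≤ k) (hs : CycleStable k G) {f : ZMod k → V}
    (hf : IsCore G f) (hG : G.Preconnected) (y : V) :
    y ∈ Set.range f ∨ ∃ a, G.Adj y (f a) := by
  obtain ⟨p⟩ := hG (f 0) y
  suffices h : ∀ u v, G.Walk u v → (u ∈ Set.range f ∨ ∃ a, G.Adj u (f a)) →
      (v ∈ Set.range f ∨ ∃ a, G.Adj v (f a)) from h _ _ p (Or.inl ⟨0, rfl⟩)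
  intro u v q hu
  induction q with
  | nil => exact hu
  | @cons u z _ h _ ih =>
    apply ih
    by_cases hz : z ∈ Set.range f
    · exact Or.inl hz
    right
    by_cases hur : u ∈ Set.range f
    · obtain ⟨a, rfl⟩ := hur
      exact ⟨a, h.symm⟩
    · obtain ⟨a, ha⟩ := hu.resolve_left hur
      exact ⟨_, hs _ _ (hf.hasPath_tail hk hz hur h.symm ha)⟩

/-- The vertex `y` plays the role of the core vertex `f a`. -/
def CoreType (G : SimpleGraph V) (f : ZMod k → V) (y : V) (a : ZMod k) : Prop :=
  y = f a ∨ (y ∉ Set.range f ∧ G.Adj y (f (a + 1)))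

/-- Vertices whose types differ by an odd amount are adjacent, as the corresponding core vertices
would be. For two outside vertices, even shifts bring the neighbours to the positions needed in
`IsCore.hasPath_outside`. -/
theorem IsCore.adj_of_coreType [NeZero k] (hk : 3 ≤ k) (hs : CycleStable k G) {f : ZMod k → V}
    (hf : IsCore G f) {x : V} (hx : x ∉ Set.range f) {b : ZMod k} (hb : G.Adj x (f b))
    {y y' : V} {a j : ZMod k} (hy : CoreType G f y a) (hy' : CoreType G f y' (a + 1 + 2 * j))
    (hne : y ≠ y') : G.Adj y y' := by
  rcases hy with rfl | ⟨h1, h2⟩ <;> rcases hy' with rfl | ⟨h3, h4⟩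
  · exact hf.adj_core hk hs hx hb a j fun h => hne (congrArg f h)
  · refine Adj.symm ?_
    convert hf.adj_add_two_mul hk hs h3 h4 (-(j + 1)) using 2
    ring
  · convert hf.adj_add_two_mul hk hs h1 h2 j using 2
  · refine hs _ _ (hf.hasPath_outside hk h1 h3 hne h2 (Adj.symm ?_))
    convert hf.adj_add_two_mul hk hs h3 h4 (-(j + 2)) using 2
    ring

theorem exists_seq_of_le_card {α : Type*} [Nonempty α] (s : Finset α) (r : ℕ) (h : r ≤ s.card) :
    ∃ e : ℕ → α, (∀ i < r, e i ∈ s) ∧ Set.InjOn e (Set.Iio r) := by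
  have x₀ : α := Classical.arbitrary α
  refine ⟨fun i => if h : i < s.card then s.equivFin.symm ⟨i, h⟩ else x₀, ?_, ?_⟩
  · intro i hi
    beta_reduce
    rw [dif_pos (by omega)]
    exact (s.equivFin.symm _).2
  · intro i hi j hj hij
    simp only [Set.mem_Iio] at hi hj
    simp only [dif_pos (show i < s.card by omega), dif_pos (show j < s.card by omega)] at hij
    have := s.equivFin.symm.injective (Subtype.ext hij)
    simpa using this

end core

/-- In a stable graph with a complete bipartite spanning subgraph, an edge inside one class makes
the other class complete. -/
theorem CycleStable.adj_of_mono_edge {V : Type*} {G : SimpleGraph V} {m : ℕ} (hm : 2 ≤ m)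
    (hs : CycleStable (2 * m) G) {col : V → Prop} (hcol : ∀ x y, col x → ¬ col y → G.Adj x y)
    {s t : Finset V} (hsc : m ≤ s.card) (htc : m ≤ t.card) (hsP : ∀ x ∈ s, col x)
    (htP : ∀ x ∈ t, ¬ col x) {y y' : V} (hy : col y) (hy' : col y') (hyy : G.Adj y y')
    {u v : V} (hu : ¬ col u) (hv : ¬ col v) (huv : u ≠ v) : G.Adj u v := by
  classical
  have : Nonempty V := ⟨u⟩
  obtain ⟨P, hPs, hPi⟩ := exists_seq_of_le_card ((s.erase y).erase y') (m - 2) (by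
    have := (s.erase y).pred_card_le_card_erase (a := y')
    have := s.pred_card_le_card_erase (a := y)
    omega)
  obtain ⟨Q, hQs, hQi⟩ := exists_seq_of_le_card ((t.erase u).erase v) (m - 2) (by
    have := (t.erase u).pred_card_le_card_erase (a := v)
    have := t.pred_card_le_card_erase (a := u)
    omega)
  simp only [Finset.mem_erase] at hPs hQs
  have hPc : ∀ i < m - 2, col (P i) := fun i hi => hsP _ (hPs i hi).2.2
  have hQc : ∀ i < m - 2, ¬ col (Q i) := fun i hi => htP _ (hQs i hi).2.2
  have hPi' : ∀ i j, i < m - 2 → j < m - 2 → P i = P j → i = j := fun i j hi hj h => hPi hi hj h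
  have hQi' : ∀ i j, i < m - 2 → j < m - 2 → Q i = Q j → i = j := fun i j hi hj h => hQi hi hj h
  have hPy : ∀ i < m - 2, P i ≠ y := fun i hi => (hPs i hi).2.1
  have hPy' : ∀ i < m - 2, P i ≠ y' := fun i hi => (hPs i hi).1
  have hQu : ∀ i < m - 2, Q i ≠ u := fun i hi => (hQs i hi).2.1
  have hQv : ∀ i < m - 2, Q i ≠ v := fun i hi => (hQs i hi).1
  have hyy' := hyy.ne
  clear hPs hQs hPi hQi hsP htP
  apply hs
  -- The path is `u, P 0, Q 0, P 1, Q 1, …, y, y', v`: alternating between the classes except for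
  -- the single step `y y'`, which corrects the parity.
  set p : ℕ → V := fun j => if j = 0 then u else if j = 2 * m - 3 then y else
    if j = 2 * m - 2 then y' else if j = 2 * m - 1 then v else
    if j % 2 = 1 then P ((j - 1) / 2) else Q ((j - 2) / 2) with hp
  have p0 : p 0 = u := by simp [hp]
  have p1 : p (2 * m - 3) = y := by simp only [hp]; rw [if_neg (by omega), if_pos trivial]
  have p2 : p (2 * m - 2) = y' := by
    simp only [hp]; rw [if_neg (by omega), if_neg (by omega), if_pos trivial]
  have p3 : p (2 * m - 1) = v := by
    simp only [hp]
    rw [if_neg (by omega), if_neg (by omega), if_neg (by omega), if_pos trivial]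
  have pP : ∀ i < m - 2, p (2 * i + 1) = P i := by
    intro i hi
    simp only [hp]
    rw [if_neg (by omega), if_neg (by omega), if_neg (by omega), if_neg (by omega),
      if_pos (by omega)]
    congr 1; omega
  have pQ : ∀ i < m - 2, p (2 * i + 2) = Q i := by
    intro i hi
    simp only [hp]
    rw [if_neg (by omega), if_neg (by omega), if_neg (by omega), if_neg (by omega),
      if_neg (by omega)]
    congr 1; omega
  clear_value p
  have hcases : ∀ j ≤ 2 * m - 1, j = 0 ∨ j = 2 * m - 3 ∨ j = 2 * m - 2 ∨ j = 2 * m - 1 ∨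
      (∃ i < m - 2, j = 2 * i + 1) ∨ (∃ i < m - 2, j = 2 * i + 2) := by
    intro j hj
    by_cases h : j = 0 ∨ j = 2 * m - 3 ∨ j = 2 * m - 2 ∨ j = 2 * m - 1
    · tauto
    · rcases Nat.mod_two_eq_zero_or_one j with h1 | h1
      · exact Or.inr (Or.inr (Or.inr (Or.inr (Or.inr ⟨(j - 2) / 2, by omega, by omega⟩))))
      · exact Or.inr (Or.inr (Or.inr (Or.inr (Or.inl ⟨(j - 1) / 2, by omega, by omega⟩))))
  have hodd : ∀ j < 2 * m - 1, j % 2 = 1 → col (p j) := by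
    intro j hj hj2
    rcases hcases j hj.le with rfl | rfl | rfl | rfl | ⟨i, hi, rfl⟩ | ⟨i, hi, rfl⟩
    · omega
    · rwa [p1]
    · omega
    · omega
    · rw [pP i hi]; exact hPc i hi
    · omega
  have heven : ∀ j < 2 * m - 2, j % 2 = 0 → ¬ col (p j) := by
    intro j hj hj2
    rcases hcases j (by omega) with rfl | rfl | rfl | rfl | ⟨i, hi, rfl⟩ | ⟨i, hi, rfl⟩
    · rwa [p0]
    · omega
    · omega
    · omega
    · omega
    · rw [pQ i hi]; exact hQc i hi
  refine ⟨p, p0, p3, ?_, ?_⟩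
  · intro j hj
    rcases eq_or_ne j (2 * m - 3) with rfl | h1
    · rw [p1, show 2 * m - 3 + 1 = 2 * m - 2 by omega, p2]; exact hyy
    rcases eq_or_ne j (2 * m - 2) with rfl | h2
    · rw [p2, show 2 * m - 2 + 1 = 2 * m - 1 by omega, p3]; exact hcol _ _ hy' hv
    rcases Nat.mod_two_eq_zero_or_one j with h3 | h3
    · exact (hcol _ _ (hodd (j + 1) (by omega) (by omega)) (heven j (by omega) h3)).symm
    · exact hcol _ _ (hodd j (by omega) h3) (heven (j + 1) (by omega) (by omega))
  · intro i hi j hj hij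
    simp only [Set.mem_Iic] at hi hj
    have hne : ∀ a b : V, col a → ¬ col b → a ≠ b := fun a b ha hb h => hb (h ▸ ha)
    rcases hcases i hi with rfl | rfl | rfl | rfl | ⟨i, hi, rfl⟩ | ⟨i, hi, rfl⟩ <;>
    rcases hcases j hj with rfl | rfl | rfl | rfl | ⟨j, hj, rfl⟩ | ⟨j, hj, rfl⟩ <;>
    grind

theorem zmod_exists_of_parity {k : ℕ} [NeZero k] (a b : ZMod k)
    (h : Odd k ∨ a.val % 2 ≠ b.val % 2) : ∃ j : ZMod k, b = a + 1 + 2 * j := by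
  have key : ∀ n : ℕ, n % 2 = (a.val + 1) % 2 → (n : ZMod k) = b →
      ∃ j : ZMod k, b = a + 1 + 2 * j := by
    intro n hn hb
    have h2 : (2 : ℤ) ∣ (n : ℤ) - (a.val + 1) := by omega
    obtain ⟨c, hc⟩ := h2
    refine ⟨(c : ZMod k), ?_⟩
    have h3 := congrArg (Int.cast : ℤ → ZMod k) hc
    push_cast at h3
    rw [ZMod.natCast_zmod_val, hb] at h3
    linear_combination h3
  by_cases hab : a.val % 2 ≠ b.val % 2
  · exact key b.val (by omega) (by simp)
  · have hk := h.resolve_right hab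
    rw [Nat.odd_iff] at hk
    exact key (b.val + k) (by omega) (by simp)

/-- A stable connected graph on more than `k` vertices that contains a path on `k` vertices is
complete if `k` is odd; if `k` is even, any two vertices joined by an odd walk are adjacent. -/
theorem CycleStable.adj_of_walk {V : Type*} {G : SimpleGraph V} {k : ℕ} (hk : 3 ≤ k)
    (hs : CycleStable k G) (hG : G.Preconnected) {x y : V} (hp : G.HasPath (k - 1) x y)
    {S : Finset V} (hS : k < S.card) {u v : V} (huv : u ≠ v)
    (hw : Odd k ∨ ∃ p : G.Walk u v, Odd p.length) : G.Adj u v := by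
  classical
  have : NeZero k := ⟨by omega⟩
  obtain ⟨f, hf⟩ := hs.exists_isCore hk hp
  obtain ⟨x, hx⟩ : ∃ x, x ∉ Set.range f := by
    by_contra hcon
    push Not at hcon
    have hle : S ⊆ Finset.univ.image f := fun z _ => by
      obtain ⟨a, ha⟩ := hcon z
      exact Finset.mem_image.2 ⟨a, Finset.mem_univ _, ha⟩
    have h1 := (Finset.card_le_card hle).trans Finset.card_image_le
    rw [Finset.card_univ, ZMod.card] at h1
    omega
  obtain ⟨b, hb⟩ := (hf.mem_or_adj hk hs hG x).resolve_left hx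
  have htype : ∀ z, ∃ a, CoreType G f z a := by
    intro z
    rcases hf.mem_or_adj hk hs hG z with ⟨a, rfl⟩ | ⟨a, ha⟩
    · exact ⟨a, Or.inl rfl⟩
    · by_cases hz : z ∈ Set.range f
      · obtain ⟨a, rfl⟩ := hz
        exact ⟨a, Or.inl rfl⟩
      · exact ⟨a - 1, Or.inr ⟨hz, by simpa using ha⟩⟩
  choose ty hty using htype
  have hadj : ∀ z z', z ≠ z' → (Odd k ∨ (ty z).val % 2 ≠ (ty z').val % 2) → G.Adj z z' := by
    intro z z' hne h
    obtain ⟨j, hj⟩ := zmod_exists_of_parity (ty z) (ty z') h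
    have h2 := hty z'
    rw [hj] at h2
    exact hf.adj_of_coreType hk hs hx hb (hty z) h2 hne
  rcases Nat.even_or_odd k with hke | hko
  swap
  · exact hadj u v huv (Or.inl hko)
  obtain ⟨p, hpo⟩ := hw.resolve_left (Nat.not_odd_iff_even.2 hke)
  -- For even `k` the parity of the type is a 2-colouring with all edges between the classes. Either
  -- there are no further edges and odd walks change colour, or one monochromatic edge makes both
  -- classes complete.
  set col : V → Prop := fun z => (ty z).val % 2 = 0 with hcol
  have hcol' : ∀ z z', col z → ¬ col z' → G.Adj z z' := by
    intro z z' h1 h2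
    simp only [hcol] at h1 h2
    exact hadj z z' (fun h => h2 (h ▸ h1)) (Or.inr (by omega))
  by_cases hmono : ∃ z z', G.Adj z z' ∧ (col z ↔ col z')
  swap
  · push Not at hmono
    have hpar : ∀ u v, ∀ p : G.Walk u v, (Odd p.length ↔ ¬ (col u ↔ col v)) := by
      intro u v p
      induction p with
      | nil => simp
      | @cons u z v h q ih =>
        have h1 := hmono u z h
        rw [Walk.length_cons, Nat.odd_add_one, ih]
        tauto
    have h1 := (hpar u v p).1 hpo
    by_cases hu : col u
    · exact hcol' u v hu (by tauto)
    · exact (hcol' v u (by tauto) hu).symm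
  · obtain ⟨m, hm⟩ := hke
    have hkm : k = 2 * m := by omega
    have hcf : ∀ a, ty (f a) = a := by
      intro a
      rcases hty (f a) with h | h
      · exact (hf.inj h).symm
      · exact absurd ⟨a, rfl⟩ h.1
    have hcard : ∀ r < 2, ((Finset.range m).image
        fun i : ℕ => f ((2 * i + r : ℕ) : ZMod k)).card = m := by
      intro r hr
      rw [Finset.card_image_of_injOn, Finset.card_range]
      intro i hi j hj hij
      simp only [Finset.coe_range, Set.mem_Iio] at hi hj
      have := zmod_natCast_inj (by omega) (by omega) (hf.inj hij)
      omega
    set s := (Finset.range m).image fun i : ℕ => f ((2 * i + 0 : ℕ) : ZMod k) with hsdef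
    set t := (Finset.range m).image fun i : ℕ => f ((2 * i + 1 : ℕ) : ZMod k) with htdef
    have hsP : ∀ z ∈ s, col z := by
      intro z hz
      obtain ⟨i, hi, rfl⟩ := Finset.mem_image.1 hz
      rw [Finset.mem_range] at hi
      simp only [hcol, hcf]
      rw [ZMod.val_natCast, Nat.mod_eq_of_lt (show 2 * i + 0 < k by omega)]
      omega
    have htP : ∀ z ∈ t, ¬ col z := by
      intro z hz
      obtain ⟨i, hi, rfl⟩ := Finset.mem_image.1 hz
      rw [Finset.mem_range] at hi
      simp only [hcol, hcf]
      rw [ZMod.val_natCast, Nat.mod_eq_of_lt (show 2 * i + 1 < k by omega)]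
      omega
    have hsc : s.card = m := hcard 0 (by omega)
    have htc : t.card = m := hcard 1 (by omega)
    rw [hkm] at hs
    have hm2 : 2 ≤ m := by omega
    have fill : ∀ z z', col z → col z' → G.Adj z z' → ∀ u v, ¬ col u → ¬ col v → u ≠ v →
        G.Adj u v := fun z z' hz hz' hzz u v hu hv huv =>
      hs.adj_of_mono_edge hm2 hcol' hsc.ge htc.ge hsP htP hz hz' hzz hu hv huv
    have fill' : ∀ z z', ¬ col z → ¬ col z' → G.Adj z z' → ∀ u v, col u → col v → u ≠ v →
        G.Adj u v := fun z z' hz hz' hzz u v hu hv huv =>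
      hs.adj_of_mono_edge (col := fun z => ¬ col z) hm2
        (fun x y hx hy => (hcol' y x (not_not.1 hy) hx).symm) htc.ge hsc.ge htP
        (fun z hz => not_not.2 (hsP z hz)) hz hz' hzz (not_not.2 hu) (not_not.2 hv) huv
    obtain ⟨a₁, ha₁, a₂, ha₂, ha⟩ := Finset.one_lt_card.1 (show 1 < s.card by omega)
    obtain ⟨b₁, hb₁, b₂, hb₂, hb'⟩ := Finset.one_lt_card.1 (show 1 < t.card by omega)
    obtain ⟨z, z', hzz, hiff⟩ := hmono
    have both : (∀ u v, col u → col v → u ≠ v → G.Adj u v) ∧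
        (∀ u v, ¬ col u → ¬ col v → u ≠ v → G.Adj u v) := by
      by_cases hz : col z
      · have h1 := fill z z' hz (hiff.1 hz) hzz
        exact ⟨fill' b₁ b₂ (htP _ hb₁) (htP _ hb₂) (h1 _ _ (htP _ hb₁) (htP _ hb₂) hb'), h1⟩
      · have h1 := fill' z z' hz (fun h => hz (hiff.2 h)) hzz
        exact ⟨h1, fill a₁ a₂ (hsP _ ha₁) (hsP _ ha₂) (h1 _ _ (hsP _ ha₁) (hsP _ ha₂) ha)⟩
    by_cases hu : col u <;> by_cases hv : col v
    · exact both.1 u v hu hv huv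
    · exact hcol' u v hu hv
    · exact (hcol' v u hv hu).symm
    · exact both.2 u v hu hv huv

/-! ### Short walks: adjacency after a bounded time -/

theorem exists_walk_of_seq_support {V : Type*} {G : SimpleGraph V} (p : ℕ → V) (m : ℕ)
    (h : ∀ j < m, G.Adj (p j) (p (j + 1))) :
    ∃ q : G.Walk (p 0) (p m), q.length = m ∧ ∀ j ≤ m, p j ∈ q.support := by
  induction m with
  | zero => exact ⟨.nil, rfl, fun j hj => by simp [Nat.le_zero.1 hj]⟩
  | succ m ih =>
    obtain ⟨q, hq, hs⟩ := ih fun j hj => h j (by omega)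
    refine ⟨q.concat (h m (by omega)), by simp [hq], fun j hj => ?_⟩
    rw [Walk.support_concat]
    rcases Nat.le_succ_iff.1 hj with h1 | rfl
    · simp [hs j h1]
    · simp

section

variable {V : Type*} [Fintype V] {k : ℕ}

/-- Inside the support of a walk of bounded length the process is finished after a bounded time. -/
theorem cycleProc_adj_of_support (hk : 3 ≤ k) {G : SimpleGraph V} {a b : V} (q : G.Walk a b)
    {p : ℕ → V} (hadj : ∀ j < k - 1, G.Adj (p j) (p (j + 1)))
    (hinj : Set.InjOn p (Set.Iic (k - 1))) (hps : ∀ j ≤ k - 1, p j ∈ q.support)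
    {S : Finset V} (hS : k < S.card) (hSq : ∀ z ∈ S, z ∈ q.support) {u v : V} (huv : u ≠ v)
    (hu : u ∈ q.support) (hv : v ∈ q.support)
    (hw : Odd k ∨ ∃ r : G.Walk u v, Odd r.length ∧ ∀ z ∈ r.support, z ∈ q.support)
    {i : ℕ} (hi : (q.length + 1) ^ 2 ≤ i) : (cycleProc k G i).Adj u v := by
  classical
  set C : Set V := {z | z ∈ q.support} with hC
  have hcard : Fintype.card C ≤ q.length + 1 := by
    rw [← Walk.length_support, ← Set.toFinset_card]
    refine (Finset.card_le_card (t := q.support.toFinset) ?_).trans (List.toFinset_card_le _)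
    intro z
    simp [hC]
  have hconn : (G.induce C).Connected := q.connected_induce_support
  have hst : CycleStable k (cycleProc k (G.induce C) i) :=
    cycleProc_stable hk (cycleProc_card_sq _ ((Nat.pow_le_pow_left hcard 2).trans hi))
  have hle : G.induce C ≤ cycleProc k (G.induce C) i := cycleProc_mono _ (Nat.zero_le i)
  have hpath : (cycleProc k (G.induce C) i).HasPath (k - 1) ⟨p 0, hps 0 (by omega)⟩
      ⟨p (k - 1), hps _ le_rfl⟩ := by
    refine ⟨fun j => ⟨p (min j (k - 1)), hps _ (min_le_right _ _)⟩, by simp, by simp, ?_, ?_⟩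
    · intro j hj
      apply hle
      change G.Adj (p (min j (k - 1))) (p (min (j + 1) (k - 1)))
      rw [min_eq_left (by omega), min_eq_left (by omega)]
      exact hadj j hj
    · intro x hx y hy hxy
      simp only [Set.mem_Iic] at hx hy
      simp only [Subtype.mk.injEq] at hxy
      rw [min_eq_left hx, min_eq_left hy] at hxy
      exact hinj hx hy hxy
  have key : (cycleProc k (G.induce C) i).Adj ⟨u, hu⟩ ⟨v, hv⟩ := by
    refine hst.adj_of_walk hk (hconn.mono hle).preconnected hpath (S := S.subtype (· ∈ C)) ?_ ?_ ?_
    · have hfil : S.filter (· ∈ C) = S := Finset.filter_true_of_mem fun z hz => hSq z hz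
      rw [Finset.card_subtype, hfil]
      exact hS
    · simpa using huv
    · refine hw.imp id ?_
      rintro ⟨r, hr, hrs⟩
      refine ⟨(r.induce C hrs).mapLe hle, ?_⟩
      rw [Walk.length_map]
      have : (r.induce C hrs).length = r.length := by
        rw [← Walk.length_map (Embedding.induce C).toHom, Walk.map_induce]
        rfl
      rwa [this]
  exact cycleProc_map hk Subtype.val_injective (fun _ _ h => h) i _ _ key

/-- In a component with a path on `k` vertices and more than `k` vertices, the ends of a short
(odd, if `k` is even) walk become adjacent after a bounded time. -/
theorem cycleProc_adj_of_short_walk (hk : 3 ≤ k) {G : SimpleGraph V} {u v : V} (p : G.Walk u v)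
    (huv : u ≠ v) (hp : Odd k ∨ Odd p.length) {a b : V} (ha : G.Reachable u a)
    (hab : G.HasPath (k - 1) a b) {S : Finset V} (hS : k < S.card)
    (hSu : ∀ z ∈ S, G.Reachable u z) {i : ℕ} (hi : (4 * k + p.length + 1) ^ 2 ≤ i) :
    (cycleProc k G i).Adj u v := by
  classical
  -- If some vertex has distance at least `k` from `u`, the first `k` edges of a geodesic supply `k
  -- + 1` distinct vertices. Otherwise the component lies within distance `k`, and short detours
  -- collect the given path on `k` vertices and one vertex off it.
  by_cases hfar : ∃ z, G.Reachable u z ∧ k ≤ G.dist u z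
  · obtain ⟨z, hz, hzk⟩ := hfar
    obtain ⟨r, hr, hrl⟩ := hz.exists_path_of_dist
    have hinj := hr.getVert_injOn
    set r' := r.take k with hr'
    have hmem : ∀ j ≤ k, r.getVert j ∈ r'.support := by
      intro j hj
      have : r'.getVert j = r.getVert j := by
        rw [hr', Walk.take_getVert]; congr 1; omega
      rw [← this]
      exact Walk.getVert_mem_support _ _
    have hlen : r'.length ≤ k := by rw [hr', Walk.take_length]; omega
    set q := r'.reverse.append p with hq
    have hsub : ∀ z ∈ r'.support, z ∈ q.support := by
      intro z hz
      rw [hq, Walk.mem_support_append_iff]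
      left
      simpa using hz
    have hsub' : ∀ z ∈ p.support, z ∈ q.support := by
      intro z hz
      rw [hq, Walk.mem_support_append_iff]
      exact Or.inr hz
    refine cycleProc_adj_of_support hk q (p := r.getVert)
      (fun j hj => r.adj_getVert_succ (by omega)) ?_ (fun j hj => hsub _ (hmem j (by omega)))
      (S := (Finset.range (k + 1)).image r.getVert) ?_ ?_ huv (hsub' _ p.start_mem_support)
      (hsub' _ p.end_mem_support) (hp.imp id fun h => ⟨p, h, hsub'⟩) ?_
    · exact hinj.mono fun j hj => by simp at hj ⊢; omega
    · rw [Finset.card_image_of_injOn, Finset.card_range]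
      · omega
      · exact hinj.mono fun j hj => by simp at hj ⊢; omega
    · intro z hz
      obtain ⟨j, hj, rfl⟩ := Finset.mem_image.1 hz
      rw [Finset.mem_range] at hj
      exact hsub _ (hmem j (by omega))
    · refine le_trans (Nat.pow_le_pow_left ?_ 2) hi
      rw [hq, Walk.length_append, Walk.length_reverse]
      omega
  · push Not at hfar
    obtain ⟨s, rfl, rfl, hadj, hinj⟩ := hab
    obtain ⟨w₃, hw₃, hs₃⟩ := exists_walk_of_seq_support s (k - 1) hadj
    have hshort : ∀ z, G.Reachable u z → ∃ w : G.Walk u z, w.length ≤ k := by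
      intro z hz
      obtain ⟨w, hw⟩ := hz.exists_walk_length_eq_dist
      exact ⟨w, by rw [hw]; exact (hfar z hz).le⟩
    obtain ⟨z, hzS, hz⟩ : ∃ z ∈ S, z ∉ (Finset.range k).image s := by
      by_contra hcon
      push Not at hcon
      have h1 := (Finset.card_le_card hcon).trans Finset.card_image_le
      rw [Finset.card_range] at h1
      omega
    obtain ⟨w₁, hw₁⟩ := hshort z (hSu z hzS)
    obtain ⟨w₂, hw₂⟩ := hshort _ ha
    obtain ⟨w₄, hw₄⟩ := hshort _ (ha.trans w₃.reachable)
    set q := w₁.reverse.append (w₂.append (w₃.append (w₄.reverse.append p))) with hq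
    have hsub' : ∀ z ∈ p.support, z ∈ q.support := by
      intro z hz
      simp only [hq, Walk.mem_support_append_iff]
      tauto
    have hsub₃ : ∀ j ≤ k - 1, s j ∈ q.support := by
      intro j hj
      have := hs₃ j hj
      simp only [hq, Walk.mem_support_append_iff]
      tauto
    refine cycleProc_adj_of_support hk q hadj hinj hsub₃
      (S := insert z ((Finset.range k).image s)) ?_ ?_ huv (hsub' _ p.start_mem_support)
      (hsub' _ p.end_mem_support) (hp.imp id fun h => ⟨p, h, hsub'⟩) ?_
    · rw [Finset.card_insert_of_notMem hz, Finset.card_image_of_injOn, Finset.card_range]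
      · omega
      · exact hinj.mono fun j hj => by simp at hj ⊢; omega
    · intro x hx
      rcases Finset.mem_insert.1 hx with rfl | hx
      · exact Walk.start_mem_support _
      · obtain ⟨j, hj, rfl⟩ := Finset.mem_image.1 hx
        rw [Finset.mem_range] at hj
        exact hsub₃ j (by omega)
    · refine le_trans (Nat.pow_le_pow_left ?_ 2) hi
      simp only [hq, Walk.length_append, Walk.length_reverse]
      omega

end

/-! ### Jumps along a path -/

section jump

variable {V : Type*} [Fintype V] {k : ℕ} {G : SimpleGraph V} {w : ℤ → V}

theorem cycleProc_succ_of_seq (hk : 3 ≤ k) {i : ℕ} {z : ℕ → ℤ}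
    (h : ∀ j < k - 1, (cycleProc k G i).Adj (w (z j)) (w (z (j + 1))))
    (hinj : Set.InjOn (fun j => w (z j)) (Set.Iic (k - 1))) :
    (cycleProc k G (i + 1)).Adj (w (z 0)) (w (z (k - 1))) := by
  rw [cycleProc_succ_adj hk]
  exact Or.inr ⟨fun j => w (z j), rfl, rfl, h, hinj⟩

/-- At time `i`, any two positions of the sequence `w` at distance `d` in `[l, r]` are adjacent. -/
def Jump (k : ℕ) (G : SimpleGraph V) (w : ℤ → V) (l r : ℤ) (i d : ℕ) : Prop :=
  ∀ x : ℤ, l ≤ x → x + d ≤ r → (cycleProc k G i).Adj (w x) (w (x + d))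

variable {l r : ℤ}

theorem Jump.mono {i j d : ℕ} (h : Jump k G w l r i d) (hij : i ≤ j) : Jump k G w l r j d :=
  fun x hx hxr => cycleProc_adj_of_le hij (h x hx hxr)

/-- All jumps go forwards, so the visited positions increase and the vertices are automatically
distinct. -/
theorem Jump.sum (hk : 3 ≤ k) (hw : Set.InjOn w (Set.Icc l r)) {i : ℕ} {δ : ℕ → ℕ}
    (hpos : ∀ j < k - 1, 0 < δ j) (hδ : ∀ j < k - 1, Jump k G w l r i (δ j)) {d : ℕ}
    (hd : d = ∑ j ∈ Finset.range (k - 1), δ j) : Jump k G w l r (i + 1) d := by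
  intro x hx hxr
  subst hd
  set z : ℕ → ℤ := fun j => x + (∑ l ∈ Finset.range j, δ l : ℕ) with hz
  have hsucc : ∀ j, z (j + 1) = z j + δ j := by
    intro j; simp only [hz, Finset.sum_range_succ]; push_cast; ring
  have hlt : ∀ a b, a < b → b ≤ k - 1 → z a < z b := by
    intro a b hab hb
    induction b, hab using Nat.le_induction with
    | base =>
      rw [hsucc]
      have := hpos a (by omega)
      omega
    | succ b hab ih =>
      rw [hsucc]
      have := ih (by omega)
      omega
  have hz0 : z 0 = x := by simp [hz]
  have hmem : ∀ j ≤ k - 1, z j ∈ Set.Icc l r := by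
    intro j hj
    constructor
    · rcases Nat.eq_zero_or_pos j with rfl | h
      · omega
      · have := hlt 0 j h hj; omega
    · rcases hj.eq_or_lt with rfl | h
      · exact hxr
      · have h1 := hlt j (k - 1) h le_rfl
        have h2 : z (k - 1) ≤ r := hxr
        omega
  have key := cycleProc_succ_of_seq (G := G) (w := w) (i := i) (z := z) hk ?_ ?_
  · rw [hz0] at key
    exact key
  · intro j hj
    rw [hsucc]
    refine hδ j hj (z j) (hmem j hj.le).1 ?_
    rw [← hsucc]
    exact (hmem (j + 1) (by omega)).2
  · intro a ha b hb hab
    simp only [Set.mem_Iic] at ha hb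
    have h1 := hw (hmem a ha) (hmem b hb) hab
    rcases lt_trichotomy a b with h | h | h
    · have := hlt a b h hb; omega
    · exact h
    · have := hlt b a h ha; omega

theorem jump_one (hadj : ∀ z, l ≤ z → z < r → G.Adj (w z) (w (z + 1))) (i : ℕ) :
    Jump k G w l r i 1 := by
  intro x hx hxr
  exact cycleProc_adj_of_le (Nat.zero_le i) (hadj x hx (by simpa using hxr))

theorem jump_pow (hk : 3 ≤ k) (hw : Set.InjOn w (Set.Icc l r))
    (hadj : ∀ z, l ≤ z → z < r → G.Adj (w z) (w (z + 1))) (i : ℕ) :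
    Jump k G w l r i ((k - 1) ^ i) := by
  induction i with
  | zero => simpa using jump_one hadj 0
  | succ i ih =>
    refine Jump.sum hk hw (δ := fun _ => (k - 1) ^ i) (fun _ _ => ?_) (fun _ _ => ih) ?_
    · exact Nat.pow_pos (by omega)
    · simp [pow_succ, mul_comm]

/-- One of the jumps of length `k - 1` is followed by a step backwards. -/
theorem jump_two_of_back (hk : 4 ≤ k) (hw : Set.InjOn w (Set.Icc l r))
    (hadj : ∀ z, l ≤ z → z < r → G.Adj (w z) (w (z + 1))) {a d : ℕ} (ha : a + 4 ≤ k)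
    (hd : d + a * (k - 2) + k = (k - 1) ^ 2) : Jump k G w l r 2 d := by
  intro x hx hxr
  have h1 : Jump k G w l r 1 1 := jump_one hadj 1
  have hk1 : Jump k G w l r 1 (k - 1) := by simpa using jump_pow (by omega) hw hadj 1
  obtain ⟨B, hB⟩ : ∃ B, k = a + B + 3 := ⟨k - a - 3, by omega⟩
  -- After `x`, `x + (k - 1)` and the step back to `x + (k - 2)` come `B` jumps of length `k - 1`,
  -- then `a` unit steps. As `B ≥ 1`, the offsets `e` skip the value `1`, so the position left by
  -- the step back is not revisited.
  set e : ℕ → ℕ := fun j => (k - 1) * min j B + (j - min j B) with he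
  have hstep : ∀ j, e (j + 1) = e j + (k - 1) ∧ j < B ∨ e (j + 1) = e j + 1 ∧ B ≤ j := by
    intro j
    rcases lt_or_ge j B with h | h
    · left
      refine ⟨?_, h⟩
      simp only [he]
      rw [min_eq_left (by omega), min_eq_left (by omega)]
      simp [mul_add]
    · right
      refine ⟨?_, h⟩
      simp only [he]
      rw [min_eq_right (by omega), min_eq_right (by omega)]
      omega
  have hmono : StrictMono e := by
    refine strictMono_nat_of_lt_succ fun j => ?_
    rcases hstep j with h | h <;> omega
  have he0 : e 0 = 0 := by simp [he]
  have heB : e (k - 3) = (k - 1) * B + a := by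
    simp only [he]
    rw [min_eq_right (by omega)]
    congr 1
    omega
  have hdB : (d : ℤ) = (k - 2) + e (k - 3) := by
    rw [heB]
    obtain ⟨q, rfl⟩ : ∃ q, k = q + 2 := ⟨k - 2, by omega⟩
    simp only [Nat.add_sub_cancel, show q + 2 - 1 = q + 1 by omega] at hd ⊢
    zify at hd hB
    push_cast
    have : (q : ℤ) = a + B + 1 := by linarith
    have : (B : ℤ) = q - a - 1 := by linarith
    rw [this]
    linear_combination hd
  set z : ℕ → ℤ := fun j => if j = 0 then x else if j = 1 then x + (k - 1 : ℕ) else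
    x + (k - 2 : ℕ) + e (j - 2) with hz
  have z0 : z 0 = x := by simp [hz]
  have z1 : z 1 = x + (k - 1 : ℕ) := by simp [hz]
  have z2 : ∀ j, z (j + 2) = x + (k - 2 : ℕ) + e j := by intro j; simp [hz]
  have he1 : e 1 = k - 1 := by
    rcases hstep 0 with h | h
    · rw [he0] at h; simpa using h.1
    · omega
  have hele : ∀ j, j ≤ k - 3 → e j ≤ e (k - 3) := fun j hj => hmono.monotone hj
  have hcases : ∀ j, j ≤ k - 1 → j = 0 ∨ j = 1 ∨ ∃ j' ≤ k - 3, j = j' + 2 := by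
    intro j hj
    rcases j with _ | _ | j
    · simp
    · simp
    · exact Or.inr (Or.inr ⟨j, by omega, rfl⟩)
  have hmem : ∀ j ≤ k - 1, z j ∈ Set.Icc l r := by
    intro j hj
    have h3 : e 1 ≤ e (k - 3) := hele 1 (by omega)
    rcases hcases j hj with rfl | rfl | ⟨j, hj', rfl⟩
    · rw [z0]; exact ⟨hx, by omega⟩
    · rw [z1]; exact ⟨by omega, by omega⟩
    · have := hele j hj'
      rw [z2]; exact ⟨by omega, by omega⟩
  clear_value z e
  have key := cycleProc_succ_of_seq (k := k) (G := G) (w := w) (i := 1) (z := z) (by omega) ?_ ?_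
  · rw [z0, show k - 1 = (k - 3) + 2 by omega, z2] at key
    convert key using 2
    omega
  · intro j hj
    rcases hcases j hj.le with rfl | rfl | ⟨j, hj', rfl⟩
    · rw [z0, z1]
      exact hk1 x hx (by have := (hmem 1 (by omega)).2; rwa [z1] at this)
    · rw [z1, z2, he0]
      refine Adj.symm ?_
      have h5 := (hmem 1 (by omega)).2
      rw [z1] at h5
      have := h1 (x + (k - 2 : ℕ)) (by omega) (by omega)
      convert this using 2
      · simp
      · omega
    · have h2 := hmem (j + 2) hj.le
      have h3 := hmem (j + 2 + 1) (by omega)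
      rw [show j + 2 + 1 = (j + 1) + 2 by omega] at h3 ⊢
      rw [z2] at h2 h3 ⊢
      rw [z2]
      rcases hstep j with ⟨h, -⟩ | ⟨h, -⟩
      · have := hk1 _ h2.1 (by rw [h] at h3; have := h3.2; push_cast at this; omega)
        convert this using 2
        rw [h]; push_cast; ring
      · have := h1 _ h2.1 (by rw [h] at h3; have := h3.2; push_cast at this; omega)
        convert this using 2
        rw [h]; push_cast; ring
  · intro i hi j hj hij
    simp only [Set.mem_Iic] at hi hj
    have h4 := hw (hmem i hi) (hmem j hj) hij
    have hne1 : ∀ j, e j ≠ 1 := by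
      intro j hj
      rcases Nat.lt_trichotomy j 0 with h | h | h
      · omega
      · subst h; omega
      · have := hmono.monotone (show 1 ≤ j from h)
        omega
    rcases hcases i hi with rfl | rfl | ⟨i, hi', rfl⟩ <;>
    rcases hcases j hj with rfl | rfl | ⟨j, hj', rfl⟩
    · rfl
    · rw [z0, z1] at h4; omega
    · rw [z0, z2] at h4; omega
    · rw [z0, z1] at h4; omega
    · rfl
    · rw [z1, z2] at h4
      have := hne1 j
      omega
    · rw [z0, z2] at h4; omega
    · rw [z1, z2] at h4
      have := hne1 i
      omega
    · rw [z2, z2] at h4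
      have : e i = e j := by omega
      rw [hmono.injective this]

theorem exists_sum_range_eq (n : ℕ) (c : ℕ → ℕ) (a : ℕ) (h : a ≤ ∑ j ∈ Finset.range n, c j) :
    ∃ f : ℕ → ℕ, (∀ j, f j ≤ c j) ∧ ∑ j ∈ Finset.range n, f j = a := by
  induction n generalizing a with
  | zero => exact ⟨fun _ => 0, by simp, by simpa using (Nat.le_zero.1 (by simpa using h)).symm⟩
  | succ n ih =>
    rw [Finset.sum_range_succ] at h
    obtain ⟨f, hf, hfs⟩ := ih (a - min a (c n)) (by omega)
    refine ⟨fun j => if j = n then min a (c n) else f j, fun j => ?_, ?_⟩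
    · dsimp only
      split_ifs with hj
      · rw [hj]; exact min_le_right _ _
      · exact hf j
    · rw [Finset.sum_range_succ, if_pos rfl, Finset.sum_congr rfl (g := f), hfs]
      · omega
      · intro j hj
        rw [Finset.mem_range] at hj
        rw [if_neg (by omega)]

/-- Jumps whose length falls short of `(k - 1) ^ i` by a combination of `k - 2` and `k`. -/
theorem jump_of_defect (hk : 3 ≤ k) (hw : Set.InjOn w (Set.Icc l r))
    (hadj : ∀ z, l ≤ z → z < r → G.Adj (w z) (w (z + 1))) (i : ℕ) :
    ∀ a b d : ℕ, (b = 0 ∨ 4 ≤ k) → a + 3 * b ≤ (k - 1) ^ (i + 1) → b ≤ (k - 1) ^ i →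
      d + a * (k - 2) + b * k = (k - 1) ^ (i + 2) → Jump k G w l r (i + 2) d := by
  obtain ⟨q, rfl⟩ : ∃ q, k = q + 2 := ⟨k - 2, by omega⟩
  simp only [Nat.add_sub_cancel, show q + 2 - 1 = q + 1 by omega]
  induction i with
  | zero =>
    intro a b d hb hab hb1 hd
    simp only [zero_add, pow_zero, pow_one] at hab hb1 hd
    rcases Nat.eq_zero_or_pos b with rfl | hb0
    · refine Jump.sum hk hw (i := 1) (δ := fun j => if j < a then 1 else q + 1) ?_ ?_ ?_
      · intro j _; split_ifs <;> omega
      · intro j _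
        split_ifs
        · exact jump_one hadj 1
        · simpa using jump_pow hk hw hadj 1
      · have h1 : ∑ j ∈ Finset.range (q + 2 - 1), (if j < a then 1 else q + 1) =
            a + (q + 1 - a) * (q + 1) := by
          obtain ⟨c, hc⟩ : ∃ c, q + 1 = a + c := ⟨q + 1 - a, by omega⟩
          rw [show q + 2 - 1 = a + c by omega, Finset.sum_range_add,
            Finset.sum_congr rfl (g := fun _ => 1)
              (fun j hj => if_pos (Finset.mem_range.1 hj)),
            Finset.sum_congr rfl (g := fun _ => q + 1) (fun j _ => if_neg (by omega))]
          simp [hc]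
        rw [h1]
        obtain ⟨c, hc⟩ : ∃ c, q + 1 = a + c := ⟨q + 1 - a, by omega⟩
        rw [show q + 1 - a = c by omega]
        have hq : (q : ℤ) = a + c - 1 := by omega
        zify at hd ⊢
        rw [hq] at hd ⊢
        linear_combination hd
    · obtain rfl : b = 1 := by omega
      exact jump_two_of_back (by omega) hw hadj (a := a) (by omega)
        (by simpa only [Nat.add_sub_cancel, show q + 2 - 1 = q + 1 by omega, one_mul] using hd)
  | succ i ih =>
    intro a b d hb hab hb1 hd
    -- The losses are shared out among the `k - 1` subjumps: first the `b` losses of size `k`, then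
    -- the `a` losses of size `k - 2` in the remaining capacity. A loss of size `k` occupies three
    -- units because the base case with `b = 1` needs `a + 3 ≤ k - 1`.
    obtain ⟨f, hf, hfs⟩ := exists_sum_range_eq (q + 1) (fun _ => min b ((q + 1) ^ i)) b (by
      rw [Finset.sum_const, Finset.card_range, smul_eq_mul]
      rcases le_total b ((q + 1) ^ i) with h | h
      · rw [min_eq_left h]; nlinarith
      · rw [min_eq_right h]; rwa [pow_succ, mul_comm] at hb1)
    have h3 : ∀ j, 3 * f j ≤ (q + 1) ^ (i + 1) ∧ (f j = 0 ∨ 4 ≤ q + 2) := by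
      intro j
      have h4 := hf j
      rcases hb with rfl | hb
      · simp only [Nat.zero_min, Nat.le_zero] at h4
        simp [h4]
      · refine ⟨?_, Or.inr hb⟩
        have h5 : f j ≤ (q + 1) ^ i := h4.trans (min_le_right _ _)
        calc 3 * f j = f j * 3 := mul_comm _ _
          _ ≤ (q + 1) ^ i * (q + 1) := Nat.mul_le_mul h5 (by omega)
          _ = _ := (pow_succ _ _).symm
    obtain ⟨g, hg, hgs⟩ := exists_sum_range_eq (q + 1) (fun j => (q + 1) ^ (i + 1) - 3 * f j) a (by
      have : ∑ j ∈ Finset.range (q + 1), ((q + 1) ^ (i + 1) - 3 * f j) +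
          3 * ∑ j ∈ Finset.range (q + 1), f j = (q + 1) ^ (i + 1 + 1) := by
        rw [Finset.mul_sum, ← Finset.sum_add_distrib,
          Finset.sum_congr rfl (g := fun _ => (q + 1) ^ (i + 1))
            (fun j _ => Nat.sub_add_cancel (h3 j).1)]
        simp [pow_succ, mul_comm]
      omega)
    have hle : ∀ j, g j * q + f j * (q + 2) ≤ q * (q + 1) ^ (i + 1) := by
      intro j
      have h4 := hg j
      have h5 := (h3 j).1
      have h6 : g j + 3 * f j ≤ (q + 1) ^ (i + 1) := by omega
      have h7 := Nat.mul_le_mul_left q h6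
      have h8 : f j * (q + 2) ≤ q * (3 * f j) := by nlinarith [Nat.zero_le (f j)]
      nlinarith
    have hle' : ∀ j, g j * q + f j * (q + 2) < (q + 1) ^ (i + 2) := by
      intro j
      refine (hle j).trans_lt ?_
      rw [show i + 2 = (i + 1) + 1 by omega, pow_succ (n := i + 1), mul_comm]
      exact Nat.mul_lt_mul_of_pos_left (by omega) (Nat.pow_pos (by omega))
    refine Jump.sum hk hw (i := i + 2)
      (δ := fun j => (q + 1) ^ (i + 2) - (g j * q + f j * (q + 2))) ?_ ?_ ?_
    · intro j _
      have := hle' j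
      omega
    · intro j _
      have h4 := hg j
      have h5 := (h3 j).1
      have h6 := hle' j
      exact ih (g j) (f j) _ (h3 j).2 (by omega) ((hf j).trans (min_le_right _ _)) (by omega)
    · have h9 : ∑ j ∈ Finset.range (q + 1), ((q + 1) ^ (i + 2) - (g j * q + f j * (q + 2))) +
          (a * q + b * (q + 2)) = (q + 1) ^ (i + 1 + 2) := by
        rw [← hgs, ← hfs, Finset.sum_mul, Finset.sum_mul, ← Finset.sum_add_distrib,
          ← Finset.sum_add_distrib, Finset.sum_congr rfl (g := fun _ => (q + 1) ^ (i + 2))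
            (fun j _ => Nat.sub_add_cancel (hle' j).le)]
        simp only [Finset.sum_const, Finset.card_range, smul_eq_mul]
        ring
      rw [show q + 2 - 1 = q + 1 by omega]
      omega

end jump

/-! ### The numerical semigroup generated by `k - 2` and `k` -/

/-- From `cycleThreshold k` on, every number (every even number, if `k` is even) is a combination
of `k - 2` and `k` with natural coefficients. -/
def cycleThreshold (k : ℕ) : ℕ := if Even k then (k - 2) * (k - 4) / 2 else (k - 1) * (k - 3)

theorem cycleThreshold_of_odd {k : ℕ} (hk : Odd k) : cycleThreshold k = (k - 1) * (k - 3) :=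
  if_neg (Nat.not_even_iff_odd.2 hk)

theorem two_mul_cycleThreshold_of_even {k : ℕ} (hk : Even k) :
    2 * cycleThreshold k = (k - 2) * (k - 4) := by
  rw [cycleThreshold, if_pos hk]
  refine Nat.mul_div_cancel' (Dvd.dvd.mul_right ?_ _)
  obtain ⟨m, rfl⟩ := hk
  omega

theorem cycleThreshold_le {k : ℕ} : cycleThreshold k ≤ k * k := by
  rcases Nat.even_or_odd k with h | h
  · have h1 := two_mul_cycleThreshold_of_even h
    have h2 : (k - 2) * (k - 4) ≤ k * k := Nat.mul_le_mul (by omega) (by omega)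
    omega
  · rw [cycleThreshold_of_odd h]
    exact Nat.mul_le_mul (by omega) (by omega)

/-- A sum of `N` generators, `b` of them equal to `k`, is `N * (k - 2) + 2 * b` with `b ≤ N`.
Division with remainder finds `N` and `b`, and the threshold forces `b ≤ N`. For odd `k`, `N` is
even or odd according to the parity of `s`. -/
theorem exists_combination {k s : ℕ} (hk : 3 ≤ k) (hs : cycleThreshold k ≤ s)
    (hp : Odd k ∨ Even s) : ∃ a b, b ≤ k - 3 ∧ s = a * (k - 2) + b * k := by
  rcases Nat.even_or_odd k with hke | hko
  · have hse := hp.resolve_left (Nat.not_odd_iff_even.2 hke)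
    have h1 := two_mul_cycleThreshold_of_even hke
    obtain ⟨x, rfl⟩ := hse
    obtain ⟨m, rfl⟩ := hke
    obtain ⟨c, rfl⟩ : ∃ c, m = c + 2 := ⟨m - 2, by omega⟩
    have h2 : c * (c + 1) ≤ x := by
      have : (c + 2 + (c + 2) - 2) * (c + 2 + (c + 2) - 4) = 4 * (c * (c + 1)) := by
        rw [show c + 2 + (c + 2) - 2 = 2 * (c + 1) by omega,
          show c + 2 + (c + 2) - 4 = 2 * c by omega]
        ring
      omega
    have h3 := Nat.div_add_mod x (c + 1)
    have h4 := Nat.mod_lt x (show 0 < c + 1 by omega)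
    set b := x % (c + 1)
    set q := x / (c + 1)
    clear_value b q
    have hqb : b ≤ q := by
      by_contra hlt
      have : (c + 1) * q ≤ (c + 1) * (b - 1) := Nat.mul_le_mul_left _ (by omega)
      obtain ⟨b', hb'⟩ : ∃ b', b = b' + 1 := ⟨b - 1, by omega⟩
      rw [hb', Nat.add_sub_cancel] at this
      have h5 : b' + 1 ≤ c := by omega
      nlinarith
    refine ⟨q - b, b, by omega, ?_⟩
    obtain ⟨d, hd⟩ := Nat.exists_eq_add_of_le hqb
    rw [hd] at h3 ⊢
    rw [show b + d - b = d by omega, show c + 2 + (c + 2) - 2 = 2 * (c + 1) by omega, ← h3]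
    ring
  · rw [cycleThreshold_of_odd hko] at hs
    obtain ⟨c, hc⟩ := hko
    obtain ⟨c, rfl⟩ : ∃ c', c = c' + 1 := ⟨c - 1, by omega⟩
    subst hc
    simp only [show 2 * (c + 1) + 1 - 1 = 2 * c + 2 by omega,
      show 2 * (c + 1) + 1 - 3 = 2 * c by omega, show 2 * (c + 1) + 1 - 2 = 2 * c + 1 by omega] at *
    have key : ∀ y, 2 * y = s ∨ 2 * y = s + (2 * c + 1) →
        ∃ a b, b ≤ 2 * c ∧ s = a * (2 * c + 1) + b * (2 * (c + 1) + 1) := by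
      intro y hy
      have h3 := Nat.div_add_mod y (2 * c + 1)
      have h4 := Nat.mod_lt y (show 0 < 2 * c + 1 by omega)
      set b := y % (2 * c + 1)
      set q := y / (2 * c + 1)
      have h5 : b ≤ 2 * c := by omega
      rcases hy with hy | hy
      · have hqb : b ≤ 2 * q := by
          by_contra hlt
          have : (2 * c + 1) * (2 * q) ≤ (2 * c + 1) * (b - 1) := Nat.mul_le_mul_left _ (by omega)
          obtain ⟨b', hb'⟩ : ∃ b', b = b' + 1 := ⟨b - 1, by omega⟩
          rw [hb', Nat.add_sub_cancel] at this
          nlinarith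
        obtain ⟨d, hd⟩ := Nat.exists_eq_add_of_le hqb
        refine ⟨d, b, h5, ?_⟩
        calc s = (2 * c + 1) * (2 * q) + 2 * b := by rw [← hy, ← h3]; ring
          _ = _ := by rw [hd]; ring
      · have hqb : b + 1 ≤ 2 * q := by
          by_contra hlt
          have : (2 * c + 1) * (2 * q) ≤ (2 * c + 1) * b := Nat.mul_le_mul_left _ (by omega)
          nlinarith
        obtain ⟨d, hd⟩ := Nat.exists_eq_add_of_le hqb
        refine ⟨d, b, h5, ?_⟩
        have : s + (2 * c + 1) = (2 * c + 1) * (2 * q) + 2 * b := by rw [← hy, ← h3]; ring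
        rw [hd] at this
        nlinarith
    rcases Nat.even_or_odd s with ⟨y, hy⟩ | ⟨y, hy⟩
    · exact key y (Or.inl (by omega))
    · exact key (y + c + 1) (Or.inr (by omega))

section

variable {V : Type*} [Fintype V] {k : ℕ} {G : SimpleGraph V} {w : ℤ → V} {l r : ℤ}

theorem even_defect {k i d s : ℕ} (h : d + s = (k - 1) ^ i) (hp : Odd k ∨ Odd d) (hk : 3 ≤ k) :
    Odd k ∨ Even s := by
  rcases Nat.even_or_odd k with hke | hko
  · right
    have hd := hp.resolve_left (Nat.not_odd_iff_even.2 hke)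
    have h1 : Odd ((k - 1) ^ i) := by
      apply Odd.pow
      rw [Nat.odd_sub (by omega)]
      simp [hke]
    rw [← h] at h1
    rw [Nat.odd_add] at h1
    exact h1.1 hd
  · exact Or.inl hko

/-- The lower bound on `d` limits the total loss, so that the numbers of losses of both kinds fit
the capacity in `jump_of_defect`. -/
theorem jump_of_mem_range (hk : 4 ≤ k) (hw : Set.InjOn w (Set.Icc l r))
    (hadj : ∀ z, l ≤ z → z < r → G.Adj (w z) (w (z + 1))) {i d : ℕ} (hi : 1 ≤ i)
    (hp : Odd k ∨ Odd d) (hlow : (k - 1) ^ (i + 1) + 3 * k * k ≤ d)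
    (hup : d + cycleThreshold k ≤ (k - 1) ^ (i + 2)) : Jump k G w l r (i + 2) d := by
  obtain ⟨s, hs⟩ := Nat.exists_eq_add_of_le (show d ≤ (k - 1) ^ (i + 2) by omega)
  obtain ⟨a, b, hb, hab⟩ := exists_combination (s := s) (by omega) (by omega)
    (even_defect hs.symm hp (by omega))
  refine jump_of_defect (by omega) hw hadj i a b d (Or.inr hk) ?_ ?_ (by omega)
  · obtain ⟨q, rfl⟩ : ∃ q, k = q + 2 := ⟨k - 2, by omega⟩
    simp only [Nat.add_sub_cancel, show q + 2 - 1 = q + 1 by omega] at *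
    have h1 : (q + 1) ^ (i + 2) = (q + 1) * (q + 1) ^ (i + 1) := by ring
    have h2 : a * q + b * (q + 2) + 3 * (q + 2) * (q + 2) ≤ q * (q + 1) ^ (i + 1) := by
      rw [← hab]; nlinarith
    have h3 : (a + 3 * b) * q ≤ (q + 1) ^ (i + 1) * q := by
      have : b * q ≤ (q + 2) * (q + 2) := Nat.mul_le_mul (by omega) (by omega)
      nlinarith
    exact Nat.le_of_mul_le_mul_right h3 (by omega)
  · calc b ≤ k - 1 := by omega
      _ = (k - 1) ^ 1 := (pow_one _).symm
      _ ≤ (k - 1) ^ i := Nat.pow_le_pow_right (by omega) hi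

/-- On a path, from some time on, all jumps of the right parity occur whose length is at least a
constant and at most `(k - 1) ^ i - cycleThreshold k`. -/
theorem exists_jump_range (hk : 3 ≤ k) : ∃ A₀ i₀ : ℕ, ∀ {V : Type*} [Fintype V] {G : SimpleGraph V}
    {w : ℤ → V} {l r : ℤ}, Set.InjOn w (Set.Icc l r) →
    (∀ z, l ≤ z → z < r → G.Adj (w z) (w (z + 1))) → ∀ i d : ℕ, i₀ ≤ i → A₀ ≤ d →
    (Odd k ∨ Odd d) → d + cycleThreshold k ≤ (k - 1) ^ i → Jump k G w l r i d := by
  rcases hk.eq_or_lt with rfl | hk4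
  · refine ⟨1, 0, fun {V} _ {G w l r} hw hadj i d _ hd _ hup => ?_⟩
    have hthr : cycleThreshold 3 = 0 := by decide
    rw [hthr, add_zero] at hup
    clear hthr
    induction i generalizing d with
    | zero =>
      obtain rfl : d = 1 := by simp at hup; omega
      exact jump_one hadj 0
    | succ i ih =>
      simp only [Nat.reduceSub, pow_succ] at ih hup
      rcases hd.eq_or_lt with rfl | hd1
      · exact jump_one hadj _
      refine Jump.sum le_rfl hw (i := i) (δ := fun j => if j = 0 then d / 2 else d - d / 2) ?_ ?_ ?_
      · intro j _; split_ifs <;> omega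
      · intro j _
        split_ifs
        · exact ih _ (by omega) (by omega) (Or.inl (by decide)) (by omega)
        · exact ih _ (by omega) (by omega) (Or.inl (by decide)) (by omega)
      · simp [Finset.sum_range_succ]; omega
  set J := 10 * k * k with hJ
  have hPJ : ∀ i, J + 1 ≤ i → 10 * k * k ≤ (k - 1) ^ i := by
    intro i hi
    have : i < (k - 1) ^ i := Nat.lt_pow_self (by omega)
    omega
  refine ⟨(k - 1) ^ (J + 2) + 3 * k * k, J + 3, fun {V} _ {G w l r} hw hadj i d hi hd hp hup => ?_⟩
  induction i, hi using Nat.le_induction with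
  | base => exact jump_of_mem_range hk4 hw hadj (i := J + 1) (by omega) hp hd hup
  | succ i hi ih =>
    rcases le_or_gt (d + cycleThreshold k) ((k - 1) ^ i) with h | h
    · exact (ih h).mono (Nat.le_succ i)
    obtain ⟨i, rfl⟩ : ∃ i', i = i' + 2 := ⟨i - 2, by omega⟩
    rcases le_or_gt ((k - 1) ^ (i + 2) + 3 * k * k) d with h1 | h1
    · exact jump_of_mem_range hk4 hw hadj (i := i + 1) (by omega) hp h1 hup
    have hP := hPJ (i + 1) (by omega)
    have hthr := cycleThreshold_le (k := k)
    have hpow : (k - 1) ^ (i + 2) = (k - 1) * (k - 1) ^ (i + 1) := by ring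
    have h3 : 3 * (k - 1) ^ (i + 1) ≤ (k - 1) ^ (i + 2) := by
      rw [hpow]; exact Nat.mul_le_mul_right _ (by omega)
    have hkk : k ≤ k * k := Nat.le_mul_self k
    have e0 : 3 * k * k = 3 * (k * k) := by ring
    have e1 : 10 * k * k = 10 * (k * k) := by ring
    rw [e0] at h1
    rw [e1] at hP
    -- Lengths close to `(k - 1) ^ (i + 2)` fall between two consecutive ranges; they are reached by
    -- two jumps of about half the length and `k - 3` unit steps. For even `k` both halves must be
    -- odd.
    have main : ∀ e₁ e₂, e₁ + e₂ + (k - 3) = d → (Odd k ∨ Odd e₁ ∧ Odd e₂) →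
        e₁ ≤ e₂ + 2 → e₂ ≤ e₁ + 2 → Jump k G w l r (i + 2 + 1) d := by
      intro e₁ e₂ hsum hodd h4 h5
      have hJ1 : Jump k G w l r (i + 2) e₁ :=
        jump_of_mem_range hk4 hw hadj (by omega) (hodd.imp id And.left) (by rw [e0]; omega)
          (by omega)
      have hJ2 : Jump k G w l r (i + 2) e₂ :=
        jump_of_mem_range hk4 hw hadj (by omega) (hodd.imp id And.right) (by rw [e0]; omega)
          (by omega)
      refine Jump.sum hk hw (i := i + 2)
        (δ := fun j => if j = 0 then e₁ else if j = 1 then e₂ else 1) ?_ ?_ ?_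
      · intro j _; split_ifs <;> omega
      · intro j _
        split_ifs
        · exact hJ1
        · exact hJ2
        · exact jump_one hadj _
      · rw [show k - 1 = (k - 3) + 1 + 1 by omega, Finset.sum_range_succ', Finset.sum_range_succ']
        simp
        omega
    rcases Nat.even_or_odd k with hke | hko
    · have hd := hp.resolve_left (Nat.not_odd_iff_even.2 hke)
      rw [Nat.odd_iff] at hd
      rw [Nat.even_iff] at hke
      have hx := Nat.div_add_mod (d - (k - 3)) 4
      have hx4 := Nat.mod_lt (d - (k - 3)) (show 0 < 4 by omega)
      rcases Nat.mod_two_eq_zero_or_one ((d - (k - 3)) / 2) with h5 | h5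
      · refine main ((d - (k - 3)) / 2 - 1) ((d - (k - 3)) / 2 + 1) (by omega)
          (Or.inr ⟨?_, ?_⟩) (by omega) (by omega) <;> rw [Nat.odd_iff] <;> omega
      · refine main ((d - (k - 3)) / 2) ((d - (k - 3)) / 2) (by omega)
          (Or.inr ⟨?_, ?_⟩) (by omega) (by omega) <;> rw [Nat.odd_iff] <;> omega
    · exact main ((d - (k - 3)) / 2) (d - (k - 3) - (d - (k - 3)) / 2) (by omega)
        (Or.inl hko) (by omega) (by omega)

end

/-! ### Rich components and the upper bound for odd `k` -/

section

variable {V : Type*} {k : ℕ}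

/-- The component of `u` has more than `k` vertices and contains a path on `k` vertices. -/
def RichAt (k : ℕ) (G : SimpleGraph V) (u : V) : Prop :=
  (∃ a b, G.Reachable u a ∧ G.HasPath (k - 1) a b) ∧
    ∃ S : Finset V, k < S.card ∧ ∀ z ∈ S, G.Reachable u z

theorem RichAt.of_reachable {G : SimpleGraph V} {u v : V} (h : G.RichAt k u)
    (huv : G.Reachable u v) : G.RichAt k v := by
  obtain ⟨⟨a, b, ha, hab⟩, S, hS, hSu⟩ := h
  exact ⟨⟨a, b, huv.symm.trans ha, hab⟩, S, hS, fun z hz => huv.symm.trans (hSu z hz)⟩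

variable [Fintype V]

theorem RichAt.adj_of_walk (hk : 3 ≤ k) {G : SimpleGraph V} {u v : V} (h : G.RichAt k u)
    (p : G.Walk u v) (huv : u ≠ v) (hp : Odd k ∨ Odd p.length) {i : ℕ}
    (hi : (4 * k + p.length + 1) ^ 2 ≤ i) : (cycleProc k G i).Adj u v := by
  obtain ⟨⟨a, b, ha, hab⟩, S, hS, hSu⟩ := h
  exact cycleProc_adj_of_short_walk hk p huv hp ha hab hS hSu hi

/-- A component without a path on `k` vertices never gains an edge, and one with at most `k`
vertices is finished after `k ^ 2` rounds. -/
theorem adj_or_richAt (hk : 3 ≤ k) {G : SimpleGraph V} {t : ℕ} (ht : k ^ 2 ≤ t) {u v : V}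
    (h : (cycleProc k G (t + 1)).Adj u v) : (cycleProc k G t).Adj u v ∨ G.RichAt k u := by
  classical
  by_contra hcon
  push Not at hcon
  obtain ⟨hnadj, hrich⟩ := hcon
  set C : Set V := {z | G.Reachable u z} with hC
  have hclosed : ∀ a b, a ∈ C → G.Adj a b → b ∈ C := fun a b ha hab => ha.trans hab.reachable
  have hu : u ∈ C := Reachable.refl u
  have hv : v ∈ C := cycleProc_reachable hk h
  have h1 := (cycleProc_induce hk hclosed (t + 1) ⟨u, hu⟩ ⟨v, hv⟩).1 h
  refine hnadj ((cycleProc_induce hk hclosed t ⟨u, hu⟩ ⟨v, hv⟩).2 ?_)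
  suffices cycleProc k (G.induce C) t = cycleProc k (G.induce C) (t + 1) by rwa [this]
  by_cases hpath : ∃ a b : C, (G.induce C).HasPath (k - 1) a b
  · refine cycleProc_card_sq _ (le_trans (Nat.pow_le_pow_left ?_ 2) ht)
    by_contra hcard
    obtain ⟨a, b, hab⟩ := hpath
    refine hrich ⟨⟨a, b, a.2, hab.map Subtype.val_injective fun _ _ h => h⟩, C.toFinset, ?_, ?_⟩
    · rw [Set.toFinset_card]; omega
    · intro z hz; simpa [hC] using hz
  · have h0 : cycleProc k (G.induce C) 0 = cycleProc k (G.induce C) (0 + 1) := by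
      ext a b
      rw [cycleProc_succ_adj hk]
      constructor
      · exact Or.inl
      · rintro (h | h)
        · exact h
        · exact absurd ⟨a, b, h⟩ hpath
    exact (cycleProc_eq_of_stable h0 (Nat.zero_le t)).trans
      (cycleProc_eq_of_stable h0 (Nat.zero_le (t + 1))).symm

theorem cycleProc_eq_succ_of_forall {G : SimpleGraph V} {t : ℕ}
    (h : ∀ u v, (cycleProc k G (t + 1)).Adj u v → (cycleProc k G t).Adj u v) :
    cycleProc k G t = cycleProc k G (t + 1) :=
  le_antisymm (cycleProc_mono G (Nat.le_succ t)) h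

/-- A path has at most `|V| - 1` edges, so the hypothesis puts its length into the range of
`exists_jump_range`; lengths below the constant there are handled by `RichAt.adj_of_walk`. -/
theorem cycleProc_eq_succ_of_odd (hk : 3 ≤ k) (hko : Odd k) : ∃ t₀ : ℕ, ∀ {V : Type*} [Fintype V]
    (G : SimpleGraph V) (t : ℕ), t₀ ≤ t →
    Fintype.card V + (k - 1) * (k - 3) ≤ (k - 1) ^ t + 1 →
    cycleProc k G t = cycleProc k G (t + 1) := by
  obtain ⟨A, i₀, hrange⟩ := exists_jump_range hk
  refine ⟨k ^ 2 + (4 * k + A + 1) ^ 2 + i₀, fun {V} _ G t ht hcard => ?_⟩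
  refine cycleProc_eq_succ_of_forall fun u v huv => ?_
  refine (adj_or_richAt hk (by omega) huv).elim id fun hrich => ?_
  obtain ⟨p, hp, hpl⟩ := (cycleProc_reachable hk huv).exists_path_of_dist
  rcases lt_or_ge p.length A with hA | hA
  · have h1 : (4 * k + p.length + 1) ^ 2 ≤ (4 * k + A + 1) ^ 2 :=
      Nat.pow_le_pow_left (by omega) 2
    exact hrich.adj_of_walk hk p huv.ne (Or.inl hko) (by omega)
  · have hinj := hp.getVert_injOn
    set w : ℤ → V := fun z => p.getVert z.toNat with hw
    have h1 : Set.InjOn w (Set.Icc 0 p.length) := by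
      intro a ha b hb hab
      have := hinj (x₁ := a.toNat) (x₂ := b.toNat)
        (by simp at ha ⊢; omega) (by simp at hb ⊢; omega) hab
      simp at ha hb
      omega
    have h2 : ∀ z : ℤ, 0 ≤ z → z < p.length → G.Adj (w z) (w (z + 1)) := by
      intro z hz hzl
      have := p.adj_getVert_succ (i := z.toNat) (by omega)
      simpa only [hw, show (z + 1).toNat = z.toNat + 1 by omega] using this
    have hlt := hp.length_lt
    have := hrange h1 h2 t p.length (by omega) hA (Or.inl hko)
      (by rw [cycleThreshold_of_odd hko]; omega) 0 le_rfl (by simp)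
    simpa [hw] using this

end

/-! ### Folded walks, for even `k` -/

/-- Two paths `x 0, …, x A` and `y 0, …, y B` with adjacent starting points which can only share
vertices of equal index. -/
structure Fold {V : Type*} (G : SimpleGraph V) (x y : ℕ → V) (A B : ℕ) : Prop where
  injOn_left : Set.InjOn x (Set.Iic A)
  injOn_right : Set.InjOn y (Set.Iic B)
  adj_left : ∀ j < A, G.Adj (x j) (x (j + 1))
  adj_right : ∀ j < B, G.Adj (y j) (y (j + 1))
  adj_zero : G.Adj (x 0) (y 0)
  eq_of_eq : ∀ i j, i ≤ A → j ≤ B → x i = y j → i = j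

namespace Fold

variable {V : Type*} {G : SimpleGraph V} {x y : ℕ → V} {A B : ℕ}

theorem symm (F : Fold G x y A B) : Fold G y x B A :=
  ⟨F.injOn_right, F.injOn_left, F.adj_right, F.adj_left, F.adj_zero.symm,
    fun i j hi hj h => (F.eq_of_eq j i hj hi h.symm).symm⟩

theorem mono (F : Fold G x y A B) {A' B' : ℕ} (hA : A' ≤ A) (hB : B' ≤ B) : Fold G x y A' B' :=
  ⟨F.injOn_left.mono fun _ h => le_trans h hA, F.injOn_right.mono fun _ h => le_trans h hB,
    fun j hj => F.adj_left j (by omega), fun j hj => F.adj_right j (by omega), F.adj_zero,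
    fun i j hi hj => F.eq_of_eq i j (by omega) (by omega)⟩

theorem exists_walk_right (F : Fold G x y A B) (j d : ℕ) (h : j + d ≤ B) :
    ∃ p : G.Walk (y j) (y (j + d)), p.length = d := by
  obtain ⟨p, hp⟩ := exists_walk_of_seq (G := G) (fun l => y (j + l)) d fun l hl =>
    F.adj_right (j + l) (by omega)
  exact ⟨p, hp⟩

theorem exists_walk (F : Fold G x y A B) {a b : ℕ} (ha : a ≤ A) (hb : b ≤ B) :
    ∃ p : G.Walk (x a) (y b), p.length = a + b + 1 := by
  have h₁ := F.exists_walk_right 0 b (by omega)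
  have h₂ := F.symm.exists_walk_right 0 a (by omega)
  rw [Nat.zero_add] at h₁ h₂
  obtain ⟨p, hp⟩ := h₁
  obtain ⟨q, hq⟩ := h₂
  refine ⟨q.reverse.append (p.cons F.adj_zero), ?_⟩
  rw [Walk.length_append, Walk.length_reverse, Walk.length_cons]
  omega

/-- The path `x 0, y 0, y 1, …` as a sequence indexed by `ℤ`. -/
def line (x y : ℕ → V) (z : ℤ) : V := if z ≤ 0 then x 0 else y (z - 1).toNat

theorem line_succ (x y : ℕ → V) (j : ℕ) : line x y (j + 1) = y j := by
  rw [line, if_neg (by omega)]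
  simp

theorem injOn_line (F : Fold G x y A B) : Set.InjOn (line x y) (Set.Icc 0 (B + 1)) := by
  have h0 : ∀ j ≤ B, x 0 ≠ y j := by
    intro j hj h
    obtain rfl := F.eq_of_eq 0 j (Nat.zero_le _) hj h
    exact F.adj_zero.ne h
  intro a ha b hb hab
  simp only [Set.mem_Icc] at ha hb
  rw [line, line] at hab
  split_ifs at hab
  · omega
  · exact absurd hab (h0 _ (by omega))
  · exact absurd hab.symm (h0 _ (by omega))
  · have := F.injOn_right (x₁ := (a - 1).toNat) (x₂ := (b - 1).toNat)
      (by simp; omega) (by simp; omega) hab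
    omega

theorem adj_line (F : Fold G x y A B) (z : ℤ) (h0 : 0 ≤ z) (hz : z < B + 1) :
    G.Adj (line x y z) (line x y (z + 1)) := by
  rcases h0.eq_or_lt with rfl | h
  · simpa [line] using F.adj_zero
  · obtain ⟨j, rfl⟩ : ∃ j : ℕ, z = j + 1 := ⟨(z - 1).toNat, by omega⟩
    have := line_succ x y (j + 1)
    push_cast at this
    rw [this, line_succ]
    exact F.adj_right j (by omega)

variable [Fintype V] {k : ℕ}

theorem adj_of_jump {i d : ℕ} (h : Jump k G (line x y) 0 (B + 1) i d) {j : ℕ} (hj : j + d ≤ B) :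
    (cycleProc k G i).Adj (y j) (y (j + d)) := by
  have h1 := h (j + 1) (by omega) (by omega)
  have h2 := line_succ x y (j + d)
  push_cast at h2
  rwa [show (j : ℤ) + 1 + d = j + d + 1 by ring, h2, line_succ] at h1

theorem adj_pow_right (F : Fold G x y A B) (hk : 3 ≤ k) (i : ℕ) {j : ℕ}
    (hj : j + (k - 1) ^ i ≤ B) : (cycleProc k G i).Adj (y j) (y (j + (k - 1) ^ i)) :=
  adj_of_jump (x := x) (jump_pow hk F.injOn_line F.adj_line i) hj

theorem adj_pow_zero (F : Fold G x y A B) (hk : 3 ≤ k) (i : ℕ) {b : ℕ}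
    (hb : b + 1 = (k - 1) ^ i) (hB : b ≤ B) : (cycleProc k G i).Adj (x 0) (y b) := by
  have h1 := jump_pow hk F.injOn_line F.adj_line i 0 le_rfl (by omega)
  rw [← hb] at h1
  have h2 := line_succ x y b
  push_cast at h1
  rw [zero_add, h2] at h1
  simpa [line] using h1

/-- From some time on, odd jumps on the right path are possible up to a constant less than
`(k - 1) ^ i`. -/
theorem exists_adj_right (hk : 3 ≤ k) : ∃ i₀ : ℕ, ∀ {V : Type*} [Fintype V] {G : SimpleGraph V}
    {x y : ℕ → V} {A B : ℕ}, Fold G x y A B → G.RichAt k (x 0) → ∀ i d j : ℕ, i₀ ≤ i → Odd d →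
    d + cycleThreshold k ≤ (k - 1) ^ i → j + d ≤ B → (cycleProc k G i).Adj (y j) (y (j + d)) := by
  obtain ⟨A₀, i₀, h⟩ := exists_jump_range hk
  refine ⟨i₀ + (4 * k + A₀ + 1) ^ 2, fun {V} _ {G x y A B} F hr i d j hi hd hup hj => ?_⟩
  rcases lt_or_ge d A₀ with hA | hA
  · obtain ⟨p, hp⟩ := F.exists_walk_right j d hj
    obtain ⟨q, -⟩ := F.exists_walk (a := 0) (b := j) (by omega) (by omega)
    have h1 : (4 * k + p.length + 1) ^ 2 ≤ (4 * k + A₀ + 1) ^ 2 :=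
      Nat.pow_le_pow_left (by omega) 2
    refine (hr.of_reachable q.reachable).adj_of_walk hk p ?_ (Or.inr (by rwa [hp])) (by omega)
    intro heq
    have := F.injOn_right (x₁ := j) (x₂ := j + d) (by simp; omega) (by simp; omega) heq
    have := hd.pos
    omega
  · exact adj_of_jump (x := x) (h F.injOn_line F.adj_line i d (by omega) hA (Or.inr hd) hup) hj

/-- Descending along the left path, crossing over and ascending along the right path. -/
theorem adj_succ_of_chains (F : Fold G x y A B) (hk : 3 ≤ k) {i l r : ℕ} (hlr : l + r + 2 = k)
    {α β : ℕ → ℕ} (hα : ∀ j < l, α (j + 1) < α j) (hβ : ∀ j < r, β (j + 1) < β j)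
    (hαA : α 0 ≤ A) (hβB : β 0 ≤ B)
    (hα' : ∀ j < l, (cycleProc k G i).Adj (x (α j)) (x (α (j + 1))))
    (hβ' : ∀ j < r, (cycleProc k G i).Adj (y (β j)) (y (β (j + 1))))
    (hlr' : (cycleProc k G i).Adj (x (α l)) (y (β r))) (hne : x (α 0) ≠ y (β 0))
    (hαβ : ∀ j ≤ l, ∀ j' ≤ r, α j = β j' → j = 0 ∧ j' = 0) :
    (cycleProc k G (i + 1)).Adj (x (α 0)) (y (β 0)) := by
  have anti : ∀ (f : ℕ → ℕ) (n : ℕ), (∀ j < n, f (j + 1) < f j) → ∀ a b, a < b → b ≤ n →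
      f b < f a := by
    intro f n hf a b hab
    induction b, hab using Nat.le_induction with
    | base => exact fun hb => hf a (by omega)
    | succ b _ ih => exact fun hb => (hf b (by omega)).trans (ih (by omega))
  have hle : ∀ (f : ℕ → ℕ) (n : ℕ), (∀ j < n, f (j + 1) < f j) → ∀ b, b ≤ n → f b ≤ f 0 := by
    intro f n hf b hb
    rcases Nat.eq_zero_or_pos b with rfl | h
    · exact le_rfl
    · exact (anti f n hf 0 b h hb).le
  have hinj : ∀ (f : ℕ → ℕ) (n : ℕ), (∀ j < n, f (j + 1) < f j) → ∀ a b, a ≤ n → b ≤ n →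
      f a = f b → a = b := by
    intro f n hf a b ha hb hab
    rcases lt_trichotomy a b with h | h | h
    · have := anti f n hf a b h hb; omega
    · exact h
    · have := anti f n hf b a h ha; omega
  rw [cycleProc_succ_adj hk]
  right
  have hcross : ∀ j ≤ l, ∀ j' ≤ r, x (α j) ≠ y (β j') := by
    intro j hj j' hj' h
    have h1 := F.eq_of_eq _ _ ((hle α l hα j hj).trans hαA) ((hle β r hβ j' hj').trans hβB) h
    obtain ⟨rfl, rfl⟩ := hαβ j hj j' hj' h1
    exact hne h
  refine ⟨fun j => if j ≤ l then x (α j) else y (β (k - 1 - j)), by simp, ?_, ?_, ?_⟩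
  · beta_reduce
    rw [if_neg (by omega), Nat.sub_self]
  · intro j hj
    beta_reduce
    rcases lt_trichotomy j l with h | rfl | h
    · rw [if_pos (by omega), if_pos (by omega)]
      exact hα' j h
    · rw [if_pos (by omega), if_neg (by omega), show k - 1 - (j + 1) = r by omega]
      exact hlr'
    · rw [if_neg (by omega), if_neg (by omega), show k - 1 - j = (k - 1 - (j + 1)) + 1 by omega]
      exact (hβ' _ (by omega)).symm
  · intro a ha b hb hab
    simp only [Set.mem_Iic] at ha hb
    beta_reduce at hab
    split_ifs at hab
    · have := F.injOn_left ((hle α l hα a (by omega)).trans hαA)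
        ((hle α l hα b (by omega)).trans hαA) hab
      exact hinj α l hα a b (by omega) (by omega) this
    · exact absurd hab (hcross _ (by omega) _ (by omega))
    · exact absurd hab.symm (hcross _ (by omega) _ (by omega))
    · have := F.injOn_right ((hle β r hβ (k - 1 - a) (by omega)).trans hβB)
        ((hle β r hβ (k - 1 - b) (by omega)).trans hβB) hab
      have := hinj β r hβ _ _ (by omega) (by omega) this
      omega

/-- Extension of a crossing edge by jumps of length `(k - 1) ^ i`. -/
theorem adj_succ_of_pow (F : Fold G x y A B) (hk : 3 ≤ k) {i l r a b : ℕ} (hlr : l + r + 2 = k)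
    (hab : (cycleProc k G i).Adj (x a) (y b)) (hA : a + l * (k - 1) ^ i ≤ A)
    (hB : b + r * (k - 1) ^ i ≤ B)
    (hne : ∀ u v, a + u * (k - 1) ^ i ≠ b + v * (k - 1) ^ i) :
    (cycleProc k G (i + 1)).Adj (x (a + l * (k - 1) ^ i)) (y (b + r * (k - 1) ^ i)) := by
  have hQ : 0 < (k - 1) ^ i := Nat.pow_pos (by omega)
  have hstep : ∀ n c j, j < n →
      c + (n - j) * (k - 1) ^ i = c + (n - (j + 1)) * (k - 1) ^ i + (k - 1) ^ i := by
    intro n c j hj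
    rw [show n - j = (n - (j + 1)) + 1 by omega, add_mul]
    ring
  have hle : ∀ n j, (n - j) * (k - 1) ^ i ≤ n * (k - 1) ^ i := fun n j =>
    Nat.mul_le_mul_right _ (Nat.sub_le _ _)
  have key := F.adj_succ_of_chains hk (i := i) hlr (α := fun j => a + (l - j) * (k - 1) ^ i)
    (β := fun j => b + (r - j) * (k - 1) ^ i) ?_ ?_ (by simpa using hA) (by simpa using hB) ?_ ?_
    ?_ ?_ ?_
  · simpa using key
  · intro j hj
    have := hstep l a j hj
    omega
  · intro j hj
    have := hstep r b j hj
    omega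
  · intro j hj
    rw [hstep l a j hj]
    have := hle l j
    exact (F.symm.adj_pow_right hk i (by rw [← hstep l a j hj]; omega)).symm
  · intro j hj
    rw [hstep r b j hj]
    have := hle r j
    exact (F.adj_pow_right hk i (by rw [← hstep r b j hj]; omega)).symm
  · simpa using hab
  · intro h
    exact hne _ _ (F.eq_of_eq _ _ (by simpa using hA) (by simpa using hB) h)
  · intro j _ j' _ h
    exact absurd h (hne _ _)

/-- A crossing edge of length `(k - 1) ^ i` yields crossing edges of the same asymmetry and length
`(k - 1) ^ i'` for all `i' ≥ i`. -/
theorem adj_of_asymmetry (F : Fold G x y A B) (hk : 3 ≤ k) (hke : Even k) {i o : ℕ} (ho : 0 < o)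
    (hbase : ∀ a, 2 * a + o + 1 = (k - 1) ^ i → a ≤ A → a + o ≤ B →
      (cycleProc k G i).Adj (x a) (y (a + o)))
    (hoi : o < (k - 1) ^ i) {i' : ℕ} (hi : i ≤ i') :
    ∀ a, 2 * a + o + 1 = (k - 1) ^ i' → a ≤ A → a + o ≤ B →
      (cycleProc k G i').Adj (x a) (y (a + o)) := by
  obtain ⟨m, hm⟩ := hke
  obtain ⟨m, rfl⟩ : ∃ m', m = m' + 1 := ⟨m - 1, by omega⟩
  have hoQ : ∀ j, i ≤ j → o < (k - 1) ^ j ∧ Odd ((k - 1) ^ j) := fun j hj =>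
    ⟨hoi.trans_le (Nat.pow_le_pow_right (by omega) hj), Odd.pow ⟨m, by omega⟩⟩
  induction i', hi using Nat.le_induction with
  | base => exact hbase
  | succ j hj ih =>
    intro a ha hA hB
    obtain ⟨hoj, hodd⟩ := hoQ j hj
    have hodd' := (hoQ (j + 1) (by omega)).2
    rw [Nat.odd_iff] at hodd hodd'
    obtain ⟨a', ha'⟩ : ∃ a', 2 * a' + o + 1 = (k - 1) ^ j :=
      ⟨((k - 1) ^ j - o - 1) / 2, by omega⟩
    have hpow : (k - 1) ^ (j + 1) = 2 * (m * (k - 1) ^ j) + (k - 1) ^ j := by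
      rw [pow_succ, mul_comm]
      nth_rewrite 1 [show k - 1 = 2 * m + 1 by omega]
      ring
    obtain rfl : a = a' + m * (k - 1) ^ j := by omega
    have := F.adj_succ_of_pow hk (i := j) (l := m) (r := m) (a := a') (b := a' + o) (by omega)
      (ih a' ha' (by omega) (by omega)) hA (by omega) ?_
    · rwa [show a' + m * (k - 1) ^ j + o = a' + o + m * (k - 1) ^ j by omega]
    · intro u v h
      rcases le_or_gt u v with huv | huv
      · have := Nat.mul_le_mul_right ((k - 1) ^ j) huv
        omega
      · have := Nat.mul_le_mul_right ((k - 1) ^ j) huv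
        rw [Nat.succ_mul] at this
        omega

/-- The seed at time `1` is the edge from `x 0` to `y (k - 2)`. -/
theorem adj_of_asymmetry_sub_two (F : Fold G x y A B) (hk : 4 ≤ k) (hke : Even k) {i a : ℕ}
    (hi : 1 ≤ i) (ha : 2 * a + (k - 2) + 1 = (k - 1) ^ i) (hA : a ≤ A) (hB : a + (k - 2) ≤ B) :
    (cycleProc k G i).Adj (x a) (y (a + (k - 2))) := by
  refine F.adj_of_asymmetry (by omega) hke (o := k - 2) (i := 1) (by omega) ?_ (by simp; omega) hi
    a ha hA hB
  intro a ha hA hB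
  rw [pow_one] at ha
  obtain rfl : a = 0 := by omega
  rw [zero_add] at hB ⊢
  exact F.adj_pow_zero (by omega) 1 (by simp; omega) hB

/-- The seed arises at time `2`: the edge from `x (k - 2)` to `y 0` has asymmetry `-(k - 2)`, and
two more jumps of length `k - 1` on the right than on the left add `2 * (k - 1)`. -/
theorem adj_of_asymmetry_self (F : Fold G x y A B) (hk : 4 ≤ k) (hke : Even k) {i a : ℕ}
    (hi : 2 ≤ i) (ha : 2 * a + k + 1 = (k - 1) ^ i) (hA : a ≤ A) (hB : a + k ≤ B) :
    (cycleProc k G i).Adj (x a) (y (a + k)) := by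
  have hk2 : k < (k - 1) ^ 2 := by
    obtain ⟨q, rfl⟩ : ∃ q, k = q + 4 := ⟨k - 4, by omega⟩
    rw [show q + 4 - 1 = q + 3 by omega]
    nlinarith
  refine F.adj_of_asymmetry (by omega) hke (o := k) (i := 2) (by omega) ?_ hk2 hi a ha hA hB
  intro a ha hA hB
  obtain ⟨m, rfl⟩ := hke
  obtain ⟨m, rfl⟩ : ∃ m', m = m' + 2 := ⟨m - 2, by omega⟩
  have h1 : 2 * m + 2 ≤ A := by nlinarith [show m + 2 + (m + 2) - 1 = 2 * m + 3 by omega]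
  have h := (F.symm.adj_pow_zero (k := m + 2 + (m + 2)) (by omega) 1 (b := 2 * m + 2)
    (by simp; omega) h1).symm
  have e : m + 2 + (m + 2) - 1 = 2 * m + 3 := by omega
  rw [e] at ha
  have ea : a = 2 * m + 2 + m * (m + 2 + (m + 2) - 1) ^ 1 := by rw [e]; nlinarith
  have eb : a + (m + 2 + (m + 2)) = 0 + (m + 2) * (m + 2 + (m + 2) - 1) ^ 1 := by rw [e]; nlinarith
  rw [ea, ← ea, eb]
  rw [ea]
  refine F.adj_succ_of_pow (by omega) (i := 1) (by omega) h (by rw [← ea]; exact hA)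
    (by rw [← eb]; exact hB) ?_
  intro u v huv
  rw [e, pow_one, zero_add] at huv
  rcases le_or_gt v u with h2 | h2
  · have := Nat.mul_le_mul_right (2 * m + 3) h2
    omega
  · have := Nat.mul_le_mul_right (2 * m + 3) h2
    rw [Nat.succ_mul] at this
    omega

end Fold

/-! ### Descents with prescribed step lengths -/

/-- `α` descends from `a` to `b` in `n` steps whose sizes satisfy `D`. -/
structure Descent (D : ℕ → Prop) (n a b : ℕ) (α : ℕ → ℕ) : Prop where
  zero : α 0 = a
  last : α n = b
  lt : ∀ j < n, α (j + 1) < α j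
  step : ∀ j < n, D (α j - α (j + 1))

theorem exists_even_add_notMem (S : Finset ℕ) (τ c : ℕ) :
    ∃ z, τ ≤ z ∧ z ≤ τ + (2 * S.card + 1) ∧ Even (z + c) ∧ z ∉ S := by
  by_contra hcon
  push Not at hcon
  obtain ⟨τ', h1, h2, h3⟩ : ∃ τ', τ ≤ τ' ∧ τ' ≤ τ + 1 ∧ Even (τ' + c) := by
    rcases Nat.even_or_odd (τ + c) with h | h
    · exact ⟨τ, le_rfl, by omega, h⟩
    · exact ⟨τ + 1, by omega, le_rfl, by rw [Nat.odd_iff] at h; rw [Nat.even_iff]; omega⟩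
  have hsub : (Finset.range (S.card + 1)).image (fun j => τ' + 2 * j) ⊆ S := by
    intro z hz
    obtain ⟨j, hj, rfl⟩ := Finset.mem_image.1 hz
    rw [Finset.mem_range] at hj
    refine hcon _ (by omega) (by omega) ?_
    rw [Nat.even_iff] at h3 ⊢
    omega
  have := Finset.card_le_card hsub
  rw [Finset.card_image_of_injective _ (fun a b h => by simpa using h), Finset.card_range] at this
  omega

/-- Each landing point may vary in a window of width `W`, which holds more than `|S|` points of the
right parity. This is how the two sides of a fold avoid equal indices. -/
theorem exists_descent_notMem {D : ℕ → Prop} (S : Finset ℕ) {J W : ℕ} (hW : 2 * S.card + 2 ≤ W)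
    (hJ : 2 * W ≤ J) (hD : ∀ d, Odd d → d ≤ J + W → D d) (n : ℕ) :
    ∀ a b : ℕ, b + n * W ≤ a → a ≤ b + n * J → Even (a + b + n) →
      ∃ α, Descent D n a b α ∧ ∀ j, 0 < j → j < n → α j ∉ S := by
  induction n with
  | zero =>
    intro a b h1 h2 _
    obtain rfl : a = b := by omega
    exact ⟨fun _ => a, ⟨rfl, rfl, by simp, by simp⟩, by simp⟩
  | succ n ih =>
    intro a b h1 h2 hpar
    rw [Nat.even_iff] at hpar
    rw [Nat.succ_mul] at h1 h2
    rcases Nat.eq_zero_or_pos n with rfl | hn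
    · refine ⟨fun j => if j = 0 then a else b, ⟨rfl, rfl, ?_, ?_⟩, by omega⟩
      · intro j hj
        obtain rfl : j = 0 := by omega
        simp
        omega
      · intro j hj
        obtain rfl : j = 0 := by omega
        refine hD _ ?_ (by simp; omega)
        simp only [↓reduceIte, Nat.zero_add, one_ne_zero]
        rw [Nat.odd_iff]
        omega
    · have h3 : n * W + W ≤ n * J := by
        obtain ⟨q, rfl⟩ : ∃ q, n = q + 1 := ⟨n - 1, by omega⟩
        nlinarith
      -- The first landing point: at least `b + n * W` to leave room for the other steps, and at
      -- least `a - (J + W)` to make the first step admissible.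
      obtain ⟨z, hz1, hz2, hz3, hz4⟩ :=
        exists_even_add_notMem S (max (b + n * W) (a - (J + W))) (b + n)
      rw [Nat.even_iff] at hz3
      have hlo := (le_max_left _ _).trans hz1
      have hlo' := (le_max_right _ _).trans hz1
      have hmax : max (b + n * W) (a - (J + W)) ≤ b + n * W ∨ max (b + n * W) (a - (J + W)) ≤ a - (J + W) := by
        omega
      have hup : z ≤ b + n * J ∧ z < a := by omega
      obtain ⟨α, hα, hαS⟩ := ih z b hlo hup.1 (by rw [Nat.even_iff]; omega)
      refine ⟨fun j => if j = 0 then a else α (j - 1), ⟨rfl, by simpa using hα.last, ?_, ?_⟩, ?_⟩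
      · intro j hj
        rcases Nat.eq_zero_or_pos j with rfl | h
        · simp [hα.zero, hup.2]
        · obtain ⟨j, rfl⟩ : ∃ j', j = j' + 1 := ⟨j - 1, by omega⟩
          simpa using hα.lt j (by omega)
      · intro j hj
        rcases Nat.eq_zero_or_pos j with rfl | h
        · simp only [↓reduceIte, Nat.zero_add, one_ne_zero, Nat.sub_self, hα.zero]
          refine hD _ ?_ (by omega)
          rw [Nat.odd_iff]
          omega
        · obtain ⟨j, rfl⟩ : ∃ j', j = j' + 1 := ⟨j - 1, by omega⟩
          simpa using hα.step j (by omega)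
      · intro j hj hjn
        beta_reduce
        rw [if_neg (by omega)]
        rcases Nat.eq_or_lt_of_le (show 1 ≤ j from hj) with rfl | h
        · simpa [hα.zero] using hz4
        · exact hαS _ (by omega) (by omega)

/-- Used for long descents, where there is no freedom to avoid points: all steps but the first have
the length `Q`, so the landing points are known. -/
theorem descent_stairs {D : ℕ → Prop} {n a b Q : ℕ} (hQ : D Q) (hQ0 : 0 < Q) (hlt : b + n * Q < a)
    (hd : D (a - (b + n * Q))) :
    Descent D (n + 1) a b (fun j => if j = 0 then a else b + (n + 1 - j) * Q) := by
  refine ⟨rfl, by simp, ?_, ?_⟩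
  · intro j hj
    rcases Nat.eq_zero_or_pos j with rfl | h
    · simpa using hlt
    · rw [if_neg (by omega), if_neg (by omega)]
      have : (n + 1 - (j + 1)) * Q < (n + 1 - j) * Q := Nat.mul_lt_mul_of_pos_right (by omega) hQ0
      omega
  · intro j hj
    rcases Nat.eq_zero_or_pos j with rfl | h
    · simpa using hd
    · rw [if_neg (by omega), if_neg (by omega), show n + 1 - j = (n + 1 - (j + 1)) + 1 by omega,
        Nat.succ_mul, ← Nat.add_assoc, Nat.add_sub_cancel_left]
      exact hQ

namespace Descent

variable {D : ℕ → Prop} {n a b : ℕ} {α : ℕ → ℕ}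

theorem lt_of_lt (h : Descent D n a b α) {i j : ℕ} (hij : i < j) (hj : j ≤ n) : α j < α i := by
  induction j, hij using Nat.le_induction with
  | base => exact h.lt i (by omega)
  | succ j _ ih => exact (h.lt j (by omega)).trans (ih (by omega))

theorem lt_first (h : Descent D n a b α) {j : ℕ} (h0 : 0 < j) (hj : j ≤ n) : α j < a :=
  h.zero ▸ h.lt_of_lt h0 hj

theorem last_le (h : Descent D n a b α) {j : ℕ} (hj : j ≤ n) : b ≤ α j := by
  rcases hj.eq_or_lt with rfl | hj
  · exact h.last.ge
  · exact (h.last ▸ h.lt_of_lt hj le_rfl).le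

end Descent

namespace Fold

variable {V : Type*} [Fintype V] {G : SimpleGraph V} {x y : ℕ → V} {A B k : ℕ}

theorem adj_succ_of_descent (F : Fold G x y A B) (hk : 3 ≤ k) {D : ℕ → Prop} {i l r a b : ℕ}
    (hlr : l + r + 2 = k) {α β : ℕ → ℕ}
    (hDx : ∀ d j, D d → j + d ≤ A → (cycleProc k G i).Adj (x j) (x (j + d)))
    (hDy : ∀ d j, D d → j + d ≤ B → (cycleProc k G i).Adj (y j) (y (j + d)))
    (hα : Descent D l A a α) (hβ : Descent D r B b β)
    (hab : (cycleProc k G i).Adj (x a) (y b)) (hne : x A ≠ y B)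
    (hαβ : ∀ j ≤ l, ∀ j' ≤ r, α j = β j' → j = 0 ∧ j' = 0) :
    (cycleProc k G (i + 1)).Adj (x A) (y B) := by
  have aux : ∀ {n c d : ℕ} {γ : ℕ → ℕ} {s : ℕ → V}, Descent D n c d γ →
      (∀ d j, D d → j + d ≤ c → (cycleProc k G i).Adj (s j) (s (j + d))) →
      ∀ j < n, (cycleProc k G i).Adj (s (γ j)) (s (γ (j + 1))) := by
    intro n c d γ s hγ hs j hj
    have h1 := hγ.lt j hj
    have h2 : γ j ≤ c := by
      rcases Nat.eq_zero_or_pos j with rfl | h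
      · exact hγ.zero.le
      · exact (hγ.lt_first h hj.le).le
    have := hs _ (γ (j + 1)) (hγ.step j hj) (by omega)
    rw [show γ (j + 1) + (γ j - γ (j + 1)) = γ j by omega] at this
    exact this.symm
  have key := F.adj_succ_of_chains hk hlr hα.lt hβ.lt hα.zero.le hβ.zero.le (aux hα hDx)
    (aux hβ hDy) (by rwa [hα.last, hβ.last]) (by rwa [hα.zero, hβ.zero]) hαβ
  rwa [hα.zero, hβ.zero] at key

end Fold

namespace Fold

variable {V : Type*} [Fintype V] {G : SimpleGraph V} {x y : ℕ → V} {A B k : ℕ}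

/-- For `A` small against `B`: cross immediately by `x A y (A + 2)` and spend all `k - 2` jumps on
the right. Only the index `A` has to be avoided. -/
theorem adj_succ_of_left_const (F : Fold G x y A B) (hk : 4 ≤ k) {D : ℕ → Prop} {i J W : ℕ}
    (hDx : ∀ d j, D d → j + d ≤ A → (cycleProc k G i).Adj (x j) (x (j + d)))
    (hDy : ∀ d j, D d → j + d ≤ B → (cycleProc k G i).Adj (y j) (y (j + d)))
    (hD : ∀ d, Odd d → d ≤ J + W → D d) (hW : 4 ≤ W) (hJ : 2 * W ≤ J) (hke : Even k)
    (hedge : (cycleProc k G i).Adj (x A) (y (A + 2))) (hne : x A ≠ y B) (hpar : Even (A + B))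
    (hlo : A + 2 + (k - 2) * W ≤ B) (hup : B ≤ A + 2 + (k - 2) * J) :
    (cycleProc k G (i + 1)).Adj (x A) (y B) := by
  obtain ⟨β, hβ, hβA⟩ := exists_descent_notMem (D := D) {A} (J := J) (W := W) (by simpa using hW)
    hJ hD (k - 2) B (A + 2) hlo hup (by rw [Nat.even_iff] at *; omega)
  refine F.adj_succ_of_descent (by omega) (l := 0) (r := k - 2) (by omega) hDx hDy
    (α := fun _ => A) ⟨rfl, rfl, by simp, by simp⟩ hβ hedge hne ?_
  intro j hj j' hj' h
  refine ⟨by omega, ?_⟩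
  rcases Nat.eq_zero_or_pos j' with h0 | h0
  · exact h0
  rcases hj'.eq_or_lt with rfl | h1
  · have := hβ.last; omega
  · exact absurd h.symm (by simpa using hβA j' h0 h1)

/-- For intermediate `A`: cross near the fold, with `q` jumps on the left and `q + 2` on the right.
The left landing points are chosen first, and the right ones avoid them. -/
theorem adj_succ_of_lt (F : Fold G x y A B) {D : ℕ → Prop} {i q J W e : ℕ} (hkq : k = 2 * q + 4)
    (hq : 0 < q)
    (hDx : ∀ d j, D d → j + d ≤ A → (cycleProc k G i).Adj (x j) (x (j + d)))
    (hDy : ∀ d j, D d → j + d ≤ B → (cycleProc k G i).Adj (y j) (y (j + d)))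
    (hD : ∀ d, Odd d → d ≤ J + W → D d) (hW : k + 4 ≤ W) (hJ : 2 * W ≤ J)
    (hedge : (cycleProc k G i).Adj (x e) (y (e + 2))) (hne : x A ≠ y B) (hpar : Even (A + B))
    (hAB : A ≤ B) (hpar' : Even (A + e + q)) (hA : e + q * W ≤ A) (hA' : A ≤ e + q * J)
    (hB : e + 2 + (q + 2) * W ≤ B) (hB' : B ≤ e + 2 + (q + 2) * J) :
    (cycleProc k G (i + 1)).Adj (x A) (y B) := by
  obtain ⟨α, hα, hαS⟩ := exists_descent_notMem (D := D) {e + 2} (J := J) (W := W) (by simp; omega)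
    hJ hD q A e hA hA' hpar'
  obtain ⟨β, hβ, hβS⟩ := exists_descent_notMem (D := D) ((Finset.range (q + 1)).image α) (J := J)
    (W := W) (by
      have := Finset.card_image_le (s := Finset.range (q + 1)) (f := α)
      rw [Finset.card_range] at this
      omega) hJ hD (q + 2) B (e + 2) hB hB' (by rw [Nat.even_iff] at *; omega)
  refine F.adj_succ_of_descent (by omega) (l := q) (r := q + 2) (by omega) hDx hDy hα hβ hedge
    hne ?_
  intro j hj j' hj' h
  have hWq : W ≤ q * W := Nat.le_mul_of_pos_left _ hq
  rcases Nat.eq_zero_or_pos j' with rfl | h0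
  · refine ⟨?_, rfl⟩
    by_contra hj0
    have := hα.lt_first (Nat.pos_of_ne_zero hj0) hj
    have := hβ.zero
    omega
  exfalso
  rcases hj'.eq_or_lt with rfl | h1
  · rw [hβ.last] at h
    rcases Nat.eq_zero_or_pos j with rfl | hj0
    · have := hα.zero; omega
    rcases hj.eq_or_lt with rfl | hj1
    · have := hα.last; omega
    · exact absurd h (by simpa using hαS j hj0 hj1)
  · exact hβS j' h0 h1 (Finset.mem_image.2 ⟨j, Finset.mem_range.2 (by omega), h⟩)

/-- For large `A`: the crossing edge has full length `Q` and asymmetry `o`, and both sides take `q +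
1` jumps. The loss is at most what the two first jumps can absorb; this is where the sharp constant
enters. -/
theorem adj_succ_of_asymmetry (F : Fold G x y A B) {D : ℕ → Prop} {i q Q J W thr v a o : ℕ}
    (hkq : k = 2 * q + 4)
    (hDx : ∀ d j, D d → j + d ≤ A → (cycleProc k G i).Adj (x j) (x (j + d)))
    (hDy : ∀ d j, D d → j + d ≤ B → (cycleProc k G i).Adj (y j) (y (j + d)))
    (hD : ∀ d, Odd d → d + thr ≤ Q → D d) (hDQ : D Q) (hDodd : ∀ d, D d → Odd d)
    (hthr : thr = 2 * v) (hJQ : Q = J + W + thr)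
    (hW : 2 * k + 10 ≤ W) (hJ : 2 * W ≤ J) (hJ' : q * (thr + W) + 2 * q + 5 ≤ J)
    (ho : o = 2 * q + 2 ∨ o = 2 * q + 4) (ha : 2 * a + o + 1 = Q)
    (hedge : (cycleProc k G i).Adj (x a) (y (a + o))) (hne : x A ≠ y B) (hpar : Even (A + B))
    (hle : A ≤ B) (hpar' : Even (A + a + (q + 1)))
    (hC : a + (q - 1) * Q + (2 * q + 5 + (q + 1) * W) ≤ A)
    (hB : 2 * B + 1 + 2 * thr + 2 * q ≤ 2 * (q * Q) + 3 * Q)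
    (hAB : A + B + 3 + 2 * thr + 2 * q ≤ 2 * (q * Q) + 3 * Q) :
    (cycleProc k G (i + 1)).Adj (x A) (y B) := by
  have hQodd : Q % 2 = 1 := Nat.odd_iff.1 (hDodd Q hDQ)
  rw [Nat.even_iff] at hpar hpar'
  have hqQ : (q * Q) % 2 = q % 2 := by rw [Nat.mul_mod, hQodd]; omega
  have hqJ : q * Q = q * J + q * (thr + W) := by rw [hJQ]; ring
  have hqJ' : (q + 1) * J = q * J + J := by ring
  have hDJ : ∀ d, Odd d → d ≤ J + W → D d := fun d hd h => hD d hd (by omega)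
  have hBr : B + thr ≤ a + o + q * Q + Q := by
    generalize q * Q = z at hB
    clear * - hB ha ho
    omega
  have hAr : A + thr ≤ a + q * Q + Q := by
    generalize q * Q = z at hAB hqQ
    clear * - hAB ha ho hle hpar' hqQ hQodd hthr
    omega
  have hBpar : (B + a + o + q) % 2 = 1 := by
    clear * - hpar hpar' ho
    omega
  have hmulJ : (q + 1) * J ≥ q * Q + (2 * q + 5) := by
    rw [hqJ', hqJ]
    omega
  have hoq : o ≤ 2 * q + 4 ∧ 0 < o ∧ o % 2 = 0 := by omega
  have haA : a + (2 * q + 5) + (q + 1) * W ≤ A := by omega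
  have hoQ : o < Q := by omega
  have hWpos : 2 * (q + 2) + 2 ≤ W := by omega
  have hQ0 : 0 < Q := by omega
  have hq2 : a + o + (q - 1) * Q < A := by omega
  clear hB hAB hthr ho ha hC hJQ hJ' hpar hqJ hqJ' hW
  have explicit_right : a + o + q * Q < B →
      Descent D (q + 1) B (a + o) (fun j => if j = 0 then B else a + o + (q + 1 - j) * Q) := by
    intro h
    refine descent_stairs hDQ hQ0 (by omega) (hD _ ?_ (by omega))
    rw [Nat.odd_iff]
    generalize q * Q = z at *
    clear * - hBpar hqQ h
    omega
  -- If `A` is within flexible reach, the left descent avoids the indices used on the right.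
  -- Otherwise both descents are stairs of step `Q` above `a` and `a + o`; since `0 < o < Q`, these
  -- never meet.
  rcases le_or_gt A (a + (q + 1) * J) with hA | hA
  · obtain ⟨β, hβ, hβA⟩ : ∃ β, Descent D (q + 1) B (a + o) β ∧
        ∀ j, 0 < j → j ≤ q + 1 → β j ≠ A := by
      rcases le_or_gt B (a + o + (q + 1) * J) with h | h
      · obtain ⟨β, hβ, hβA⟩ := exists_descent_notMem (D := D) {A} (J := J) (W := W)
          (by simp; omega) hJ hDJ (q + 1) B (a + o) (by omega) h (by rw [Nat.even_iff]; omega)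
        refine ⟨β, hβ, fun j h0 hj => ?_⟩
        rcases hj.eq_or_lt with rfl | hj
        · rw [hβ.last]; omega
        · simpa using hβA j h0 hj
      · refine ⟨_, explicit_right (by omega), fun j h0 hj => ?_⟩
        rw [if_neg (by omega)]
        rcases Nat.eq_or_lt_of_le (show 1 ≤ j from h0) with rfl | h1
        · rw [Nat.add_sub_cancel]
          omega
        · have : (q + 1 - j) * Q ≤ (q - 1) * Q := Nat.mul_le_mul_right _ (by omega)
          omega
    obtain ⟨α, hα, hαS⟩ := exists_descent_notMem (D := D) ((Finset.range (q + 2)).image β) (J := J)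
      (W := W) (by
        have := Finset.card_image_le (s := Finset.range (q + 2)) (f := β)
        rw [Finset.card_range] at this
        omega) hJ hDJ (q + 1) A a (by omega) hA (by rw [Nat.even_iff]; omega)
    refine F.adj_succ_of_descent (by omega) (l := q + 1) (r := q + 1) (by omega) hDx hDy hα hβ
      hedge hne ?_
    intro j hj j' hj' h
    rcases Nat.eq_zero_or_pos j with rfl | h0
    · refine ⟨rfl, ?_⟩
      by_contra hj0
      exact hβA j' (Nat.pos_of_ne_zero hj0) hj' (by rw [← h, hα.zero])
    exfalso
    rcases hj.eq_or_lt with rfl | h1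
    · have := hβ.last_le hj'
      rw [← h, hα.last] at this
      omega
    · exact hαS j h0 h1 (Finset.mem_image.2 ⟨j', Finset.mem_range.2 (by omega), h.symm⟩)
  · have hβ := explicit_right (by omega)
    have hα : Descent D (q + 1) A a (fun j => if j = 0 then A else a + (q + 1 - j) * Q) := by
      refine descent_stairs hDQ (by omega) (by omega) (hD _ ?_ ?_)
      · rw [Nat.odd_iff]; omega
      · omega
    refine F.adj_succ_of_descent (by omega) (l := q + 1) (r := q + 1) (by omega) hDx hDy hα hβ
      hedge hne ?_
    intro j hj j' hj' h
    have hmono : ∀ c, 0 < c → (q + 1 - c) * Q ≤ q * Q := fun c hc =>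
      Nat.mul_le_mul_right _ (by omega)
    rcases Nat.eq_zero_or_pos j with rfl | h0 <;> rcases Nat.eq_zero_or_pos j' with rfl | h0'
    · exact ⟨rfl, rfl⟩
    · rw [if_pos rfl, if_neg (by omega)] at h
      have := hmono j' h0'
      omega
    · rw [if_pos rfl, if_neg (by omega)] at h
      have := hmono j h0
      omega
    · rw [if_neg (by omega), if_neg (by omega)] at h
      rcases le_or_gt (q + 1 - j) (q + 1 - j') with h1 | h1
      · have := Nat.mul_le_mul_right Q h1
        omega
      · have := Nat.mul_le_mul_right Q h1
        rw [Nat.succ_mul] at this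
        omega

end Fold

/-! ### Joining the ends of a fold at the sharp time -/

namespace Fold

/-- The lengths of the available jumps at time `i` along a path. -/
def JumpLength (k i d : ℕ) : Prop :=
  Odd d ∧ (d + cycleThreshold k ≤ (k - 1) ^ i ∨ d = (k - 1) ^ i)

theorem exists_adj_of_jumpLength {k : ℕ} (hk : 3 ≤ k) : ∃ i₀ : ℕ, ∀ {V : Type*} [Fintype V]
    {G : SimpleGraph V} {x y : ℕ → V} {A B : ℕ}, Fold G x y A B → G.RichAt k (x 0) →
    ∀ i, i₀ ≤ i → ∀ d j, JumpLength k i d →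
      (j + d ≤ A → (cycleProc k G i).Adj (x j) (x (j + d))) ∧
      (j + d ≤ B → (cycleProc k G i).Adj (y j) (y (j + d))) := by
  obtain ⟨i₀, h⟩ := exists_adj_right hk
  refine ⟨i₀, fun {V} _ {G x y A B} F hr i hi d j ⟨hd, hd'⟩ => ?_⟩
  have hr' := hr.of_reachable F.adj_zero.reachable
  rcases hd' with hd' | rfl
  · exact ⟨h F.symm hr' i d j hi hd hd', h F hr i d j hi hd hd'⟩
  · exact ⟨F.symm.adj_pow_right hk i, F.adj_pow_right hk i⟩

theorem adj_of_small {V : Type*} [Fintype V] {k : ℕ} (hk : 3 ≤ k) {G : SimpleGraph V}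
    {x y : ℕ → V} {A B : ℕ} (F : Fold G x y A B) (hr : G.RichAt k (x 0)) {a b M i : ℕ}
    (ha : a ≤ A) (hb : b ≤ B) (hne : x a ≠ y b) (hpar : Even (a + b)) (hM : a + b ≤ M)
    (hi : (4 * k + M + 2) ^ 2 ≤ i) : (cycleProc k G i).Adj (x a) (y b) := by
  obtain ⟨p, hp⟩ := F.exists_walk ha hb
  obtain ⟨q, -⟩ := F.symm.exists_walk (a := 0) (b := a) (by omega) ha
  have h1 : (4 * k + p.length + 1) ^ 2 ≤ (4 * k + M + 2) ^ 2 := Nat.pow_le_pow_left (by omega) 2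
  have h2 := hr.of_reachable F.adj_zero.reachable
  refine (h2.of_reachable q.reachable).adj_of_walk hk p hne (Or.inr ?_) (by omega)
  rw [hp, Nat.odd_iff]
  rw [Nat.even_iff] at hpar
  omega

/-- No correction term is needed for bounded `A`: the `k - 2` jumps on the right reach well beyond
`(k - 1) ^ (i + 1) / 2`. -/
theorem exists_adj_of_lt {k : ℕ} (hk : 4 ≤ k) (hke : Even k) (C : ℕ) : ∃ i₀ : ℕ, ∀ {V : Type*}
    [Fintype V] {G : SimpleGraph V} {x y : ℕ → V} {A B : ℕ}, Fold G x y A B →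
    G.RichAt k (x 0) → ∀ i, i₀ ≤ i → x A ≠ y B → Even (A + B) → A < C →
    2 * B + 1 ≤ (k - 1) ^ (i + 1) → (cycleProc k G (i + 1)).Adj (x A) (y B) := by
  obtain ⟨i₀, h⟩ := exists_adj_of_jumpLength (k := k) (by omega)
  set U := cycleThreshold k + (2 * k + 10) with hU
  set M := 2 * C + 2 + (k - 2) * (2 * k + 10) with hM
  refine ⟨i₀ + (4 * k + M + 2) ^ 2 + 4 * U, fun {V} _ {G x y A B} F hr i hi hne hpar hA hB => ?_⟩
  obtain ⟨q, rfl⟩ : ∃ q, k = 2 * q + 4 := by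
    obtain ⟨m, rfl⟩ := hke
    exact ⟨m - 2, by omega⟩
  rcases lt_or_ge B (A + 2 + (2 * q + 4 - 2) * (2 * (2 * q + 4) + 10)) with hlt | hge
  · exact F.adj_of_small (by omega) hr le_rfl le_rfl hne hpar (M := M) (by omega) (by omega)
  have hQ : i < (2 * q + 4 - 1) ^ i := Nat.lt_pow_self (by omega)
  have hJ := h F hr i (by omega)
  have hedge : (cycleProc (2 * q + 4) G i).Adj (x A) (y (A + 2)) := by
    refine F.adj_of_small (by omega) hr le_rfl (by omega) (fun heq => ?_)
      ⟨A + 1, by ring⟩ (M := M) (by omega) (by omega)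
    have := F.eq_of_eq _ _ le_rfl (by omega) heq
    omega
  obtain ⟨J, hJQ⟩ : ∃ J, (2 * q + 4 - 1) ^ i = J + U := ⟨(2 * q + 4 - 1) ^ i - U, by omega⟩
  refine F.adj_succ_of_left_const hk (D := JumpLength (2 * q + 4) i)
    (W := 2 * (2 * q + 4) + 10) (J := J)
    (fun d j hd => (hJ d j hd).1) (fun d j hd => (hJ d j hd).2) (fun d hd hd' => ⟨hd, Or.inl ?_⟩)
    (by omega) (by omega) hke hedge hne hpar hge ?_
  · omega
  · rw [pow_succ, hJQ, show 2 * q + 4 - 1 = 2 * q + 3 by omega] at hB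
    rw [show 2 * q + 4 - 2 = 2 * q + 2 by omega]
    have : 3 * U ≤ J := by omega
    nlinarith

/-- For `k = 4` there are only two jumps, too few for the intermediate case. One is used on each
side, and the crossing edge starts at level `0` or `1`, supplied at time `i` by the case of bounded
`A`. -/
theorem adj_succ_of_four {V : Type*} [Fintype V] {G : SimpleGraph V} {x y : ℕ → V} {A B i : ℕ}
    (F : Fold G x y A B)
    (h : ∀ d j, JumpLength 4 i d → (j + d ≤ A → (cycleProc 4 G i).Adj (x j) (x (j + d))) ∧
      (j + d ≤ B → (cycleProc 4 G i).Adj (y j) (y (j + d))))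
    (hne : x A ≠ y B) (hpar : Even (A + B)) (hAB : A ≤ B) (hA : 9 ≤ A) (hAQ : A ≤ 3 ^ i)
    (hB : 2 * B + 1 ≤ 3 * 3 ^ i)
    (hedge : ∀ a b, a ≤ 1 → b ≤ B → Even (a + b) → a ≠ b → 2 * b + 1 ≤ 3 ^ i →
      (cycleProc 4 G i).Adj (x a) (y b)) : (cycleProc 4 G (i + 1)).Adj (x A) (y B) := by
  have hQ : 3 ^ i % 2 = 1 := by
    rw [← Nat.odd_iff]
    exact Odd.pow (by decide)
  have hD : ∀ d, d % 2 = 1 → d ≤ 3 ^ i → JumpLength 4 i d := fun d hd hd' =>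
    ⟨Nat.odd_iff.2 hd, Or.inl (by simpa [cycleThreshold, show Even 4 by decide] using hd')⟩
  have hDodd : ∀ d, JumpLength 4 i d → d % 2 = 1 := fun d hd => Nat.odd_iff.1 hd.1
  rw [Nat.even_iff] at hpar
  generalize 3 ^ i = Q at *
  -- The right jump is as long as possible if `B ≥ Q + 2`; otherwise it descends to `2` or `3`,
  -- whichever makes its length odd.
  obtain ⟨b, hb2, hbB, hb1, hbQ, hbpar⟩ : ∃ b, 2 ≤ b ∧ b < B ∧ 2 * b + 1 ≤ Q ∧
      B - b ≤ Q ∧ (B - b) % 2 = 1 := by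
    rcases le_or_gt (Q + 2) B with h2 | h2
    · exact ⟨B - Q, by omega, by omega, by omega, by omega, by omega⟩
    · exact ⟨2 + (B + 1) % 2, by omega, by omega, by omega, by omega, by omega⟩
  have hd : ∀ {c d : ℕ}, JumpLength 4 i (d - c) → c < d →
      Descent (JumpLength 4 i) 1 d c (fun j => if j = 0 then d else c) := by
    intro c d h1 h2
    refine ⟨rfl, rfl, ?_, ?_⟩ <;> intro j hj <;> obtain rfl : j = 0 := by omega
    · simpa using h2
    · simpa using h1
  refine F.adj_succ_of_descent (k := 4) (by norm_num) (l := 1) (r := 1) (by norm_num)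
    (fun d j hd => (h d j hd).1) (fun d j hd => (h d j hd).2)
    (hd (hD (A - b % 2) (by omega) (by omega)) (by omega)) (hd (hD (B - b) hbpar hbQ) hbB)
    (hedge _ _ (by omega) hbB.le (by rw [Nat.even_iff]; omega) (by omega) hb1) hne ?_
  intro j hj j' hj' heq
  split_ifs at heq <;> omega

-- Three regimes according to the size of `A`: bounded, intermediate (separately for `k = 4`), and
-- large. The two numerical conditions are the bounds required in the last regime, where `(k - 1) *
-- (k - 4) = 2 * cycleThreshold k + 2 * q` with `k = 2 * q + 4`.
set_option maxHeartbeats 1000000 in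
theorem exists_adj {k : ℕ} (hk : 4 ≤ k) (hke : Even k) : ∃ i₀ : ℕ, ∀ {V : Type*}
    [Fintype V] {G : SimpleGraph V} {x y : ℕ → V} {A B : ℕ}, Fold G x y A B →
    G.RichAt k (x 0) → ∀ i, i₀ ≤ i → x A ≠ y B → Even (A + B) → A ≤ B →
    2 * B + 1 + (k - 1) * (k - 4) ≤ (k - 1) ^ (i + 1) →
    A + B + 3 + (k - 1) * (k - 4) ≤ (k - 1) ^ (i + 1) →
    (cycleProc k G (i + 1)).Adj (x A) (y B) := by
  obtain ⟨q, rfl⟩ : ∃ q, k = 2 * q + 4 := by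
    obtain ⟨m, rfl⟩ := hke
    exact ⟨m - 2, by omega⟩
  obtain ⟨i₀, h⟩ := exists_adj_of_jumpLength (k := 2 * q + 4) (by omega)
  set thr := cycleThreshold (2 * q + 4) with hthr
  have hthr2 : thr = 2 * (q * (q + 1)) := by
    have h1 := two_mul_cycleThreshold_of_even hke
    rw [← hthr, show 2 * q + 4 - 2 = 2 * q + 2 by omega, show 2 * q + 4 - 4 = 2 * q by omega] at h1
    linarith
  set W := 2 * (2 * q + 4) + 10 with hW
  obtain ⟨i₁, h₁⟩ := exists_adj_of_lt hk hke (3 + (q + 2) * W)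
  refine ⟨i₀ + i₁ + 1 + 16 ^ 2 * (2 * q + 4) ^ 2 + 10 * ((q + 2) * (thr + W)),
    fun {V} _ {G x y A B} F hr i hi hne hpar hAB hB hB' => ?_⟩
  rcases lt_or_ge A (3 + (q + 2) * W) with hA | hA
  · exact h₁ F hr i (by omega) hne hpar hA (by omega)
  have hQi : i < (2 * q + 4 - 1) ^ i := Nat.lt_pow_self (by omega)
  have hQodd : Odd ((2 * q + 4 - 1) ^ i) := Odd.pow ⟨q + 1, by omega⟩
  have hjump := h F hr i (by omega)
  have hpow : (2 * q + 4 - 1) ^ (i + 1) = 2 * (q * (2 * q + 4 - 1) ^ i) +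
      3 * (2 * q + 4 - 1) ^ i := by
    rw [pow_succ, mul_comm]
    nth_rewrite 1 [show 2 * q + 4 - 1 = 2 * q + 3 by omega]
    ring
  have hK : (2 * q + 4 - 1) * (2 * q + 4 - 4) = 2 * thr + 2 * q := by
    rw [show 2 * q + 4 - 1 = 2 * q + 3 by omega, show 2 * q + 4 - 4 = 2 * q by omega, hthr2]
    ring
  rw [hK, hpow] at hB hB'
  have hD : ∀ d, Odd d → d + thr ≤ (2 * q + 4 - 1) ^ i → JumpLength (2 * q + 4) i d :=
    fun d hd hd' => ⟨hd, Or.inl hd'⟩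
  have hDQ : JumpLength (2 * q + 4) i ((2 * q + 4 - 1) ^ i) := ⟨hQodd, Or.inr rfl⟩
  -- The `q + 1` jumps on each side are odd, so the parity of `a` is forced. Passing from asymmetry
  -- `k - 2` to `k` changes `a` by one, hence one of the two is suitable.
  obtain ⟨a, o, ho, ha, hpar'⟩ : ∃ a o, (o = 2 * q + 2 ∨ o = 2 * q + 4) ∧
      2 * a + o + 1 = (2 * q + 4 - 1) ^ i ∧ Even (A + a + (q + 1)) := by
    have hbig : 10 * ((q + 2) * (thr + W)) < (2 * q + 4 - 1) ^ i := by omega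
    have hbig' : W ≤ (q + 2) * (thr + W) :=
      (Nat.le_add_left W thr).trans (Nat.le_mul_of_pos_left _ (by omega))
    rw [Nat.odd_iff] at hQodd
    generalize (2 * q + 4 - 1) ^ i = Q at *
    rcases Nat.even_or_odd (A + (Q - (2 * q + 2) - 1) / 2 + (q + 1)) with h2 | h2
    · exact ⟨_, _, Or.inl rfl, by omega, h2⟩
    · refine ⟨(Q - (2 * q + 4) - 1) / 2, _, Or.inr rfl, by omega, ?_⟩
      rw [Nat.odd_iff] at h2
      rw [Nat.even_iff]
      omega
  have hsmall : ∀ e, e ≤ 1 → (cycleProc (2 * q + 4) G i).Adj (x e) (y (e + 2)) := by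
    intro e he
    have hW2 : 2 * W ≤ (q + 2) * W := Nat.mul_le_mul_right _ (by omega)
    refine F.adj_of_small (by omega) hr (by omega) (by omega) (fun heq => ?_) ⟨e + 1, by ring⟩
      (M := 4) (by omega) (le_trans ?_ (show 16 ^ 2 * (2 * q + 4) ^ 2 ≤ i by omega))
    · have := F.eq_of_eq _ _ (by omega) (by omega) heq
      omega
    · rw [← mul_pow]
      exact Nat.pow_le_pow_left (by omega) 2
  have hbig : 10 * ((q + 2) * (thr + W)) < (2 * q + 4 - 1) ^ i := by omega
  have hU : (q + 2) * (thr + W) = (q + 1) * (thr + W) + (thr + W) := by ring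
  have hU' : (q + 1) * (thr + W) = q * (thr + W) + (thr + W) := by ring
  have hWU : (q + 2) * W ≤ (q + 2) * (thr + W) := Nat.mul_le_mul_left _ (by omega)
  have hWq : (q + 2) * W = (q + 1) * W + W := by ring
  have hWq' : (q + 1) * W = q * W + W := by ring
  have hqW : q * (thr + W) = q * thr + q * W := by ring
  obtain ⟨J, hJQ⟩ : ∃ J, (2 * q + 4 - 1) ^ i = J + W + thr :=
    ⟨(2 * q + 4 - 1) ^ i - (W + thr), by omega⟩
  have hWJ : 2 * W ≤ J := by
    clear * - hJQ hbig hU hU'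
    omega
  have hqJ : q * (thr + W) + 2 * q + 5 ≤ J := by
    clear * - hJQ hbig hU hU' hW
    omega
  have hqJ' : 2 * ((q + 2) * (thr + W)) ≤ (2 * q + 4 - 1) ^ i := by
    clear * - hbig
    omega
  rcases le_or_gt (a + (q - 1) * (2 * q + 4 - 1) ^ i + (2 * q + 5 + (q + 1) * W)) A with hC | hC
  · have hoA : a + (2 * q + 5) ≤ A := by
      clear * - hC
      omega
    have hoq : o ≤ 2 * q + 4 := by
      clear * - ho
      omega
    refine F.adj_succ_of_asymmetry rfl (fun d j hd => (hjump d j hd).1)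
      (fun d j hd => (hjump d j hd).2) hD hDQ (fun d hd => hd.1) hthr2 hJQ hW.ge hWJ
      hqJ ho ha ?_ hne hpar hAB hpar' hC (by linarith) (by linarith)
    have hi2 : 2 ≤ i := by
      have : 16 ^ 2 * (2 * q + 4) ^ 2 ≥ 2 := by nlinarith
      clear * - hi this
      omega
    have hAa : a ≤ A := by linarith
    rcases ho with rfl | rfl
    · exact F.adj_of_asymmetry_sub_two hk hke (by linarith) ha hAa
        (show a + (2 * q + 2) ≤ B by linarith)
    · exact F.adj_of_asymmetry_self hk hke hi2 ha hAa (by linarith)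
  rcases Nat.eq_zero_or_pos q with rfl | hq
  · obtain ⟨i, rfl⟩ : ∃ i', i = i' + 1 := ⟨i - 1, by omega⟩
    have hAQ : A ≤ 3 ^ (i + 1) := by
      change a + (0 - 1) * 3 ^ (i + 1) + _ > A at hC
      change 2 * a + o + 1 = 3 ^ (i + 1) at ha
      change _ < 3 ^ (i + 1) at hbig
      clear * - hC ha hbig hWU hWq hWq'
      omega
    refine F.adj_succ_of_four hjump hne hpar hAB (by clear * - hA hW; omega) hAQ
      (by clear * - hB; change _ ≤ _ + 3 * 3 ^ (i + 1) at hB; omega) fun a b ha hb hpar hab h2 => ?_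
    have haA : a ≤ A := by clear * - ha hA; omega
    refine h₁ (F.mono haA hb) hr i (by clear * - hi; omega) (fun heq => ?_) hpar
      (by clear * - ha; omega) h2
    exact hab (F.eq_of_eq _ _ haA hb heq)
  · obtain ⟨e, he, hepar⟩ : ∃ e, e ≤ 1 ∧ Even (A + e + q) := by
      refine ⟨(A + q) % 2, by clear * -; omega, ?_⟩
      rw [Nat.even_iff]
      clear * -
      omega
    have hA₁ : e + q * W ≤ A := by nlinarith
    have hB₁ : e + 2 + (q + 2) * W ≤ B := by linarith
    have hA₂ : A ≤ e + q * J := by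
      obtain ⟨q, rfl⟩ : ∃ q', q = q' + 1 := ⟨q - 1, by clear * - hq; omega⟩
      rw [Nat.add_sub_cancel] at hC
      clear_value thr W
      generalize (2 * (q + 1) + 4 - 1) ^ i = Q at *
      clear * - hC hJQ hbig ha hW
      subst hJQ
      nlinarith
    have hB₂ : B ≤ e + 2 + (q + 2) * J := by
      generalize (2 * q + 4 - 1) ^ i = Q at *
      clear * - hB hJQ hqJ'
      subst hJQ
      nlinarith
    exact F.adj_succ_of_lt rfl hq (fun d j hd => (hjump d j hd).1)
      (fun d j hd => (hjump d j hd).2) (fun d hd hd' => hD d hd (by linarith)) (W := W) (J := J)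
      (by clear * - hW; omega) hWJ (hsmall e he) hne hpar hAB hepar hA₁ hA₂ hB₁ hB₂

end Fold

/-! ### Shortest odd walks and the upper bound for even `k` -/

section

variable {V : Type*} {G : SimpleGraph V} {u v : V}

theorem Walk.exists_walk_getVert (p : G.Walk u v) (i j : ℕ) (hij : i ≤ j) (hj : j ≤ p.length) :
    ∃ q : G.Walk (p.getVert i) (p.getVert j), q.length = j - i := by
  obtain ⟨q, hq⟩ := exists_walk_of_seq (G := G) (fun l => p.getVert (i + l)) (j - i) fun l hl =>
    p.adj_getVert_succ (by omega)
  have h : (fun l => p.getVert (i + l)) (j - i) = p.getVert j := by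
    beta_reduce
    congr 1
    omega
  exact ⟨q.copy rfl h, by simpa using hq⟩

/-- In a shortest walk of odd length all coincidences are symmetric about the same centre. -/
theorem Walk.exists_center (p : G.Walk u v) (hodd : Odd p.length)
    (hmin : ∀ q : G.Walk u v, Odd q.length → p.length ≤ q.length) :
    ∃ c, Odd c ∧ c + 1 ≤ 2 * p.length ∧
      ∀ i j, i < j → j ≤ p.length → p.getVert i = p.getVert j → i + j = c := by
  have seg : ∀ a b, a ≤ p.length → b ≤ p.length →
      ∃ q : G.Walk (p.getVert a) (p.getVert b), q.length = (a - b) + (b - a) := by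
    intro a b ha hb
    rcases le_total a b with h | h
    · obtain ⟨q, hq⟩ := p.exists_walk_getVert a b h hb
      exact ⟨q, by omega⟩
    · obtain ⟨q, hq⟩ := p.exists_walk_getVert b a h ha
      exact ⟨q.reverse, by rw [length_reverse]; omega⟩
  -- Two coincidences allow the walk to be rerouted: up to `i`, then between `a` and `b` in either
  -- direction, then from `j` on. Minimality forbids a shorter odd result.
  have short : ∀ i a b j, i ≤ p.length → a ≤ p.length → b ≤ p.length → j ≤ p.length →
      p.getVert i = p.getVert a → p.getVert b = p.getVert j →
      (i + ((a - b) + (b - a)) + (p.length - j)) % 2 = 1 →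
      p.length ≤ i + ((a - b) + (b - a)) + (p.length - j) := by
    intro i a b j hi ha hb hj hia hbj hpar
    obtain ⟨q₁, h₁⟩ := seg 0 i (by omega) hi
    obtain ⟨q₂, h₂⟩ := seg a b ha hb
    obtain ⟨q₃, h₃⟩ := seg j p.length hj le_rfl
    have e₁ : p.getVert 0 = u := p.getVert_zero
    have e₃ : p.getVert p.length = v := p.getVert_length
    have h := hmin ((q₁.copy e₁ hia).append (q₂.append (q₃.copy hbj.symm e₃)))
    simp only [length_append, length_copy, Nat.odd_iff] at h
    have := h (by omega)
    omega
  have hdiff : ∀ i j, i < j → j ≤ p.length → p.getVert i = p.getVert j → (i + j) % 2 = 1 := by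
    intro i j hij hj h
    have := short i j j j (by omega) hj hj hj h rfl
    rw [Nat.odd_iff] at hodd
    omega
  have hle : ∀ i j i' j', i < j → j ≤ p.length → p.getVert i = p.getVert j → i' < j' →
      j' ≤ p.length → p.getVert i' = p.getVert j' → ¬ i + j < i' + j' := by
    intro i j i' j' hij hj h hij' hj' h' hlt
    have h1 := hdiff i j hij hj h
    have h2 := hdiff i' j' hij' hj' h'
    rw [Nat.odd_iff] at hodd
    rcases le_or_gt j' j with hjj | hjj
    · have := short i j j' i' (by omega) hj hj' (by omega) h h'.symm (by omega)
      omega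
    · have := short i j i' j' (by omega) hj (by omega) hj' h h' (by omega)
      omega
  by_cases hex : ∃ i j, i < j ∧ j ≤ p.length ∧ p.getVert i = p.getVert j
  · obtain ⟨i, j, hij, hj, h⟩ := hex
    refine ⟨i + j, Nat.odd_iff.2 (hdiff i j hij hj h), by omega, ?_⟩
    intro i' j' hij' hj' h'
    have h1 := hle i j i' j' hij hj h hij' hj' h'
    have h2 := hle i' j' i j hij' hj' h' hij hj h
    omega
  · push Not at hex
    have := hodd.pos
    exact ⟨p.length, hodd, by omega, fun i j hij hj h => absurd h (hex i j hij hj)⟩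

/-- Cut the walk at the edge in its centre of symmetry and number both halves outwards: coincidences
then have equal indices. -/
theorem Walk.exists_fold (p : G.Walk u v) (hodd : Odd p.length)
    (hmin : ∀ q : G.Walk u v, Odd q.length → p.length ≤ q.length) :
    ∃ x y A B, Fold G x y A B ∧ x A = u ∧ y B = v ∧ Even (A + B) := by
  obtain ⟨c, ⟨a, rfl⟩, hc, h⟩ := p.exists_center hodd hmin
  rw [Nat.odd_iff] at hodd
  have hinj : ∀ i j, i ≤ p.length → j ≤ p.length → p.getVert i = p.getVert j →
      i = j ∨ i + j = 2 * a + 1 := by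
    intro i j hi hj hij
    rcases lt_trichotomy i j with h1 | h1 | h1
    · exact Or.inr (h i j h1 hj hij)
    · exact Or.inl h1
    · have := h j i h1 hi hij.symm
      omega
  refine ⟨fun j => p.getVert (a - j), fun j => p.getVert (a + 1 + j), a, p.length - a - 1,
    ⟨?_, ?_, ?_, ?_, ?_, ?_⟩, by simp, ?_, by rw [Nat.even_iff]; omega⟩
  · intro i hi j hj hij
    simp only [Set.mem_Iic] at hi hj
    have := hinj _ _ (by omega) (by omega) hij
    omega
  · intro i hi j hj hij
    simp only [Set.mem_Iic] at hi hj
    have := hinj _ _ (by omega) (by omega) hij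
    omega
  · intro j hj
    have := p.adj_getVert_succ (i := a - (j + 1)) (by omega)
    rw [show a - (j + 1) + 1 = a - j by omega] at this
    exact this.symm
  · intro j hj
    exact p.adj_getVert_succ (i := a + 1 + j) (by omega)
  · exact p.adj_getVert_succ (i := a) (by omega)
  · intro i j hi hj hij
    have := hinj _ _ (by omega) (by omega) hij
    omega
  · have : p.getVert (a + 1 + (p.length - a - 1)) = p.getVert p.length := by congr 1; omega
    exact this.trans p.getVert_length

end

/-- The right path and `x 0` are distinct vertices. In the balanced case `x A` is a further one, and
this extra vertex is what the bound on `A + B + 3` needs. -/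
theorem Fold.card_le {V : Type*} [Fintype V] {G : SimpleGraph V} {x y : ℕ → V} {A B : ℕ}
    (F : Fold G x y A B) (hne : x A ≠ y B) :
    B + 2 ≤ Fintype.card V ∧ (A = B → 0 < A → B + 3 ≤ Fintype.card V) := by
  classical
  have h0 : x 0 ∉ (Finset.range (B + 1)).image y := by
    intro hmem
    obtain ⟨j, hj, hj'⟩ := Finset.mem_image.1 hmem
    rw [Finset.mem_range] at hj
    obtain rfl := F.eq_of_eq 0 j (by omega) (by omega) hj'.symm
    exact F.adj_zero.ne hj'.symm
  have hcard : ((Finset.range (B + 1)).image y).card = B + 1 := by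
    rw [Finset.card_image_of_injOn, Finset.card_range]
    refine F.injOn_right.mono fun j hj => ?_
    simp at hj ⊢
    omega
  constructor
  · have := Finset.card_le_univ (insert (x 0) ((Finset.range (B + 1)).image y))
    rw [Finset.card_insert_of_notMem h0, hcard] at this
    omega
  · rintro rfl hA
    have h1 : x A ∉ insert (x 0) ((Finset.range (A + 1)).image y) := by
      intro hmem
      rcases Finset.mem_insert.1 hmem with h | h
      · have := F.injOn_left (x₁ := A) (x₂ := 0) (by simp) (by simp) h
        omega
      · obtain ⟨j, hj, hj'⟩ := Finset.mem_image.1 h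
        rw [Finset.mem_range] at hj
        obtain rfl := F.eq_of_eq A j le_rfl (by omega) hj'.symm
        exact hne hj'.symm
    have := Finset.card_le_univ (insert (x A) (insert (x 0) ((Finset.range (A + 1)).image y)))
    rw [Finset.card_insert_of_notMem h1, Finset.card_insert_of_notMem h0, hcard] at this
    omega

theorem cycleProc_eq_succ_of_even {k : ℕ} (hk : 4 ≤ k) (hke : Even k) : ∃ t₀ : ℕ,
    ∀ {V : Type*} [Fintype V] (G : SimpleGraph V) (t : ℕ), t₀ ≤ t →
    2 * Fintype.card V + (k - 1) * (k - 4) ≤ (k - 1) ^ t + 4 →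
    cycleProc k G t = cycleProc k G (t + 1) := by
  classical
  obtain ⟨i₀, h⟩ := Fold.exists_adj hk hke
  refine ⟨k ^ 2 + i₀ + 1, fun {V} _ G t ht hcard => ?_⟩
  obtain ⟨i, rfl⟩ : ∃ i, t = i + 1 := ⟨t - 1, by omega⟩
  refine cycleProc_eq_succ_of_forall fun u v huv => ?_
  refine (adj_or_richAt (by omega) (by omega) huv).elim id fun hrich => ?_
  have hex : ∃ L, ∃ p : G.Walk u v, Odd p.length ∧ p.length = L := by
    obtain ⟨p, hp⟩ := cycleProc_odd_walk (by omega) hke huv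
    exact ⟨_, p, hp, rfl⟩
  obtain ⟨p, hp, hpL⟩ := Nat.find_spec hex
  obtain ⟨x, y, A, B, F, hxA, hyB, hpar⟩ := p.exists_fold hp fun q hq => by
    rw [hpL]
    exact Nat.find_min' hex ⟨q, hq, rfl⟩
  have hr : G.RichAt k (x 0) := by
    obtain ⟨q, -⟩ := F.symm.exists_walk_right 0 A (by omega)
    rw [Nat.zero_add] at q
    exact hrich.of_reachable (hxA ▸ q.reachable.symm)
  have hcardk : k < Fintype.card V := by
    obtain ⟨-, S, hS, -⟩ := hrich
    exact hS.trans_le (Finset.card_le_univ S)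
  -- The power is odd and `(k - 1) * (k - 4)` is even, which gains the missing unit in the
  -- cardinality hypothesis.
  have hP : (k - 1) ^ (i + 1) % 2 = 1 := by
    rw [← Nat.odd_iff]
    refine Odd.pow ?_
    rw [Nat.odd_sub (by omega)]
    simp [hke]
  have hK : (k - 1) * (k - 4) % 2 = 0 := by
    rw [← Nat.even_iff]
    refine Even.mul_left ?_ _
    rw [Nat.even_sub (by omega)]
    simp [hke, show Even 4 by decide]
  have main : ∀ {x y : ℕ → V} {A B : ℕ}, Fold G x y A B → G.RichAt k (x 0) → x A ≠ y B →
      Even (A + B) → A ≤ B → (cycleProc k G (i + 1)).Adj (x A) (y B) := by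
    intro x y A B F hr hne hpar hAB
    obtain ⟨h1, h2⟩ := F.card_le hne
    have hpar' := Nat.even_iff.1 hpar
    refine h F hr i (by omega) hne hpar hAB (by omega) ?_
    rcases hAB.eq_or_lt with hAB | hAB
    · rcases Nat.eq_zero_or_pos A with h3 | h3
      · omega
      · have := h2 hAB h3
        omega
    · omega
  rw [← hxA, ← hyB]
  have hne : x A ≠ y B := by rw [hxA, hyB]; exact huv.ne
  rcases le_total A B with hAB | hAB
  · exact main F hr hne hpar hAB
  · exact (main F.symm (hr.of_reachable F.adj_zero.reachable) hne.symm
      (by rwa [Nat.add_comm]) hAB).symm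

/-! ### Defects and the lower bound for odd `k` -/

/-- `d` arises from `n * (k - 1) ^ i` by subtracting a combination of `k - 2` and `k`. -/
def Defect (k i n : ℕ) (d : ℤ) : Prop :=
  ∃ a b : ℕ, d + a * ((k : ℤ) - 2) + b * k = n * ((k : ℤ) - 1) ^ i

theorem Defect.sum {k i : ℕ} {z : ℕ → ℤ} {m n : ℕ} (hmn : m ≤ n)
    (h : ∀ j, m ≤ j → j < n → Defect k i 1 (z (j + 1) - z j)) :
    Defect k i (n - m) (z n - z m) := by
  induction n, hmn using Nat.le_induction with
  | base => exact ⟨0, 0, by simp⟩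
  | succ n hn ih =>
    obtain ⟨a, b, hab⟩ := ih fun j h1 h2 => h j h1 (by omega)
    obtain ⟨a', b', hab'⟩ := h n hn (by omega)
    refine ⟨a + a', b + b', ?_⟩
    rw [show n + 1 - m = (n - m) + 1 by omega]
    push_cast at hab hab' ⊢
    linear_combination hab + hab'

theorem Defect.succ {k i : ℕ} {z : ℕ → ℤ} (hk : 1 ≤ k)
    (h : ∀ j < k - 1, Defect k i 1 (z (j + 1) - z j)) :
    Defect k (i + 1) 1 (z (k - 1) - z 0) := by
  obtain ⟨a, b, hab⟩ := Defect.sum (Nat.zero_le (k - 1)) fun j _ hj => h j hj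
  rw [Nat.sub_zero] at hab
  refine ⟨a, b, hab.trans ?_⟩
  push_cast [hk]
  ring

theorem Defect.mono {k i : ℕ} {d : ℤ} (hk : 2 ≤ k) (h : Defect k i 1 d) : Defect k (i + 1) 1 d := by
  obtain ⟨a, b, hab⟩ := h
  refine ⟨a + (k - 1) ^ i, b, ?_⟩
  push_cast [show 1 ≤ k by omega] at hab ⊢
  linear_combination hab

/-- The four displacements fall short of `k - 1` by `k - 2`, `k`, `0` and `(k - 2) + k`. -/
theorem defect_one {k : ℕ} {d : ℤ} (h : d = 1 ∨ d = -1 ∨ d = k - 1 ∨ d = -(k - 1)) :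
    Defect k 1 1 d := by
  rcases h with rfl | rfl | rfl | rfl
  · exact ⟨1, 0, by push_cast; ring⟩
  · exact ⟨0, 1, by push_cast; ring⟩
  · exact ⟨0, 0, by push_cast; ring⟩
  · exact ⟨1, 1, by push_cast; ring⟩

/-- A sequence with steps `±1` which never turns back is monotone. -/
theorem eq_add_or_sub_of_steps {z : ℕ → ℤ} {n : ℕ}
    (h : ∀ j < n, z (j + 1) = z j + 1 ∨ z (j + 1) = z j - 1)
    (hne : ∀ j, j + 2 ≤ n → z (j + 2) ≠ z j) :
    (∀ j ≤ n, z j = z 0 + j) ∨ (∀ j ≤ n, z j = z 0 - j) := by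
  induction n with
  | zero => exact Or.inl fun j hj => by simp [Nat.le_zero.1 hj]
  | succ n ih =>
    rcases Nat.eq_zero_or_pos n with rfl | hn
    · refine (h 0 (by omega)).imp (fun h0 j hj => ?_) (fun h0 j hj => ?_)
      all_goals
        obtain rfl | rfl : j = 0 ∨ j = 1 := by omega
        · simp
        · simpa using h0
    · obtain ⟨m, rfl⟩ : ∃ m, n = m + 1 := ⟨n - 1, by omega⟩
      have h1 := hne m (by omega)
      have h2 := h (m + 1) (by omega)
      refine (ih (fun j hj => h j (by omega)) fun j hj => hne j (by omega)).imp
        (fun hz j hj => ?_) (fun hz j hj => ?_)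
      all_goals
        rcases hj.lt_or_eq with hj | rfl
        · exact hz j (by omega)
        · have h3 := hz m (by omega)
          have h4 := hz (m + 1) le_rfl
          rw [show m + 1 + 1 = m + 2 by omega] at *
          push_cast at h4 ⊢
          omega

/-- Injectivity of the paths matters only in the first round, where it forbids turning back;
afterwards displacements, and hence defects, simply add up. -/
theorem cycleProc_pathGraph_defect {k n : ℕ} (hk : 3 ≤ k) (i : ℕ) (u v : Fin n)
    (h : (cycleProc k (pathGraph n) (i + 1)).Adj u v) :
    Defect k (i + 1) 1 ((v : ℤ) - u) := by
  have hstep : ∀ u v : Fin n, (pathGraph n).Adj u v → (v : ℤ) = u + 1 ∨ (v : ℤ) = u - 1 := by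
    intro u v h
    rw [pathGraph_adj] at h
    omega
  induction i generalizing u v with
  | zero =>
    rw [cycleProc_succ_adj hk] at h
    rcases h with h | ⟨p, rfl, rfl, hadj, hinj⟩
    · have := hstep u v h
      exact defect_one (by omega)
    · have h1 := eq_add_or_sub_of_steps (z := fun j => (p j : ℤ)) (n := k - 1)
        (fun j hj => hstep _ _ (hadj j hj)) (fun j hj heq => by
          refine hinj.ne hj (show j ≤ k - 1 by omega) (by omega) ?_
          apply Fin.ext
          simpa using heq)
      refine defect_one ?_
      rcases h1 with h1 | h1 <;> have h2 := h1 (k - 1) le_rfl <;>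
        push_cast [show 1 ≤ k by omega] at h2 <;> omega
  | succ i ih =>
    rw [cycleProc_succ_adj hk] at h
    rcases h with h | ⟨p, rfl, rfl, hadj, -⟩
    · exact (ih u v h).mono (by omega)
    · exact Defect.succ (z := fun j => (p j : ℤ)) (by omega) fun j hj => ih _ _ (hadj j hj)

theorem lt_bootstrapTime_pathGraph {k n t : ℕ} (hk : 3 ≤ k) (hko : Odd k) (ht : 1 ≤ t) (hn : k < n)
    (hlo : k * k + 2 < (k - 1) ^ t + 4 * k) (hup : (k - 1) ^ t + 4 * k < n + k * k + 2) :
    t < bootstrapTime (cycleGraph k) (pathGraph n) := by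
  by_contra hcon
  rw [not_lt, bootstrapTime_le_iff] at hcon
  have hst := cycleProc_stable hk hcon
  have hle : pathGraph n ≤ cycleProc k (pathGraph n) t := cycleProc_mono _ (Nat.zero_le t)
  obtain ⟨m, rfl⟩ : ∃ m, n = m + 1 := ⟨n - 1, by omega⟩
  have hkk : 3 * k ≤ k * k := Nat.mul_le_mul_right k hk
  obtain ⟨d, hd⟩ : ∃ d, d + (k * k + 2) = (k - 1) ^ t + 4 * k :=
    ⟨(k - 1) ^ t + 4 * k - (k * k + 2), by omega⟩
  have hadj : (cycleProc k (pathGraph (m + 1)) t).Adj ⟨0, by omega⟩ ⟨d, by omega⟩ := by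
    refine hst.adj_of_walk hk ((pathGraph_connected m).mono hle).preconnected
      (x := ⟨0, by omega⟩) (y := ⟨k - 1, by omega⟩) ?_
      (S := Finset.univ) (by simpa using hn) ?_ (Or.inl hko)
    · refine ⟨fun j => ⟨min j m, by omega⟩, by simp, by simp; omega, fun j hj => hle ?_, ?_⟩
      · rw [pathGraph_adj]
        simp
        omega
      · intro a ha b hb hab
        simp only [Set.mem_Iic] at ha hb
        simp only [Fin.mk.injEq] at hab
        omega
    · intro h
      rw [Fin.mk.injEq] at h
      omega
  obtain ⟨i, rfl⟩ : ∃ i, t = i + 1 := ⟨t - 1, by omega⟩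
  obtain ⟨a, b, hab⟩ := cycleProc_pathGraph_defect hk i _ _ hadj
  obtain ⟨q, rfl⟩ : ∃ q, k = q + 2 := ⟨k - 2, by omega⟩
  have hcop : Nat.Coprime q (q + 2) := by
    rw [Nat.coprime_self_add_right, Nat.coprime_two_right, ← Nat.not_even_iff_odd]
    intro h
    exact Nat.not_even_iff_odd.2 hko (h.add (by decide))
  -- The defect of `d` is the Frobenius number of `q` and `q + 2`; adding one to both coefficients
  -- would represent their product with positive coefficients.
  refine Nat.Coprime.mul_add_mul_ne_mul hcop (a := a + 1) (b := b + 1) (by omega) (by omega) ?_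
  rw [show q + 2 - 1 = q + 1 by omega] at hd
  zify at hd ⊢
  push_cast at hab
  have h2 : ((q : ℤ) + 2 - 1) = q + 1 := by ring
  rw [h2] at hab
  linear_combination hab - hd

/-! ### The twin path and the lower bound for even `k` -/

/-- A path with levels `0, …, H` whose end levels are blown up, where the two vertices of level `0`
are adjacent. -/
structure IsTwinPath {V : Type*} (G : SimpleGraph V) (h : V → ℕ) (H : ℕ) : Prop where
  two_le : 2 ≤ H
  le : ∀ v, h v ≤ H
  adj_iff : ∀ u v, G.Adj u v ↔ h u + 1 = h v ∨ h v + 1 = h u ∨ u ≠ v ∧ h u = 0 ∧ h v = 0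
  eq_of_eq : ∀ u v, h u = h v → 0 < h u → h u < H → u = v
  zero : ∀ u v w, h u = 0 → h v = 0 → h w = 0 → u = v ∨ v = w ∨ u = w

/-- The position of parity `ε` among the positions `c` and `-1 - c`. -/
def lift (c ε : ℕ) : ℤ := if (c + ε) % 2 = 0 then c else -1 - c

theorem lift_congr {c ε ε' : ℕ} (h : ε % 2 = ε' % 2) : lift c ε = lift c ε' := by
  simp only [lift, Nat.add_mod c, h]

/-- The possible levels of the ends of an edge that crosses from the negative to the nonnegative
positions at time `i`. -/
def Crossing (k i : ℕ) (a b : ℤ) : Prop :=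
  ∃ j : ℤ, ∃ s₁ s₂ s₃ s₄ : ℕ, ∃ a₀ b₀ : ℤ,
    (a₀ = 0 ∧ b₀ = 0 ∨ a₀ = 0 ∧ b₀ = k - 2 ∨ a₀ = k - 2 ∧ b₀ = 0) ∧
    2 * (a + s₁ * ((k : ℤ) - 2) + s₂ * k) =
      2 * a₀ + ((k : ℤ) - 1) ^ i - (k - 1) + 2 * j * (k - 1) ∧
    2 * (b + s₃ * ((k : ℤ) - 2) + s₄ * k) =
      2 * b₀ + ((k : ℤ) - 1) ^ i - (k - 1) - 2 * j * (k - 1)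

/-- With `l` steps before and `r` after the crossing, the two sides gain `l` and `r` times the
current power. Their deviation from the balanced value `m` is opposite and is recorded in `j`. -/
theorem Crossing.succ {k m i l r : ℕ} (hk : k = 2 * m + 2) (hlr : l + r = 2 * m) {a b a' b' : ℤ}
    (h : Crossing k (i + 1) a b) (ha : Defect k (i + 1) l (a' - a))
    (hb : Defect k (i + 1) r (b' - b)) : Crossing k (i + 2) a' b' := by
  obtain ⟨j, s₁, s₂, s₃, s₄, a₀, b₀, h₀, h₁, h₂⟩ := h
  obtain ⟨t₁, t₂, ht⟩ := ha
  obtain ⟨t₃, t₄, ht'⟩ := hb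
  have hr : (r : ℤ) = 2 * m - l := by omega
  subst hk
  refine ⟨j + (l - m) * (((2 * m + 2 : ℕ) : ℤ) - 1) ^ i, s₁ + t₁, s₂ + t₂, s₃ + t₃, s₄ + t₄,
    a₀, b₀, h₀, ?_, ?_⟩
  · push_cast at *
    linear_combination h₁ + 2 * ht
  · rw [hr] at ht'
    push_cast at *
    linear_combination h₂ + 2 * ht'

theorem Crossing.mono {k m i : ℕ} (hk : k = 2 * m + 2) {a b : ℤ} (h : Crossing k (i + 1) a b) :
    Crossing k (i + 2) a b := by
  obtain ⟨j, s₁, s₂, s₃, s₄, a₀, b₀, h₀, h₁, h₂⟩ := h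
  subst hk
  refine ⟨j + m * (((2 * m + 2 : ℕ) : ℤ) - 1) ^ i, s₁ + (2 * m + 1) ^ (i + 1), s₂, s₃, s₄, a₀, b₀,
    h₀, ?_, ?_⟩
  · push_cast at *
    linear_combination h₁
  · push_cast at *
    linear_combination h₂

/-- After halving, the equation asks for at most the largest gap of the semigroup of `m` and `m +
1`; shifting the coefficients would write `m * (m + 1)` with positive coefficients. -/
theorem crossing_aux {m s₁ s₂ : ℕ} {j a₀ : ℤ} (ha : a₀ = 0 ∨ a₀ = 2 * m) (hj : j < 0)
    (hodd : j % 2 = 1)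
    (h : 2 * m * s₁ + 2 * (m + 1) * s₂ = a₀ - m + (2 * m + 1) * (m - 1) + j * (2 * m + 1)) :
    False := by
  obtain ⟨e, he⟩ : ∃ e : ℕ, j = -1 - 2 * e := ⟨((-1 - j) / 2).toNat, by omega⟩
  subst he
  have hcop : Nat.Coprime m (m + 1) := by simp
  rcases ha with rfl | rfl
  · refine Nat.Coprime.mul_add_mul_ne_mul hcop (a := s₁ + 2 + e) (b := s₂ + 1 + e) (by omega)
      (by omega) ?_
    zify
    linarith
  · refine Nat.Coprime.mul_add_mul_ne_mul hcop (a := s₁ + 1 + e) (b := s₂ + 1 + e) (by omega)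
      (by omega) ?_
    zify
    linarith

/-- Parity forces `j` to be odd, in particular nonzero. So `j` or `-j` is negative, and
`crossing_aux` rules out the corresponding side. -/
theorem not_crossing {k m t : ℕ} (hk : k = 2 * m + 2) {c : ℤ}
    (hc : 2 * c + 1 + (k - 1) * (k - 4) = ((k : ℤ) - 1) ^ t) : ¬ Crossing k t c c := by
  rintro ⟨j, s₁, s₂, s₃, s₄, a₀, b₀, h₀, h₁, h₂⟩
  subst hk
  push_cast at *
  have e₁ : 2 * (m : ℤ) * s₁ + 2 * (m + 1) * s₂ =
      a₀ - m + (2 * m + 1) * (m - 1) + j * (2 * m + 1) := by linarith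
  have e₂ : 2 * (m : ℤ) * s₃ + 2 * (m + 1) * s₄ =
      b₀ - m + (2 * m + 1) * (m - 1) + (-j) * (2 * m + 1) := by linarith
  have hodd : j % 2 = 1 := by
    rcases Int.emod_two_eq_zero_or_one j with h | h
    · exfalso
      obtain ⟨e, he⟩ : ∃ e, j = 2 * e := ⟨j / 2, by omega⟩
      obtain ⟨f, hf⟩ : ∃ f, a₀ = 2 * f := by
        rcases h₀ with h | h | h
        · exact ⟨0, by omega⟩
        · exact ⟨0, by omega⟩
        · exact ⟨m, by omega⟩
      have : 2 * ((m : ℤ) * s₁ + (m + 1) * s₂ - f - m * m + m - e * (2 * m + 1) + 1) = 1 := by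
        rw [he, hf] at e₁
        linarith
      omega
    · exact h
  rcases lt_trichotomy j 0 with hj | rfl | hj
  · exact crossing_aux (by omega) hj hodd e₁
  · omega
  · exact crossing_aux (by omega) (by omega) (by omega) e₂

theorem lift_cases (c ε : ℕ) :
    lift c ε = c ∧ (c + ε) % 2 = 0 ∨ lift c ε = -1 - c ∧ (c + ε) % 2 = 1 := by
  unfold lift
  split_ifs <;> omega

namespace IsTwinPath

section

variable {V : Type*} {G : SimpleGraph V} {h : V → ℕ} {H : ℕ}

/-- The map to the integers unfolds the walk: the edge inside level `0` becomes the step between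
`-1` and `0`. -/
theorem lift_succ (T : IsTwinPath G h H) {u v : V} (huv : G.Adj u v) (ε : ℕ) :
    lift (h v) (ε + 1) = lift (h u) ε + 1 ∨ lift (h v) (ε + 1) = lift (h u) ε - 1 := by
  have := (T.adj_iff u v).1 huv
  rcases lift_cases (h v) (ε + 1) with h1 | h1 <;> rcases lift_cases (h u) ε with h2 | h2 <;> omega

theorem eq_of_lift_eq {u v : V} {ε : ℕ} (huv : lift (h u) ε = lift (h v) ε) : h u = h v := by
  rcases lift_cases (h v) ε with h1 | h1 <;> rcases lift_cases (h u) ε with h2 | h2 <;> omega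

/-- A path with at least three edges never turns back between two vertices of the same level. -/
theorem level_ne (T : IsTwinPath G h H) {n : ℕ} (hn : 3 ≤ n) {p : ℕ → V}
    (hadj : ∀ j < n, G.Adj (p j) (p (j + 1))) (hinj : Set.InjOn p (Set.Iic n)) {j : ℕ}
    (hj : j + 2 ≤ n) : h (p (j + 2)) ≠ h (p j) := by
  intro heq
  have hne' : ∀ a b, a ≤ n → b ≤ n → a ≠ b → p a ≠ p b := fun a b ha hb => hinj.ne ha hb
  have h02 := hne' j (j + 2) (by omega) hj (by omega)
  have h01 := (T.adj_iff _ _).1 (hadj j (by omega))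
  have hle := T.le (p (j + 1))
  obtain ⟨z, hz, hz0, hz1, hz2⟩ : ∃ z, (G.Adj (p j) z ∨ G.Adj (p (j + 2)) z) ∧ z ≠ p j ∧
      z ≠ p (j + 1) ∧ z ≠ p (j + 2) := by
    rcases Nat.lt_or_ge (j + 2) n with h3 | h3
    · exact ⟨p (j + 3), Or.inr (hadj (j + 2) h3), hne' _ _ h3 (by omega) (by omega),
        hne' _ _ h3 (by omega) (by omega), hne' _ _ h3 (by omega) (by omega)⟩
    · obtain ⟨l, rfl⟩ : ∃ l, j = l + 1 := ⟨j - 1, by omega⟩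
      exact ⟨p l, Or.inl (hadj l (by omega)).symm, hne' _ _ (by omega) (by omega) (by omega),
        hne' _ _ (by omega) (by omega) (by omega), hne' _ _ (by omega) (by omega) (by omega)⟩
  have hz' : h (p j) + 1 = h z ∨ h z + 1 = h (p j) ∨ h (p j) = 0 ∧ h z = 0 := by
    rcases hz with hz | hz <;> have := (T.adj_iff _ _).1 hz <;> omega
  have hzle := T.le z
  have htwo := T.two_le
  rcases Nat.eq_zero_or_pos (h (p j)) with h0 | h0
  · rcases Nat.eq_zero_or_pos (h z) with h4 | h4
    · rcases T.zero (p j) (p (j + 2)) z h0 (by omega) h4 with h5 | h5 | h5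
      · exact h02 h5
      · exact hz2 h5.symm
      · exact hz0 h5.symm
    · rcases Nat.eq_zero_or_pos (h (p (j + 1))) with h5 | h5
      · rcases T.zero (p j) (p (j + 1)) (p (j + 2)) h0 h5 (by omega) with h6 | h6 | h6
        · exact (hadj j (by omega)).ne h6
        · exact (hadj (j + 1) (by omega)).ne h6
        · exact h02 h6
      · exact hz1 (T.eq_of_eq _ _ (by omega) h4 (by omega))
  · rcases (T.le (p j)).lt_or_eq with h5 | h5
    · exact h02 (T.eq_of_eq _ _ heq.symm h0 h5)
    · exact hz1 (T.eq_of_eq _ _ (by omega) (by omega) (by omega))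

theorem monotone_lift (T : IsTwinPath G h H) {n : ℕ} (hn : 3 ≤ n) {p : ℕ → V}
    (hadj : ∀ j < n, G.Adj (p j) (p (j + 1))) (hinj : Set.InjOn p (Set.Iic n)) (ε : ℕ) :
    (∀ j ≤ n, lift (h (p j)) (ε + j) = lift (h (p 0)) ε + j) ∨
      ∀ j ≤ n, lift (h (p j)) (ε + j) = lift (h (p 0)) ε - j := by
  refine eq_add_or_sub_of_steps (z := fun j => lift (h (p j)) (ε + j))
    (fun j hj => T.lift_succ (hadj j hj) (ε + j)) fun j hj heq => ?_
  beta_reduce at heq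
  rw [lift_congr (ε := ε + (j + 2)) (ε' := ε + j) (by omega)] at heq
  exact T.level_ne hn hadj hinj hj (eq_of_lift_eq heq)

theorem exists_walk (T : IsTwinPath G h H) {f : ℕ → V} (hf : ∀ j ≤ H, h (f j) = j) {v z : V}
    (hv : 0 < h v) (hz : h z = 0) : ∃ p : G.Walk v z, p.length = h v := by
  have hle := T.le v
  obtain ⟨p, hp⟩ := exists_walk_of_seq (G := G)
    (fun j => if j = 0 then v else if j = h v then z else f (h v - j)) (h v) (by
      intro j hj
      have key : ∀ i ≤ h v, h (if i = 0 then v else if i = h v then z else f (h v - i)) =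
          h v - i := by
        intro i hi
        split_ifs with h1 h2
        · simp [h1]
        · simp [h2, hz]
        · exact hf _ (by omega)
      rw [T.adj_iff]
      rw [key j hj.le, key (j + 1) hj]
      omega)
  have e : (fun j => if j = 0 then v else if j = h v then z else f (h v - j)) (h v) = z := by
    simp [hv.ne']
  exact ⟨p.copy (by simp) e, by simpa using hp⟩

variable [Fintype V] {k m : ℕ}

/-- Total displacement alone does not exclude the edge between the twins, so the levels at the
crossing are tracked as well. A first-round path with neither end at level `0` would pass positions
`-2` and `1`, which are the same vertex. -/
theorem defect_and_crossing (T : IsTwinPath G h H) (hm : 1 ≤ m) (hk : k = 2 * m + 2) (i : ℕ)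
    (u v : V) (huv : (cycleProc k G (i + 1)).Adj u v) (ε : ℕ) :
    Defect k (i + 1) 1 (lift (h v) (ε + 1) - lift (h u) ε) ∧
      (lift (h u) ε < 0 → 0 ≤ lift (h v) (ε + 1) → Crossing k (i + 1) (h u) (h v)) := by
  have hneg : ∀ c ε, lift c ε < 0 → lift c ε = -1 - c := by
    intro c ε hlt
    rcases lift_cases c ε with h1 | h1 <;> omega
  have hnonneg : ∀ c ε, 0 ≤ lift c ε → lift c ε = c := by
    intro c ε hlt
    rcases lift_cases c ε with h1 | h1 <;> omega
  have hlast : ∀ c ε, lift c (ε + (k - 1)) = lift c (ε + 1) := fun c ε => lift_congr (by omega)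
  induction i generalizing u v ε with
  | zero =>
    rw [cycleProc_succ_adj (by omega)] at huv
    rcases huv with huv | ⟨p, rfl, rfl, hadj, hinj⟩
    · have h1 := T.lift_succ huv ε
      refine ⟨defect_one (by omega), fun hu hv => ⟨0, 0, 0, 0, 0, 0, 0, Or.inl ⟨rfl, rfl⟩, ?_⟩⟩
      have h2 := hneg _ _ hu
      have h3 := hnonneg _ _ hv
      have h4 : (h u : ℤ) = 0 := by omega
      have h5 : (h v : ℤ) = 0 := by omega
      rw [h4, h5]
      constructor <;> push_cast <;> ring
    · have h1 := T.monotone_lift (by omega) hadj hinj ε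
      have hz : lift (h (p (k - 1))) (ε + 1) = lift (h (p 0)) ε + (k - 1) ∨
          lift (h (p (k - 1))) (ε + 1) = lift (h (p 0)) ε - (k - 1) := by
        rw [← hlast]
        refine h1.imp (fun h2 => ?_) (fun h2 => ?_) <;>
          · rw [h2 _ le_rfl]
            push_cast [show 1 ≤ k by omega]
            ring
      refine ⟨defect_one (by omega), fun hu hv => ?_⟩
      have h2 := hneg _ _ hu
      have h3 := hnonneg _ _ hv
      have h4 : ∀ j ≤ k - 1, lift (h (p j)) (ε + j) = lift (h (p 0)) ε + j := by
        rcases h1 with h1 | h1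
        · exact h1
        · have := h1 (k - 1) le_rfl
          rw [hlast] at this
          omega
      have hends : (h (p 0) : ℤ) = 0 ∧ (h (p (k - 1)) : ℤ) = k - 2 ∨
          (h (p 0) : ℤ) = k - 2 ∧ (h (p (k - 1)) : ℤ) = 0 := by
        by_contra hcon
        have h5 := h4 (h (p 0) - 1) (by omega)
        have h6 := h4 (h (p 0) + 2) (by omega)
        have h7 : lift (h (p (h (p 0) - 1))) (ε + (h (p 0) - 1)) = -2 := by omega
        have h8 : lift (h (p (h (p 0) + 2))) (ε + (h (p 0) + 2)) = 1 := by omega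
        have h9 := hneg _ _ (h7.trans_lt (by norm_num))
        have h10 := hnonneg _ _ (zero_le_one.trans_eq h8.symm)
        have htwo := T.two_le
        have := hinj (show h (p 0) - 1 ≤ k - 1 by omega) (show h (p 0) + 2 ≤ k - 1 by omega)
          (T.eq_of_eq _ _ (by omega) (by omega) (by omega))
        omega
      refine ⟨0, 0, 0, 0, 0, _, _, Or.inr hends, ?_⟩
      constructor <;> push_cast <;> ring
  | succ i ih =>
    rw [cycleProc_succ_adj (by omega)] at huv
    rcases huv with huv | ⟨p, rfl, rfl, hadj, -⟩
    · obtain ⟨h1, h2⟩ := ih u v huv ε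
      exact ⟨h1.mono (by omega), fun hu hv => (h2 hu hv).mono hk⟩
    · have ih' := fun j hj => ih (p j) (p (j + 1)) (hadj j hj) (ε + j)
      set z : ℕ → ℤ := fun j => lift (h (p j)) (ε + j) with hz
      have hz0 : z 0 = lift (h (p 0)) ε := rfl
      have hzk : z (k - 1) = lift (h (p (k - 1))) (ε + 1) := hlast _ _
      rw [← hz0, ← hzk]
      refine ⟨Defect.succ (by omega) fun j hj => (ih' j hj).1, fun hu hv => ?_⟩
      -- A step crossing from negative to nonnegative positions; the crossing invariant is applied
      -- to it, and only defects to the rest of the path.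
      obtain ⟨j, hj, hj1, hj2⟩ : ∃ j, j < k - 1 ∧ z j < 0 ∧ 0 ≤ z (j + 1) := by
        by_contra hcon
        push Not at hcon
        have : ∀ j ≤ k - 1, z j < 0 := by
          intro j hj
          induction j with
          | zero => exact hu
          | succ j ihj => exact hcon j (by omega) (ihj (by omega))
        exact absurd hv (this _ le_rfl).not_ge
      have hl := Defect.sum (k := k) (i := i + 1) (z := z) (Nat.zero_le j)
        fun l _ hl => (ih' l (by omega)).1
      have hr := Defect.sum (k := k) (i := i + 1) (z := z) (show j + 1 ≤ k - 1 by omega)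
        fun l _ hl => (ih' l hl).1
      refine ((ih' j hj).2 hj1 hj2).succ hk (l := j - 0) (r := k - 1 - (j + 1)) (by omega) ?_ ?_
      · convert hl using 1
        have h1 : z 0 = -1 - h (p 0) := hneg _ _ hu
        have h2 : z j = -1 - h (p j) := hneg _ _ hj1
        rw [h1, h2]
        ring
      · convert hr using 1
        have h1 : z (k - 1) = h (p (k - 1)) := hnonneg _ _ hv
        have h2 : z (j + 1) = h (p (j + 1)) := hnonneg _ _ hj2
        rw [h1, h2]

/-- The twins `u` and `v` are joined by a walk of length `2 * H + 1` through the edge in level `0`,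
so they are adjacent in any stable graph of the process; `not_crossing` excludes this at time `t`.
-/
theorem lt_bootstrapTime (T : IsTwinPath G h H) (hm : 1 ≤ m) (hk : k = 2 * m + 2) {f : ℕ → V}
    (hf : ∀ j ≤ H, h (f j) = j) {z u v : V} (hz : h z = 0) (hzf : z ≠ f 0) (hu : h u = H)
    (hv : h v = H) (huv : u ≠ v) (hkH : k ≤ H) {t : ℕ} (ht : 1 ≤ t)
    (hH : 2 * H + 1 + (k - 1) * (k - 4) = (k - 1) ^ t) : t < bootstrapTime (cycleGraph k) G := by
  classical
  by_contra hcon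
  rw [not_lt, bootstrapTime_le_iff] at hcon
  have hst := cycleProc_stable (by omega) hcon
  have hle : G ≤ cycleProc k G t := cycleProc_mono _ (Nat.zero_le t)
  have hf0 : h (f 0) = 0 := hf 0 (by omega)
  have hreach : ∀ w, G.Reachable w (f 0) := by
    intro w
    rcases Nat.eq_zero_or_pos (h w) with h0 | h0
    · by_cases hw : w = f 0
      · rw [hw]
      · exact ((T.adj_iff _ _).2 (Or.inr (Or.inr ⟨hw, h0, hf0⟩))).reachable
    · obtain ⟨p, -⟩ := T.exists_walk hf h0 hf0
      exact p.reachable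
  have hfinj : Set.InjOn f (Set.Iic H) := by
    intro a ha b hb hab
    rw [← hf a ha, ← hf b hb, hab]
  have htwo := T.two_le
  have hadj : (cycleProc k G t).Adj u v := by
    refine hst.adj_of_walk (by omega)
      (fun a b => ((hreach a).trans (hreach b).symm).mono hle) (x := f 0) (y := f (k - 1))
      ⟨f, rfl, rfl, fun j hj => hle ((T.adj_iff _ _).2 (Or.inl ?_)), hfinj.mono ?_⟩
      (S := (Finset.range (k + 1)).image f) ?_ huv (Or.inr ?_)
    · rw [hf _ (by omega), hf _ (by omega)]
    · intro j hj
      simp only [Set.mem_Iic] at hj ⊢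
      omega
    · rw [Finset.card_image_of_injOn, Finset.card_range]
      · omega
      · refine hfinj.mono fun j hj => ?_
        simp at hj ⊢
        omega
    · obtain ⟨p, hp⟩ := T.exists_walk hf (v := u) (by omega) hf0
      obtain ⟨q, hq⟩ := T.exists_walk hf (v := v) (by omega) hz
      have hzf' : G.Adj (f 0) z := (T.adj_iff _ _).2 (Or.inr (Or.inr ⟨hzf.symm, hf0, hz⟩))
      refine ⟨(p.append (q.reverse.cons hzf')).mapLe hle, ⟨H, ?_⟩⟩
      simp [hp, hq, hu, hv]
      omega
  obtain ⟨i, rfl⟩ : ∃ i, t = i + 1 := ⟨t - 1, by omega⟩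
  -- Starting parity `H + 1` puts `u` at `-1 - H` and `v` at `H`, so the edge does cross.
  have key := (T.defect_and_crossing hm hk i u v hadj (H + 1)).2
  rw [hu, hv] at key
  refine not_crossing hk ?_ (key ?_ ?_)
  · zify [show 1 ≤ k by omega, show 4 ≤ k by omega] at hH
    exact hH
  · rcases lift_cases H (H + 1) with h1 | h1 <;> omega
  · rcases lift_cases H (H + 1 + 1) with h1 | h1 <;> omega

end

end IsTwinPath

/-- The level of a vertex in `twinPath`. -/
def twinLevel (n H : ℕ) (v : Fin n) : ℕ := min (v - 1) H

/-- The path with `H + 1` levels on `n` vertices whose first level has two adjacent vertices and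
whose last level has `n - H - 1` vertices. -/
def twinPath (n H : ℕ) : SimpleGraph (Fin n) where
  Adj u v := twinLevel n H u + 1 = twinLevel n H v ∨ twinLevel n H v + 1 = twinLevel n H u ∨
    u ≠ v ∧ twinLevel n H u = 0 ∧ twinLevel n H v = 0
  symm := ⟨fun u v h => by rcases h with h | h | ⟨h1, h2, h3⟩ <;> [right; left; skip] <;> tauto⟩
  loopless := ⟨fun u h => by rcases h with h | h | ⟨h1, -⟩ <;> [omega; omega; exact h1 rfl]⟩

theorem isTwinPath_twinPath {n H : ℕ} (hH : 2 ≤ H) :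
    IsTwinPath (twinPath n H) (twinLevel n H) H where
  two_le := hH
  le _ := min_le_right _ _
  adj_iff _ _ := Iff.rfl
  eq_of_eq u v h h0 hH := by
    unfold twinLevel at *
    apply Fin.ext
    omega
  zero u v w hu hv hw := by
    unfold twinLevel at *
    simp only [Fin.ext_iff]
    omega

theorem lt_bootstrapTime_twinPath {k n H t : ℕ} (hk : 4 ≤ k) (hke : Even k) (hkH : k ≤ H)
    (hn : H + 3 ≤ n) (ht : 1 ≤ t) (hH : 2 * H + 1 + (k - 1) * (k - 4) = (k - 1) ^ t) :
    t < bootstrapTime (cycleGraph k) (twinPath n H) := by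
  obtain ⟨m, hm⟩ := hke
  refine (isTwinPath_twinPath (by omega)).lt_bootstrapTime (m := m - 1) (by omega) (by omega)
    (f := fun j => ⟨min (j + 1) (n - 1), by omega⟩) (z := ⟨0, by omega⟩) (u := ⟨H + 1, by omega⟩)
    (v := ⟨H + 2, by omega⟩) ?_ ?_ ?_ ?_ ?_ ?_ hkH ht hH
  · intro j hj
    simp only [twinLevel]
    omega
  · simp [twinLevel]
  · simp
    omega
  · simp [twinLevel]
  · simp [twinLevel]
  · simp

/-! ### The exact value -/

theorem maxBootstrapTime_cycleGraph_eq {k n X : ℕ} (hk : 3 ≤ k) {x : ℝ} (hx : x = X)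
    (hT : 1 ≤ Nat.clog (k - 1) X)
    (hup : ∀ G : SimpleGraph (Fin n), bootstrapTime (cycleGraph k) G ≤ Nat.clog (k - 1) X)
    (hlow : ∃ G : SimpleGraph (Fin n), Nat.clog (k - 1) X - 1 < bootstrapTime (cycleGraph k) G) :
    (maxBootstrapTime (cycleGraph k) n : ℤ) = ⌈Real.logb ((k : ℝ) - 1) x⌉ := by
  classical
  have hcast : (k : ℝ) - 1 = ((k - 1 : ℕ) : ℝ) := by
    push_cast [show 1 ≤ k by omega]
    rfl
  rw [hx, hcast, Real.ceil_logb_natCast (Nat.cast_nonneg _), Int.clog_natCast, Nat.cast_inj]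
  obtain ⟨G, hG⟩ := hlow
  unfold maxBootstrapTime
  refine le_antisymm (Finset.sup_le fun G _ => hup G) ?_
  refine le_trans ?_ (Finset.le_sup (Finset.mem_univ G))
  omega

end SimpleGraph

theorem theorem1p2 (k : ℕ) (hk : 3 ≤ k) :
    ∃ N : ℕ, ∀ n : ℕ, N ≤ n →
      (Odd k →
        (SimpleGraph.maxBootstrapTime (SimpleGraph.cycleGraph k) n : ℤ) =
          ⌈Real.logb ((k : ℝ) - 1) ((n : ℝ) + (k : ℝ) ^ 2 - 4 * (k : ℝ) + 2)⌉) ∧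
      (Even k →
        (SimpleGraph.maxBootstrapTime (SimpleGraph.cycleGraph k) n : ℤ) =
          ⌈Real.logb ((k : ℝ) - 1) (2 * (n : ℝ) + (k : ℝ) ^ 2 - 5 * (k : ℝ))⌉) := by
  -- For large `n` the exponent `Nat.clog (k - 1) X - 1`, which is the time `t` in the lower bounds,
  -- exceeds any prescribed constant, and so does its power.
  have large : ∀ τ X : ℕ, (k - 1) ^ (τ + 1) < X → τ ≤ Nat.clog (k - 1) X - 1 ∧
      1 ≤ Nat.clog (k - 1) X ∧ (k - 1) ^ (Nat.clog (k - 1) X - 1) < X ∧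
      X ≤ (k - 1) ^ Nat.clog (k - 1) X ∧ τ < (k - 1) ^ (Nat.clog (k - 1) X - 1) := by
    intro τ X hX
    have h1 : τ + 1 < Nat.clog (k - 1) X := (Nat.lt_clog_iff_pow_lt (by omega)).2 hX
    have h2 : Nat.clog (k - 1) X - 1 < (k - 1) ^ (Nat.clog (k - 1) X - 1) :=
      Nat.lt_pow_self (by omega)
    exact ⟨by omega, by omega, (Nat.lt_clog_iff_pow_lt (by omega)).1 (by omega),
      Nat.le_pow_clog (by omega) _, by omega⟩
  rcases Nat.even_or_odd k with hke | hko
  · have hk4 : 4 ≤ k := by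
      rw [Nat.even_iff] at hke
      omega
    obtain ⟨t₀, h⟩ := SimpleGraph.cycleProc_eq_succ_of_even hk4 hke
    refine ⟨(k - 1) ^ (t₀ + 3 * (k * k) + 1) + 5 * k + 1, fun n hn =>
      ⟨fun hko => absurd hke (Nat.not_even_iff_odd.2 hko), fun _ => ?_⟩⟩
    have hkk : 4 * k ≤ k * k := Nat.mul_le_mul_right k hk4
    have hK : (k - 1) * (k - 4) + 5 * k = k * k + 4 := by
      obtain ⟨q, rfl⟩ : ∃ q, k = q + 4 := ⟨k - 4, by omega⟩
      rw [show q + 4 - 1 = q + 3 by omega, Nat.add_sub_cancel]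
      ring
    obtain ⟨X, hX⟩ : ∃ X, X + 5 * k = 2 * n + k * k := ⟨2 * n + k * k - 5 * k, by omega⟩
    obtain ⟨h1, h2, h3, h4, h5⟩ := large (t₀ + 3 * (k * k)) X (by omega)
    refine SimpleGraph.maxBootstrapTime_cycleGraph_eq hk (X := X) ?_ h2 (fun G => ?_) ?_
    · have : (X : ℝ) + 5 * k = 2 * n + k * k := by exact_mod_cast hX
      linarith
    · rw [SimpleGraph.bootstrapTime_le_iff]
      exact h G _ (by omega) (by rw [Fintype.card_fin]; omega)
    · have hodd : Odd ((k - 1) ^ (Nat.clog (k - 1) X - 1)) := by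
        refine Odd.pow ?_
        rw [Nat.odd_sub (by omega)]
        simp [hke]
      have hKe : Even ((k - 1) * (k - 4)) := by
        refine Even.mul_left ?_ _
        rw [Nat.even_sub hk4]
        simp [hke, show Even 4 by decide]
      rw [Nat.odd_iff] at hodd
      rw [Nat.even_iff] at hKe
      generalize hT : Nat.clog (k - 1) X - 1 = t at *
      -- `H` solves `2 * H + 1 + (k - 1) * (k - 4) = (k - 1) ^ t`; the division is exact by the two
      -- parities above.
      refine ⟨SimpleGraph.twinPath n (((k - 1) ^ t - (k - 1) * (k - 4) - 1) / 2),
        SimpleGraph.lt_bootstrapTime_twinPath hk4 hke ?_ ?_ ?_ ?_⟩ <;> omega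
  · obtain ⟨t₀, h⟩ := SimpleGraph.cycleProc_eq_succ_of_odd hk hko
    refine ⟨(k - 1) ^ (t₀ + 3 * (k * k) + 1) + 5 * k + 1, fun n hn =>
      ⟨fun _ => ?_, fun hke => absurd hke (Nat.not_even_iff_odd.2 hko)⟩⟩
    have hkk : 3 * k ≤ k * k := Nat.mul_le_mul_right k hk
    have hK : (k - 1) * (k - 3) + 4 * k = k * k + 3 := by
      obtain ⟨q, rfl⟩ : ∃ q, k = q + 3 := ⟨k - 3, by omega⟩
      rw [show q + 3 - 1 = q + 2 by omega, Nat.add_sub_cancel]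
      ring
    obtain ⟨X, hX⟩ : ∃ X, X + 4 * k = n + k * k + 2 := ⟨n + k * k + 2 - 4 * k, by omega⟩
    obtain ⟨h1, h2, h3, h4, h5⟩ := large (t₀ + 3 * (k * k)) X (by omega)
    refine SimpleGraph.maxBootstrapTime_cycleGraph_eq hk (X := X) ?_ h2 (fun G => ?_) ?_
    · have : (X : ℝ) + 4 * k = n + k * k + 2 := by exact_mod_cast hX
      linarith
    · rw [SimpleGraph.bootstrapTime_le_iff]
      exact h G _ (by omega) (by rw [Fintype.card_fin]; omega)
    · exact ⟨SimpleGraph.pathGraph n, SimpleGraph.lt_bootstrapTime_pathGraph hk hko (by omega) (by omega) (by omega)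
        (by omega)⟩
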